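/- Let $M$ be a von Neumann algebra and $A\subset M$ a MASA (maximal abelian $*$-subalgebra) that is the range of a normal conditional expectation $E_A:M\to A$. Write $M_{sa}$ for the set of self-adjoint elements of $M$, and "so" for the strong operator topology. **Definitions.** Let $\varepsilon>0$, $n\in\mathbb N$, $\kappa\ge 1$, $x\in M$. * $x$ is *$(\varepsilon,n)$ norm pavable over $A$* if there are projections $p_1,\dots,p_n\in A$ with $\sum_i p_i=1$ and $a\in A$ with $\|a\|\le\|x\|$ such that $\|\sum_i p_ixp_i-a\|\le\varepsilon\|x\|$. * $x$ is *$(\varepsilon,n)$ so-pavable over $A$* if for every so-neighborhood $\mathcal V$ of $0$ in $M$ there are projections $p_1,\dots,p_n\in A$ with $\sum_i p_i=1$, an element $a\in A$ with $\|a\|\le\|x\|$ and a projection $q\in M$ with $1-q\in\mathcal V$ and $\|q(\sum_i p_ixp_i-a)q\|\le\varepsilon\|x\|$. * $x$ is *$(\varepsilon,n;\kappa)$ app-pavable over $A$* if $x$ is the so-limit of a net of $(\varepsilon,n)$ norm pavable elements of $M$ of norm at most $\kappa\|x\|$. * $x$ is *norm pavable* (respectively *so-pavable*) if for every $\varepsilon>0$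 there is $n$ such that it is $(\varepsilon,n)$ norm pavable (respectively so-pavable); $x$ is *app-pavable* if there is $\kappa_0$ such that for every $\varepsilon>0$ there is $n$ such that $x$ is $(\varepsilon,n;\kappa_0)$ app-pavable. * $A\subset M$ has the *so-paving* (respectively *app-paving*) *property* if every $x\in M_{sa}$ is so-pavable (respectively app-pavable). It has the *uniform so-paving property* if for every $\varepsilon>0$ there is $n$ such that every $x\in M_{sa}$ is $(\varepsilon,n)$ so-pavable, and the *uniform (norm) paving property* if for every $\varepsilon>0$ there is $n$ such that every $x\in M$ is $(\varepsilon,n)$ norm pavable. The norm notions are used in the same way for other inclusions. * $A$ is *countably decomposable* if it carries a normal faithful state. * Let $\omega$ be a free ultrafilter on $\mathbb N$. Let $I_\omega\subset\ell^\infty(\mathbb N,M)$ be the set of bounded sequences converging to $0$ in the strong-$*$ topology along $\omega$, let $M^{0,\omega}=\{f\in\ell^\infty(\mathbb N,M): fI_\omega\subset I_\omega,\ I_\omega f\subset I_\omega\}$, and let $M^\omega=M^{0,\omega}/I_\omega$ be the Ocneanu ultrapower, with the quotient norm; $M\subset M^\omega$ through constant sequences. If $A$ is countably decomposable, then $\ell^\infty(\mathbb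 N,A)\subset M^{0,\omega}$, and $A^\omega\subset M^\omega$ is the set of classes of the bounded sequences in $A$. **Theorem.** 1. Let $x\in M_{sa}$, $n\in\mathbb N$, $\varepsilon>0$. If $x$ is $(\varepsilon,n;\kappa)$ app-pavable for some $\kappa\ge1$, then $x$ is $(2\kappa\varepsilon',n)$ so-pavable for every $\varepsilon'>\varepsilon$. If $x$ is $(\varepsilon,n)$ so-pavable, then $x$ is $(\varepsilon',n;3)$ app-pavable for every $\varepsilon'>\varepsilon$. Hence $x\in M_{sa}$ is so-pavable over $A$ if and only if it is app-pavable over $A$, and $A\subset M$ has the so-paving property if and only if it has the app-paving property. 2. Assume that $A$ is countably decomposable. Then $x\in M_{sa}$ is so-pavable over $A$ if and only if $x$, as an element of $M^\omega$, is norm pavable over $A^\omega$. More precisely, for $\varepsilon>0$ and $n\in\mathbb N$: if $x$ is $(\varepsilon,n)$ so-pavable over $A$, then $x$ is $(\varepsilon,n)$ norm pavable over $A^\omega$; if $x$ is $(\varepsilon,n)$ norm pavable over $A^\omega$, then $x$ is $(\varepsilon',n)$ so-pavable over $A$ for every $\varepsilon'>\varepsilon$. 3. Assume that $A$ is countably decomposable.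 Then $A\subset M$ has the uniform so-paving property if and only if $A^\omega\subset M^\omega$ has the uniform norm paving property. More precisely, for $\varepsilon>0$ and $n\in\mathbb N$: if every $x\in M_{sa}$ is $(\varepsilon,n)$ so-pavable over $A$, then every self-adjoint $x\in M^\omega$ is $(\varepsilon,n)$ norm pavable over $A^\omega$. -/

import Mathlib

open Topology
open scoped BoundedContinuousFunction ComplexOrder

noncomputable section

namespace Paving

section NormPaving

variable {R : Type*} [Ring R] [Star R] [Norm R]

/-- `x` is `(ε, n)` (norm) pavable over `A`. Here `A` is (the underlying set of) a
`*`-subalgebra of an ambient normed `*`-algebra. -/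
def IsPavableWith (A : Set R) (ε : ℝ) (n : ℕ) (x : R) : Prop :=
  ∃ (p : Fin n → R) (a : R),
    (∀ i, p i ∈ A ∧ IsStarProjection (p i)) ∧ a ∈ A ∧ ‖a‖ ≤ ‖x‖ ∧
    ∑ i, p i = 1 ∧ ‖∑ i, p i * x * p i - a‖ ≤ ε * ‖x‖

/-- `x` is (norm) pavable over `A`. -/
def IsPavable (A : Set R) (x : R) : Prop :=
  ∀ ε : ℝ, 0 < ε → ∃ n : ℕ, IsPavableWith A ε n x

/-- Uniform (norm) paving property of `A ⊆ R`: the number `n` of projections needed to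
`(ε, n)` pave an element of `R` can be chosen independently of the element. -/
def UniformPaving (A : Set R) : Prop :=
  ∀ ε : ℝ, 0 < ε → ∃ n : ℕ, ∀ x : R, IsPavableWith A ε n x

end NormPaving

section Hilbert

variable {H : Type*} [NormedAddCommGroup H] [InnerProductSpace ℂ H] [CompleteSpace H]

/-- The bounded operator `T`, seen in `B(H)` with the strong operator topology. -/
abbrev so (T : H →L[ℂ] H) : H →Lₚₜ[ℂ] H :=
  ContinuousLinearMap.toPointwiseConvergenceCLM ℂ (RingHom.id ℂ) H H T

/-- `x` is `(ε, n)` so-pavable over `A ⊆ M`. -/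
def IsSoPavableWith (M A : VonNeumannAlgebra H) (ε : ℝ) (n : ℕ) (x : H →L[ℂ] H) : Prop :=
  ∀ V ∈ 𝓝 (0 : H →Lₚₜ[ℂ] H),
    ∃ (p : Fin n → H →L[ℂ] H) (a q : H →L[ℂ] H),
      (∀ i, p i ∈ A ∧ IsStarProjection (p i)) ∧ a ∈ A ∧ (q ∈ M ∧ IsStarProjection q) ∧
      ‖a‖ ≤ ‖x‖ ∧ ∑ i, p i = 1 ∧
      ‖q * (∑ i, p i * x * p i - a) * q‖ ≤ ε * ‖x‖ ∧ so (1 - q) ∈ V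

/-- `x` is so-pavable over `A ⊆ M`. -/
def IsSoPavable (M A : VonNeumannAlgebra H) (x : H →L[ℂ] H) : Prop :=
  ∀ ε : ℝ, 0 < ε → ∃ n : ℕ, IsSoPavableWith M A ε n x

/-- The so-paving property of `A ⊆ M`. -/
def SoPavingProperty (M A : VonNeumannAlgebra H) : Prop :=
  ∀ x ∈ M, IsSelfAdjoint x → IsSoPavable M A x

/-- The uniform so-paving property of `A ⊆ M`. -/
def UniformSoPaving (M A : VonNeumannAlgebra H) : Prop :=
  ∀ ε : ℝ, 0 < ε → ∃ n : ℕ, ∀ x ∈ M, IsSelfAdjoint x → IsSoPavableWith M A ε n x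

/-- `x` is `(ε, n; κ)` app-pavable over `A ⊆ M`: it is a limit, in the strong operator
topology, of a net of `(ε, n)` pavable elements of `M` of norm at most `κ ‖x‖`. -/
def IsAppPavableWith (M A : VonNeumannAlgebra H) (ε : ℝ) (n : ℕ) (κ : ℝ) (x : H →L[ℂ] H) :
    Prop :=
  so x ∈ closure
    (so '' {y : H →L[ℂ] H | y ∈ M ∧ IsPavableWith (A : Set (H →L[ℂ] H)) ε n y ∧ ‖y‖ ≤ κ * ‖x‖})

/-- `x` is app-pavable over `A ⊆ M`. -/
def IsAppPavable (M A : VonNeumannAlgebra H) (x : H →L[ℂ] H) : Prop :=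
  ∃ κ₀ : ℝ, ∀ ε : ℝ, 0 < ε → ∃ n : ℕ, IsAppPavableWith M A ε n κ₀ x

/-- The app-paving property of `A ⊆ M`. -/
def AppPavingProperty (M A : VonNeumannAlgebra H) : Prop :=
  ∀ x ∈ M, IsSelfAdjoint x → IsAppPavable M A x

/-- `A` is a maximal abelian `*`-subalgebra of `M`: `A ⊆ M` and `A' ∩ M = A`. -/
def IsMASA (A M : VonNeumannAlgebra H) : Prop :=
  A ≤ M ∧ ∀ x ∈ M, x ∈ A ↔ ∀ a ∈ A, a * x = x * a

variable (H) in
/-- The σ-weak (ultraweak) topology on `B(H)`, generated by the functionals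
`T ↦ ∑ₙ ⟪ξₙ, T ηₙ⟫` with `ξ, η ∈ ℓ²(ℕ, H)`. -/
abbrev sigmaWeakTopology : TopologicalSpace (H →L[ℂ] H) :=
  ⨅ (ξ : lp (fun _ : ℕ => H) 2) (η : lp (fun _ : ℕ => H) 2),
    TopologicalSpace.induced (fun T : H →L[ℂ] H => ∑' n, inner ℂ (ξ n) (T (η n))) inferInstance

/-- The σ-weak topology on a von Neumann algebra. -/
abbrev sigmaWeakOn (M : VonNeumannAlgebra H) : TopologicalSpace M.toStarSubalgebra :=
  TopologicalSpace.induced (fun x => (x : H →L[ℂ] H)) (sigmaWeakTopology H)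

/-- `E` is a normal conditional expectation of `M` onto `A`: a positive, `A`-bimodular linear
map of `M` onto `A`, equal to the identity on `A` and continuous for the σ-weak topologies. -/
structure IsNormalConditionalExpectation (M A : VonNeumannAlgebra H)
    (E : M.toStarSubalgebra →ₗ[ℂ] A.toStarSubalgebra) : Prop where
  map_of_mem : ∀ x : M.toStarSubalgebra, (x : H →L[ℂ] H) ∈ A →
    (E x : H →L[ℂ] H) = x
  positive : ∀ x : M.toStarSubalgebra, (E (star x * x) : H →L[ℂ] H).IsPositive
  bimodule : ∀ a x b : M.toStarSubalgebra, (a : H →L[ℂ] H) ∈ A → (b : H →L[ℂ] H) ∈ A →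
    (E (a * x * b) : H →L[ℂ] H) = (a : H →L[ℂ] H) * E x * b
  normal : @Continuous _ _ (sigmaWeakOn M) (sigmaWeakOn A) E

/-- `φ` is a normal faithful state on `A`. -/
structure IsNormalFaithfulState (A : VonNeumannAlgebra H)
    (φ : A.toStarSubalgebra →ₗ[ℂ] ℂ) : Prop where
  map_one : φ 1 = 1
  nonneg : ∀ a, 0 ≤ φ (star a * a)
  faithful : ∀ a, φ (star a * a) = 0 → a = 0
  normal : @Continuous _ _ (sigmaWeakOn A) inferInstance φ

/-- `A` is countably decomposable, i.e. there is a normal faithful state on `A`. -/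
def IsCountablyDecomposable (A : VonNeumannAlgebra H) : Prop :=
  ∃ φ : A.toStarSubalgebra →ₗ[ℂ] ℂ, IsNormalFaithfulState A φ

/-! ### The Ocneanu ultrapower

`ℓ^∞(ℕ, M)` is the set of those `f : ℕ →ᵇ (H →L[ℂ] H)` with `f m ∈ M` for all `m`.
-/

/-- `I_ω`: the bounded sequences in `M` that converge to `0` in the strong-`*` topology along
`ω`. -/
def nullSeq (M : VonNeumannAlgebra H) (ω : Ultrafilter ℕ) : Set (ℕ →ᵇ (H →L[ℂ] H)) :=
  {f | (∀ m, f m ∈ M) ∧ ∀ ξ : H,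
    Filter.Tendsto (fun m => f m ξ) ω (𝓝 0) ∧ Filter.Tendsto (fun m => star (f m) ξ) ω (𝓝 0)}

section nullSeq

variable {M : VonNeumannAlgebra H} {ω : Ultrafilter ℕ}

theorem zero_mem_nullSeq : (0 : ℕ →ᵇ (H →L[ℂ] H)) ∈ nullSeq M ω :=
  ⟨fun _ => zero_mem M, fun ξ => by simp⟩

theorem add_mem_nullSeq {f g : ℕ →ᵇ (H →L[ℂ] H)} (hf : f ∈ nullSeq M ω)
    (hg : g ∈ nullSeq M ω) : f + g ∈ nullSeq M ω := by
  refine ⟨fun m => add_mem (hf.1 m) (hg.1 m), fun ξ => ⟨?_, ?_⟩⟩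
  · simpa using (hf.2 ξ).1.add (hg.2 ξ).1
  · simpa using (hf.2 ξ).2.add (hg.2 ξ).2

theorem neg_mem_nullSeq {f : ℕ →ᵇ (H →L[ℂ] H)} (hf : f ∈ nullSeq M ω) :
    -f ∈ nullSeq M ω := by
  refine ⟨fun m => neg_mem (hf.1 m), fun ξ => ⟨?_, ?_⟩⟩
  · simpa using (hf.2 ξ).1.neg
  · simpa using (hf.2 ξ).2.neg

theorem star_mem_nullSeq {f : ℕ →ᵇ (H →L[ℂ] H)} (hf : f ∈ nullSeq M ω) :
    star f ∈ nullSeq M ω := by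
  refine ⟨fun m => star_mem (hf.1 m), fun ξ => ⟨?_, ?_⟩⟩
  · simpa using (hf.2 ξ).2
  · simpa using (hf.2 ξ).1

/-- A bounded sequence of operators applied to a null sequence of vectors is null. -/
theorem tendsto_apply_zero (f : ℕ →ᵇ (H →L[ℂ] H)) {u : ℕ → H}
    (hu : Filter.Tendsto u ω (𝓝 0)) : Filter.Tendsto (fun m => f m (u m)) ω (𝓝 0) := by
  have h : Filter.Tendsto (fun m => ‖f‖ * ‖u m‖) ω (𝓝 0) := by
    simpa using hu.norm.const_mul ‖f‖
  refine squeeze_zero_norm (fun m => ?_) h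
  exact ((f m).le_opNorm _).trans
    (mul_le_mul_of_nonneg_right (f.norm_coe_le_norm m) (norm_nonneg _))

theorem mul_mem_nullSeq {f g : ℕ →ᵇ (H →L[ℂ] H)} (hf : f ∈ nullSeq M ω)
    (hg : g ∈ nullSeq M ω) : f * g ∈ nullSeq M ω := by
  refine ⟨fun m => mul_mem (hf.1 m) (hg.1 m), fun ξ => ⟨?_, ?_⟩⟩
  · simpa using tendsto_apply_zero f (hg.2 ξ).1
  · simpa using tendsto_apply_zero (star g) (hf.2 ξ).2

end nullSeq

/-- `M^{0,ω}`: the multiplier (bi-normalizer) of `I_ω` in `ℓ^∞(ℕ, M)`. -/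
def multiplier (M : VonNeumannAlgebra H) (ω : Ultrafilter ℕ) :
    StarSubalgebra ℂ (ℕ →ᵇ (H →L[ℂ] H)) where
  carrier := {f | (∀ m, f m ∈ M) ∧ ∀ g ∈ nullSeq M ω, f * g ∈ nullSeq M ω ∧ g * f ∈ nullSeq M ω}
  mul_mem' {f g} hf hg := by
    refine ⟨fun m => mul_mem (hf.1 m) (hg.1 m), fun k hk => ⟨?_, ?_⟩⟩
    · rw [mul_assoc]; exact (hf.2 _ (hg.2 k hk).1).1
    · rw [← mul_assoc]; exact (hg.2 _ (hf.2 k hk).2).2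
  add_mem' {f g} hf hg := by
    refine ⟨fun m => add_mem (hf.1 m) (hg.1 m), fun k hk => ⟨?_, ?_⟩⟩
    · rw [add_mul]; exact add_mem_nullSeq (hf.2 k hk).1 (hg.2 k hk).1
    · rw [mul_add]; exact add_mem_nullSeq (hf.2 k hk).2 (hg.2 k hk).2
  algebraMap_mem' c := by
    refine ⟨fun m => M.toStarSubalgebra.algebraMap_mem c, fun k hk => ?_⟩
    have h : c • k ∈ nullSeq M ω := by
      refine ⟨fun m => M.toStarSubalgebra.smul_mem (hk.1 m) c, fun ξ => ⟨?_, ?_⟩⟩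
      · simpa using (hk.2 ξ).1.const_smul c
      · simpa using (hk.2 ξ).2.const_smul (star c)
    rw [← Algebra.commutes c k, ← Algebra.smul_def]
    exact ⟨h, h⟩
  star_mem' {f} hf := by
    refine ⟨fun m => star_mem (hf.1 m), fun k hk => ⟨?_, ?_⟩⟩
    · have h : star f * k = star (star k * f) := by ext; simp
      rw [h]; exact star_mem_nullSeq (hf.2 _ (star_mem_nullSeq hk)).2
    · have h : k * star f = star (f * star k) := by ext; simp
      rw [h]; exact star_mem_nullSeq (hf.2 _ (star_mem_nullSeq hk)).1

/-- `I_ω`, as an ideal of `M^{0,ω}`. -/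
def nullIdeal (M : VonNeumannAlgebra H) (ω : Ultrafilter ℕ) : Ideal (multiplier M ω) where
  carrier := {f | (f : ℕ →ᵇ (H →L[ℂ] H)) ∈ nullSeq M ω}
  add_mem' hf hg := add_mem_nullSeq hf hg
  zero_mem' := zero_mem_nullSeq
  smul_mem' c _ hf := (c.2.2 _ hf).1

theorem nullSeq_subset_multiplier (M : VonNeumannAlgebra H) (ω : Ultrafilter ℕ) :
    nullSeq M ω ⊆ multiplier M ω :=
  fun _ hf => ⟨hf.1, fun _ hg => ⟨mul_mem_nullSeq hf hg, mul_mem_nullSeq hg hf⟩⟩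

instance (M : VonNeumannAlgebra H) (ω : Ultrafilter ℕ) : (nullIdeal M ω).IsTwoSided :=
  ⟨fun b hf => (b.2.2 _ hf).2⟩

/-- The Ocneanu ultrapower `M^ω = M^{0,ω} / I_ω`. -/
def Ultrapower (M : VonNeumannAlgebra H) (ω : Ultrafilter ℕ) : Type _ :=
  multiplier M ω ⧸ nullIdeal M ω

namespace Ultrapower

variable (M : VonNeumannAlgebra H) (ω : Ultrafilter ℕ)

instance : Ring (Ultrapower M ω) := Ideal.Quotient.ring (nullIdeal M ω)

/-- The class in `M^ω` of a sequence in `M^{0,ω}`. -/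
def mk : multiplier M ω →+* Ultrapower M ω := Ideal.Quotient.mk (nullIdeal M ω)

/-- The quotient norm: the infimum of the sup-norms of the representing sequences. -/
instance : Norm (Ultrapower M ω) where
  norm z := sInf {r : ℝ | ∃ f : multiplier M ω, mk M ω f = z ∧ r = ‖f‖}

/-- The involution, applied termwise to representing sequences. -/
instance : Star (Ultrapower M ω) where
  star := Quotient.lift (fun f : multiplier M ω => mk M ω (star f)) fun f g h => by
    refine Ideal.Quotient.eq.2 ?_
    have h' : f - g ∈ nullIdeal M ω := Ideal.Quotient.eq.1 (Quotient.sound h)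
    have e : star f - star g = star (f - g) := Subtype.ext (by ext; simp)
    rw [e]
    exact star_mem_nullSeq h'

theorem star_mk (f : multiplier M ω) : star (mk M ω f) = mk M ω (star f) := rfl

variable {M} in
/-- The natural embedding `M ⊆ M^ω` by constant sequences. -/
def ofElement (x : H →L[ℂ] H) (hx : x ∈ M) : Ultrapower M ω :=
  mk M ω ⟨BoundedContinuousFunction.const ℕ x, fun _ => hx, fun g hg => by
    refine ⟨⟨fun m => mul_mem hx (hg.1 m), fun ξ => ⟨?_, ?_⟩⟩,
      ⟨fun m => mul_mem (hg.1 m) hx, fun ξ => ⟨?_, ?_⟩⟩⟩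
    · simpa using tendsto_apply_zero (BoundedContinuousFunction.const ℕ x) (hg.2 ξ).1
    · simpa using (hg.2 (star x ξ)).2
    · simpa using (hg.2 (x ξ)).1
    · simpa using tendsto_apply_zero (BoundedContinuousFunction.const ℕ (star x)) (hg.2 ξ).2⟩

/-- `A^ω ⊆ M^ω`: the classes of the bounded sequences in `A`. (A sequence has a class in `M^ω`
when it lies in `M^{0,ω}`. If `A` is countably decomposable and the range of a normal
conditional expectation, every bounded sequence in `A` does so, and this set is
`(ℓ^∞(ℕ, A) + I_ω) / I_ω`.) -/
def ofSubalgebra (A : VonNeumannAlgebra H) : Set (Ultrapower M ω) :=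
  {z | ∃ f : multiplier M ω, (∀ m, (f : ℕ →ᵇ (H →L[ℂ] H)) m ∈ A) ∧ mk M ω f = z}

end Ultrapower

end Hilbert

end Paving

end

/-! Everything rests on one fact: a normal conditional expectation `F` onto a MASA `A` is faithful
(`IsNormalExpectation.faithful`). The left kernel of `F` has a positive right unit `u` with `F u =
0`. This `u` commutes with `A`, so it lies in `A`, whence `u = F u = 0`. Together with weak
compactness of bounded sets, faithfulness shows that a bounded net `T` in `M` is strongly null
exactly when `F (T* T)` is weakly null. Since `A` is abelian, `F (a* T* T a) = a* F (T* T) a ≤ ‖a‖²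
F (T* T)`. Bounded strongly null nets are therefore stable under right multiplication by bounded
nets in `A` (`strongTendsto_mul_right`), and bounded nets in `A` are multipliers of the strong-*
null nets (`mem_multNets`).

From app-paving to so-paving: let `y → x` strongly, with `y` paved by `p`. Split `∑ p x p - F x`
into `∑ p y p - F y`, bounded by `2 κ ε ‖x‖`, and the same expression for `x - y`, which is strongly
null. A strongly null error becomes small in norm after cutting by spectral projections tending to
`1` (`isSoPavableWith_of_net`).

From so-paving to app-paving: choose a paving for each strong neighbourhood of `0` and put `z = ∑ p
x p - b` with `b` self-adjoint in `A`. Then `z` and `q z q` agree modulo null nets, and so do their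
continuous functions. As `q z q` is bounded by `ε ‖x‖`, the part of `z` beyond that level is null
(`cfc_sub_clamp_mem_nullNets`). Subtracting it from `x` gives norm paved elements converging to `x`.

For the ultrapower, a normal faithful state on `A` composed with `F` detects strong convergence of
projections to `0`, so sequences replace nets and so-pavings taken term by term give a paving modulo
null sequences (`Ultrapower.exists_multiplier_paving`). Conversely, partitions of unity in `A^ω`
lift to sequences of partitions of unity in `A` (`exists_partition_of_asymptotic`), and the null
error is cut away as before. Self-adjoint classes have self-adjoint representatives of equal norm
(`Ultrapower.exists_selfAdjoint_rep`), which keeps `ε` and `n` unchanged. A general class is treated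
through real and imaginary parts and the product of the two partitions. -/

set_option linter.unusedSectionVars false

noncomputable section

namespace Paving

open Filter

/-! ### Weak and strong operator limits of nets -/

section WeakLimits

variable {H : Type*} [NormedAddCommGroup H] [InnerProductSpace ℂ H] {ι : Type*}

/-- Convergence in the weak operator topology. -/
def WeakTendsto (l : Filter ι) (T : ι → H →L[ℂ] H) (T₀ : H →L[ℂ] H) : Prop :=
  ∀ ξ η : H, Tendsto (fun i => inner ℂ ξ (T i η)) l (𝓝 (inner ℂ ξ (T₀ η)))

/-- Convergence in the strong operator topology. -/
def StrongTendsto (l : Filter ι) (T : ι → H →L[ℂ] H) (T₀ : H →L[ℂ] H) : Prop :=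
  ∀ ξ : H, Tendsto (fun i => T i ξ) l (𝓝 (T₀ ξ))

variable {l : Filter ι} {S T : ι → H →L[ℂ] H} {S₀ T₀ : H →L[ℂ] H}

theorem StrongTendsto.weakTendsto (h : StrongTendsto l T T₀) : WeakTendsto l T T₀ :=
  fun _ η => tendsto_const_nhds.inner (h η)

theorem StrongTendsto.add (hS : StrongTendsto l S S₀) (hT : StrongTendsto l T T₀) :
    StrongTendsto l (fun i => S i + T i) (S₀ + T₀) := fun ξ => by
  simpa using (hS ξ).add (hT ξ)

theorem StrongTendsto.sub (hS : StrongTendsto l S S₀) (hT : StrongTendsto l T T₀) :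
    StrongTendsto l (fun i => S i - T i) (S₀ - T₀) := fun ξ => by
  simpa using (hS ξ).sub (hT ξ)

theorem strongTendsto_const : StrongTendsto l (fun _ => T₀) T₀ := fun _ => tendsto_const_nhds

theorem WeakTendsto.mono {k : Filter ι} (h : WeakTendsto l T T₀) (hk : k ≤ l) :
    WeakTendsto k T T₀ := fun ξ η => (h ξ η).mono_left hk

theorem WeakTendsto.unique [l.NeBot] (hS : WeakTendsto l T S₀) (hT : WeakTendsto l T T₀) :
    S₀ = T₀ := by
  ext η
  exact ext_inner_left ℂ fun ξ => tendsto_nhds_unique (hS ξ η) (hT ξ η)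

theorem weakTendsto_const : WeakTendsto l (fun _ => T₀) T₀ := fun _ _ => tendsto_const_nhds

/-- A property holds along a filter if it holds along every finer ultrafilter. -/
theorem weakTendsto_of_ultrafilter
    (h : ∀ U : Ultrafilter ι, (U : Filter ι) ≤ l → WeakTendsto (U : Filter ι) T T₀) :
    WeakTendsto l T T₀ := fun ξ η =>
  (tendsto_iff_ultrafilter _ _ _).2 fun U hU => h U hU ξ η

/-- Bounded nets of operators have weak limits along ultrafilters. -/
theorem exists_weakTendsto [CompleteSpace H] (U : Ultrafilter ι) {C : ℝ}
    (hC : ∀ᶠ i in (U : Filter ι), ‖T i‖ ≤ C) :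
    ∃ T₀ : H →L[ℂ] H, WeakTendsto (U : Filter ι) T T₀ := by
  have hb : ∀ ξ η : H, ∀ᶠ i in (U : Filter ι), ‖inner ℂ (T i ξ) η‖ ≤ C * ‖ξ‖ * ‖η‖ := by
    intro ξ η
    filter_upwards [hC] with i hi
    refine (norm_inner_le_norm _ _).trans (mul_le_mul_of_nonneg_right ?_ (norm_nonneg _))
    exact ((T i).le_opNorm ξ).trans (mul_le_mul_of_nonneg_right hi (norm_nonneg _))
  have hlim : ∀ ξ η : H, ∃ c : ℂ, Tendsto (fun i => inner ℂ (T i ξ) η) (U : Filter ι) (𝓝 c) ∧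
      ‖c‖ ≤ C * ‖ξ‖ * ‖η‖ := by
    intro ξ η
    obtain ⟨c, hc, h⟩ := (isCompact_closedBall (0 : ℂ) (C * ‖ξ‖ * ‖η‖)).ultrafilter_le_nhds
      (U.map fun i => inner ℂ (T i ξ) η) (by
        rw [le_principal_iff, Ultrafilter.mem_coe, Ultrafilter.mem_map]
        filter_upwards [hb ξ η] with i hi
        simpa using hi)
    exact ⟨c, h, by simpa using hc⟩
  choose c hc hcb using hlim
  let B : H →ₗ⋆[ℂ] H →ₗ[ℂ] ℂ := LinearMap.mk₂'ₛₗ (starRingEnd ℂ) (RingHom.id ℂ) c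
    (fun x y z => tendsto_nhds_unique (hc _ _) (by
      simpa [inner_add_left] using (hc x z).add (hc y z)))
    (fun r x z => tendsto_nhds_unique (hc _ _) (by
      simpa [inner_smul_left, mul_comm] using (hc x z).const_mul (starRingEnd ℂ r)))
    (fun x y z => tendsto_nhds_unique (hc _ _) (by
      simpa [inner_add_right] using (hc x y).add (hc x z)))
    (fun r x z => tendsto_nhds_unique (hc _ _) (by
      simpa [inner_smul_right] using (hc x z).const_mul r))
  let B' : H →L⋆[ℂ] H →L[ℂ] ℂ := B.mkContinuous₂ C hcb
  refine ⟨InnerProductSpace.continuousLinearMapOfBilin B', fun ξ η => ?_⟩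
  have h1 : inner ℂ ξ ((InnerProductSpace.continuousLinearMapOfBilin B') η)
      = starRingEnd ℂ (c η ξ) := by
    rw [← inner_conj_symm, InnerProductSpace.continuousLinearMapOfBilin_apply]
    rfl
  rw [h1]
  simpa [Function.comp_def] using (Complex.continuous_conj.tendsto _).comp (hc η ξ)

variable [CompleteSpace H]

theorem WeakTendsto.star (h : WeakTendsto l T T₀) :
    WeakTendsto l (fun i => star (T i)) (star T₀) := fun ξ η => by
  have := (Complex.continuous_conj.tendsto _).comp (h η ξ)
  simpa [ContinuousLinearMap.star_eq_adjoint, ContinuousLinearMap.adjoint_inner_right,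
    Function.comp_def] using this

theorem WeakTendsto.mul_mul (h : WeakTendsto l T T₀) (a b : H →L[ℂ] H) :
    WeakTendsto l (fun i => a * T i * b) (a * T₀ * b) := fun ξ η => by
  simpa [ContinuousLinearMap.adjoint_inner_left] using
    h (ContinuousLinearMap.adjoint a ξ) (b η)

/-- `M` is its own bicommutant, and commuting with a fixed operator passes to weak limits. -/
theorem mem_of_weakTendsto [l.NeBot] (M : VonNeumannAlgebra H) (h : WeakTendsto l T T₀)
    (hM : ∀ᶠ i in l, T i ∈ M) : T₀ ∈ M := by
  rw [← M.commutant_commutant, VonNeumannAlgebra.mem_commutant_iff]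
  intro y hy
  have h1 := h.mul_mul y 1
  have h2 := h.mul_mul 1 y
  simp only [mul_one, one_mul] at h1 h2
  refine h1.unique fun ξ η => (h2 ξ η).congr' ?_
  filter_upwards [hM] with i hi
  rw [VonNeumannAlgebra.mem_commutant_iff.1 hy _ hi]

theorem nonneg_of_weakTendsto [l.NeBot] (h : WeakTendsto l T T₀)
    (hT : ∀ᶠ i in l, 0 ≤ T i) : 0 ≤ T₀ := by
  rw [ContinuousLinearMap.nonneg_iff_isPositive, ContinuousLinearMap.isPositive_iff']
  constructor
  · refine (h.star).unique fun ξ η => (h ξ η).congr' ?_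
    filter_upwards [hT] with i hi
    rw [(IsSelfAdjoint.of_nonneg hi).star_eq]
  · intro ξ
    have h1 := h ξ ξ
    have h2 : ∀ᶠ i in l, 0 ≤ inner ℂ ξ (T i ξ) := by
      filter_upwards [hT] with i hi
      exact ((ContinuousLinearMap.nonneg_iff_isPositive _).1 hi).inner_nonneg_right ξ
    have h3 := ge_of_tendsto h1 h2
    rw [← inner_conj_symm]
    exact star_nonneg_iff.2 h3

theorem le_of_weakTendsto [l.NeBot] (hS : WeakTendsto l S S₀) (hT : WeakTendsto l T T₀)
    (hle : ∀ᶠ i in l, S i ≤ T i) : S₀ ≤ T₀ := by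
  rw [← sub_nonneg]
  refine nonneg_of_weakTendsto (l := l) (T := fun i => T i - S i) ?_ ?_
  · intro ξ η
    simpa [inner_sub_right] using (hT ξ η).sub (hS ξ η)
  · filter_upwards [hle] with i hi using sub_nonneg.2 hi

/-- Weak convergence to `0` of positive operators is monotone. -/
theorem weakTendsto_zero_of_le (hS : ∀ᶠ i in l, 0 ≤ S i) (hle : ∀ᶠ i in l, S i ≤ T i)
    (hb : ∃ C : ℝ, ∀ᶠ i in l, ‖S i‖ ≤ C) (hT : WeakTendsto l T 0) : WeakTendsto l S 0 := by
  obtain ⟨C, hC⟩ := hb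
  refine weakTendsto_of_ultrafilter fun U hU => ?_
  obtain ⟨S₁, hS₁⟩ := exists_weakTendsto U (hC.filter_mono hU)
  have h1 := nonneg_of_weakTendsto hS₁ (hS.filter_mono hU)
  have h2 := le_of_weakTendsto hS₁ (hT.mono hU) (hle.filter_mono hU)
  rwa [le_antisymm h2 h1] at hS₁

/-- Since `⟪ξ, T* T ξ⟫ = ‖T ξ‖²`, questions about strong convergence become questions about weak
limits of positive operators, where compactness and order are available. -/
theorem strongTendsto_zero_iff :
    StrongTendsto l T 0 ↔ WeakTendsto l (fun i => star (T i) * T i) 0 := by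
  have key : ∀ ξ η i, inner ℂ ξ ((star (T i) * T i) η) = inner ℂ (T i ξ) (T i η) := by
    intro ξ η i
    simp [ContinuousLinearMap.star_eq_adjoint, ContinuousLinearMap.adjoint_inner_right]
  constructor
  · intro h ξ η
    simp only [key]
    simpa using (h ξ).inner (𝕜 := ℂ) (h η)
  · intro h ξ
    have h1 := h ξ ξ
    simp only [key, inner_self_eq_norm_sq_to_K] at h1
    have h2 := (continuous_norm.tendsto _).comp h1
    have h3 : Tendsto (fun i => ‖T i ξ‖ ^ 2) l (𝓝 0) := by
      simpa [Function.comp_def] using h2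
    have h4 := (Real.continuous_sqrt.tendsto _).comp h3
    rw [ContinuousLinearMap.zero_apply, tendsto_zero_iff_norm_tendsto_zero]
    simpa [Function.comp_def, Real.sqrt_sq (norm_nonneg _)] using h4

end WeakLimits

/-! ### Normal conditional expectations -/

section Expectation

variable {H : Type*} [NormedAddCommGroup H] [InnerProductSpace ℂ H] [CompleteSpace H]

section SigmaWeak

variable {ι : Type*} {l : Filter ι} {T : ι → H →L[ℂ] H} {T₀ : H →L[ℂ] H}

theorem tendsto_sigmaWeak_iff :
    Tendsto T l (@nhds _ (sigmaWeakTopology H) T₀) ↔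
      ∀ ξ η : lp (fun _ : ℕ => H) 2, Tendsto (fun i => ∑' n, inner ℂ (ξ n) (T i (η n))) l
        (𝓝 (∑' n, inner ℂ (ξ n) (T₀ (η n)))) := by
  simp only [nhds_iInf, tendsto_iInf, nhds_induced, tendsto_comap_iff]
  rfl

/-- Dominated convergence: on bounded sets each term of the series is dominated by `|C| (‖ξ n‖² + ‖η
n‖²)`. -/
theorem WeakTendsto.sigmaWeak {C : ℝ} (h : WeakTendsto l T T₀) (hC : ∀ᶠ i in l, ‖T i‖ ≤ C) :
    Tendsto T l (@nhds _ (sigmaWeakTopology H) T₀) := by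
  rw [tendsto_sigmaWeak_iff]
  intro ξ η
  have hsum : ∀ ζ : lp (fun _ : ℕ => H) 2, Summable fun n => ‖ζ n‖ ^ 2 := by
    intro ζ
    have := (lp.memℓp ζ).summable (by norm_num)
    simpa using this
  have hb : Summable fun n => |C| * (‖ξ n‖ ^ 2 + ‖η n‖ ^ 2) := ((hsum ξ).add (hsum η)).mul_left _
  refine tendsto_tsum_of_dominated_convergence hb (fun n => h _ _) ?_
  filter_upwards [hC] with i hi n
  calc ‖inner ℂ (ξ n) (T i (η n))‖ ≤ ‖ξ n‖ * (|C| * ‖η n‖) := by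
        refine (norm_inner_le_norm _ _).trans (mul_le_mul_of_nonneg_left ?_ (norm_nonneg _))
        exact ((T i).le_opNorm _).trans
          (mul_le_mul_of_nonneg_right (hi.trans (le_abs_self C)) (norm_nonneg _))
    _ ≤ |C| * (‖ξ n‖ ^ 2 + ‖η n‖ ^ 2) := by
        nlinarith [abs_nonneg C, mul_nonneg (abs_nonneg C) (sq_nonneg (‖ξ n‖ - ‖η n‖)),
          mul_nonneg (abs_nonneg C) (sq_nonneg (‖ξ n‖)),
          mul_nonneg (abs_nonneg C) (sq_nonneg (‖η n‖))]

theorem weakTendsto_of_sigmaWeak (h : Tendsto T l (@nhds _ (sigmaWeakTopology H) T₀)) :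
    WeakTendsto l T T₀ := by
  rw [tendsto_sigmaWeak_iff] at h
  intro ξ η
  have key : ∀ S : H →L[ℂ] H, ∑' n, inner ℂ ((lp.single 2 0 ξ : lp (fun _ : ℕ => H) 2) n)
      (S ((lp.single 2 0 η : lp (fun _ : ℕ => H) 2) n)) = inner ℂ ξ (S η) := by
    intro S
    rw [tsum_eq_single 0]
    · simp
    · intro n hn
      simp [lp.single_apply, hn]
  simpa only [key] using h (lp.single 2 0 ξ) (lp.single 2 0 η)

end SigmaWeak

/-- A normal conditional expectation `M → A`, as a map on all of `B(H)` whose values outside `M`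
are irrelevant. Normality is phrased as weak continuity on bounded sets. -/
structure IsNormalExpectation (M A : VonNeumannAlgebra H) (F : (H →L[ℂ] H) → (H →L[ℂ] H)) :
    Prop where
  le : A ≤ M
  mem : ∀ x ∈ M, F x ∈ A
  map_of_mem : ∀ x ∈ A, F x = x
  map_add : ∀ x ∈ M, ∀ y ∈ M, F (x + y) = F x + F y
  map_smul : ∀ c : ℂ, ∀ x ∈ M, F (c • x) = c • F x
  star_mul_self : ∀ x ∈ M, 0 ≤ F (star x * x)
  bimodule : ∀ a ∈ A, ∀ x ∈ M, ∀ b ∈ A, F (a * x * b) = a * F x * b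
  normal : ∀ (l : Filter (H →L[ℂ] H)) (C : ℝ) (T₀ : H →L[ℂ] H),
    (∀ᶠ T in l, T ∈ M ∧ ‖T‖ ≤ C) → T₀ ∈ M → WeakTendsto l id T₀ → WeakTendsto l F (F T₀)

theorem smul_mem_vn {M : VonNeumannAlgebra H} (c : ℂ) {x : H →L[ℂ] H} (hx : x ∈ M) :
    c • x ∈ M :=
  M.toStarSubalgebra.smul_mem hx c

theorem real_smul_mem_vn {M : VonNeumannAlgebra H} (c : ℝ) {x : H →L[ℂ] H} (hx : x ∈ M) :
    c • x ∈ M := by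
  rw [← Complex.coe_smul]
  exact smul_mem_vn _ hx

/-- Whatever commutes with `x` commutes with its functional calculus, so the bicommutant theorem
applies. -/
theorem cfc_mem_vn {M : VonNeumannAlgebra H} {x : H →L[ℂ] H} (hx : x ∈ M) (f : ℝ → ℝ) :
    cfc f x ∈ M := by
  rw [← M.commutant_commutant, VonNeumannAlgebra.mem_commutant_iff]
  intro y hy
  have : Commute x y := VonNeumannAlgebra.mem_commutant_iff.1 hy x hx
  exact (this.cfc_real f).symm

theorem tendsto_sigmaWeakOn {M : VonNeumannAlgebra H} {ι : Type*} {l : Filter ι}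
    {T : ι → M.toStarSubalgebra} {T₀ : M.toStarSubalgebra} :
    Tendsto T l (@nhds _ (sigmaWeakOn M) T₀) ↔
      Tendsto (fun i => (T i : H →L[ℂ] H)) l (@nhds _ (sigmaWeakTopology H) T₀) := by
  rw [@nhds_induced _ _ (sigmaWeakTopology H), tendsto_comap_iff]
  rfl

/-- Extending by `0` outside `M` gives a total map on operators. Only continuity on bounded sets is
kept, where the weak and σ-weak topologies agree. -/
theorem IsNormalConditionalExpectation.exists_expectation {M A : VonNeumannAlgebra H}
    {E : M.toStarSubalgebra →ₗ[ℂ] A.toStarSubalgebra} (hAM : A ≤ M)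
    (hE : IsNormalConditionalExpectation M A E) :
    ∃ F : (H →L[ℂ] H) → (H →L[ℂ] H), IsNormalExpectation M A F := by
  classical
  let F : (H →L[ℂ] H) → (H →L[ℂ] H) := fun x =>
    if h : x ∈ M.toStarSubalgebra then (E ⟨x, h⟩ : H →L[ℂ] H) else 0
  have hF : ∀ x : M.toStarSubalgebra, F x = E x := fun x => dif_pos x.2
  refine ⟨F, hAM, ?_, ?_, ?_, ?_, ?_, ?_, ?_⟩
  · intro x hx
    rw [hF ⟨x, hx⟩]
    exact (E _).2
  · intro x hx
    exact (hF ⟨x, hAM hx⟩).trans (hE.map_of_mem ⟨x, hAM hx⟩ hx)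
  · intro x hx y hy
    have := hF (⟨x, hx⟩ + ⟨y, hy⟩)
    rw [map_add] at this
    exact this.trans (congrArg₂ (· + ·) (hF ⟨x, hx⟩).symm (hF ⟨y, hy⟩).symm)
  · intro c x hx
    have := hF (c • ⟨x, hx⟩)
    rw [map_smul] at this
    exact this.trans (congrArg (c • ·) (hF ⟨x, hx⟩).symm)
  · intro x hx
    rw [ContinuousLinearMap.nonneg_iff_isPositive]
    have := hE.positive ⟨x, hx⟩
    rwa [← hF] at this
  · intro a ha x hx b hb
    have := hE.bimodule ⟨a, hAM ha⟩ ⟨x, hx⟩ ⟨b, hAM hb⟩ ha hb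
    rwa [← hF, ← hF] at this
  · intro l C T₀ hl hT₀ hw
    rcases l.eq_or_neBot with rfl | hne
    · intro ξ η; exact tendsto_bot
    let T : (H →L[ℂ] H) → M.toStarSubalgebra := fun x =>
      if h : x ∈ M.toStarSubalgebra then ⟨x, h⟩ else 0
    have hT : ∀ᶠ x in l, (T x : H →L[ℂ] H) = x := by
      filter_upwards [hl] with x hx
      have : T x = ⟨x, hx.1⟩ := dif_pos hx.1
      rw [this]
    have h1 : Tendsto T l (@nhds _ (sigmaWeakOn M) ⟨T₀, hT₀⟩) := by
      rw [tendsto_sigmaWeakOn]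
      refine WeakTendsto.sigmaWeak (C := C) (fun ξ η => (hw ξ η).congr' ?_) ?_
      · filter_upwards [hT] with x hx
        rw [hx]; rfl
      · filter_upwards [hT, hl] with x hx hx'
        rw [hx]; exact hx'.2
    have h2 := ((@Continuous.tendsto _ _ (sigmaWeakOn M) (sigmaWeakOn A) _ hE.normal _).comp h1)
    have h3 := weakTendsto_of_sigmaWeak (tendsto_sigmaWeakOn.1 h2)
    intro ξ η
    rw [hF ⟨T₀, hT₀⟩]
    refine (h3 ξ η).congr' ?_
    filter_upwards [hl] with x hx
    have : T x = ⟨x, hx.1⟩ := dif_pos hx.1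
    simp only [Function.comp]
    rw [this, ← hF]

namespace IsNormalExpectation

variable {M A : VonNeumannAlgebra H} {F : (H →L[ℂ] H) → (H →L[ℂ] H)}

section
variable (hF : IsNormalExpectation M A F)
include hF

theorem map_zero : F 0 = 0 := hF.map_of_mem 0 (zero_mem A)

theorem map_sub {x y : H →L[ℂ] H} (hx : x ∈ M) (hy : y ∈ M) : F (x - y) = F x - F y := by
  rw [eq_sub_iff_add_eq, ← hF.map_add _ (sub_mem hx hy) _ hy, sub_add_cancel]

theorem map_sum {κ : Type*} (s : Finset κ) {x : κ → H →L[ℂ] H} (hx : ∀ k, x k ∈ M) :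
    F (∑ k ∈ s, x k) = ∑ k ∈ s, F (x k) := by
  classical
  induction s using Finset.induction_on with
  | empty => simpa using hF.map_zero
  | insert a s ha ih =>
    rw [Finset.sum_insert ha, Finset.sum_insert ha, hF.map_add _ (hx a) _
      (sum_mem fun k _ => hx k), ih]

theorem nonneg {x : H →L[ℂ] H} (hx : x ∈ M) (h0 : 0 ≤ x) : 0 ≤ F x := by
  have h := hF.star_mul_self _ (cfc_mem_vn hx Real.sqrt)
  have h1 : star (cfc Real.sqrt x) * cfc Real.sqrt x = x := by
    have hs : IsSelfAdjoint (cfc Real.sqrt x) := cfc_predicate _ _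
    rw [hs.star_eq, ← cfc_mul ..]
    conv_rhs => rw [← cfc_id ℝ x]
    refine cfc_congr fun t ht => ?_
    exact Real.mul_self_sqrt (spectrum_nonneg_of_nonneg h0 ht)
  rwa [h1] at h

theorem mono {x y : H →L[ℂ] H} (hx : x ∈ M) (hy : y ∈ M) (h : x ≤ y) : F x ≤ F y := by
  have := hF.nonneg (sub_mem hy hx) (sub_nonneg.2 h)
  rwa [hF.map_sub hy hx, sub_nonneg] at this

/-- For self-adjoint `y`, positivity of `‖y‖ - y` makes `‖y‖ - F y` self-adjoint. The general case
follows from real and imaginary parts. -/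
theorem map_star {x : H →L[ℂ] H} (hx : x ∈ M) : F (star x) = star (F x) := by
  have hsa : ∀ y ∈ M, IsSelfAdjoint y → IsSelfAdjoint (F y) := by
    intro y hy hys
    have h1 : (algebraMap ℝ (H →L[ℂ] H) ‖y‖) ∈ A := by
      rw [Algebra.algebraMap_eq_smul_one]; exact real_smul_mem_vn _ (one_mem A)
    have h2 : 0 ≤ algebraMap ℝ (H →L[ℂ] H) ‖y‖ - y :=
      sub_nonneg.2 hys.le_algebraMap_norm_self
    have h3 := hF.nonneg (sub_mem (hF.le h1) hy) h2
    rw [hF.map_sub (hF.le h1) hy, hF.map_of_mem _ h1] at h3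
    have h4 := (IsSelfAdjoint.of_nonneg h3)
    have h5 : IsSelfAdjoint (algebraMap ℝ (H →L[ℂ] H) ‖y‖) := IsSelfAdjoint.algebraMap _ (.all _)
    simpa using h5.sub h4
  have hr : (realPart x : H →L[ℂ] H) ∈ M := by
    rw [realPart_apply_coe]; exact real_smul_mem_vn _ (add_mem hx (star_mem hx))
  have hi : (imaginaryPart x : H →L[ℂ] H) ∈ M := by
    rw [imaginaryPart_apply_coe]
    exact smul_mem_vn _ (real_smul_mem_vn _ (sub_mem hx (star_mem hx)))
  have e1 : F x = F (realPart x) + Complex.I • F (imaginaryPart x) := by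
    conv_lhs => rw [← realPart_add_I_smul_imaginaryPart x]
    rw [hF.map_add _ hr _ (smul_mem_vn _ hi), hF.map_smul _ _ hi]
  have e2 : F (star x) = F (realPart x) + (-Complex.I) • F (imaginaryPart x) := by
    conv_lhs => rw [← realPart_add_I_smul_imaginaryPart x]
    rw [star_add, star_smul, (realPart x).2.star_eq, (imaginaryPart x).2.star_eq,
      hF.map_add _ hr _ (smul_mem_vn _ hi), hF.map_smul _ _ hi]
    simp
  rw [e1, e2, star_add, star_smul, (hsa _ hr (realPart x).2).star_eq,
    (hsa _ hi (imaginaryPart x).2).star_eq]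
  simp

/-- The Kadison-Schwarz inequality. -/
theorem star_mul_le {x : H →L[ℂ] H} (hx : x ∈ M) : star (F x) * F x ≤ F (star x * x) := by
  have ha := hF.mem x hx
  -- Positivity at `x - F x`: after expansion and bimodularity both cross terms equal `F(x)* F(x)`.
  have h := hF.star_mul_self _ (sub_mem hx (hF.le ha))
  have e : star (x - F x) * (x - F x)
      = star x * x - star (F x) * x * 1 - 1 * star x * F x + star (F x) * F x := by
    rw [star_sub]; noncomm_ring
  have hm : star (F x) * F x ∈ A := mul_mem (star_mem ha) ha
  have m1 : star x * x ∈ M := mul_mem (star_mem hx) hx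
  have m2 : star (F x) * x * 1 ∈ M := mul_mem (mul_mem (hF.le (star_mem ha)) hx) (one_mem M)
  have m3 : 1 * star x * F x ∈ M := mul_mem (mul_mem (one_mem M) (star_mem hx)) (hF.le ha)
  rw [e, hF.map_add _ (sub_mem (sub_mem m1 m2) m3) _ (hF.le hm),
    hF.map_sub (sub_mem m1 m2) m3, hF.map_sub m1 m2, hF.map_of_mem _ hm,
    hF.bimodule _ (star_mem ha) _ hx _ (one_mem A), hF.bimodule _ (one_mem A) _ (star_mem hx) _ ha,
    hF.map_star hx] at h
  rw [← sub_nonneg]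
  convert h using 1
  noncomm_ring

/-- Kadison-Schwarz together with `x* x ≤ ‖x‖²`, a scalar fixed by `F`. -/
theorem norm_le {x : H →L[ℂ] H} (hx : x ∈ M) : ‖F x‖ ≤ ‖x‖ := by
  have h1 := hF.star_mul_le hx
  have hc : ∀ r : ℝ, algebraMap ℝ (H →L[ℂ] H) r ∈ A := fun r => by
    rw [Algebra.algebraMap_eq_smul_one]; exact real_smul_mem_vn _ (one_mem A)
  have h2 : F (star x * x) ≤ algebraMap ℝ _ (‖x‖ ^ 2) := by
    rw [← hF.map_of_mem _ (hc _)]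
    refine hF.mono (mul_mem (star_mem hx) hx) (hF.le (hc _)) ?_
    have := (IsSelfAdjoint.star_mul_self x).le_algebraMap_norm_self
    rwa [CStarRing.norm_star_mul_self, ← sq] at this
  have h3 : ‖star (F x) * F x‖ ≤ ‖x‖ ^ 2 :=
    (CStarAlgebra.norm_le_iff_le_algebraMap _ (sq_nonneg _) (star_mul_self_nonneg _)).2
      (h1.trans h2)
  rw [CStarRing.norm_star_mul_self, ← sq] at h3
  exact le_of_sq_le_sq h3 (norm_nonneg _)

theorem weakTendsto {ι : Type*} {l : Filter ι} {T : ι → H →L[ℂ] H} {T₀ : H →L[ℂ] H}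
    (hT : ∀ᶠ i in l, T i ∈ M) {C : ℝ} (hC : ∀ᶠ i in l, ‖T i‖ ≤ C) (h₀ : T₀ ∈ M)
    (h : WeakTendsto l T T₀) : WeakTendsto l (fun i => F (T i)) (F T₀) := by
  have h1 := hF.normal (l.map T) C T₀ (by
    rw [eventually_map]; exact hT.and hC) h₀ (fun ξ η => h ξ η)
  exact fun ξ η => h1 ξ η

end

end IsNormalExpectation

end Expectation

/-! ### Faithfulness of the expectation and strongly null nets -/

section Faithful

variable {H : Type*} [NormedAddCommGroup H] [InnerProductSpace ℂ H] [CompleteSpace H]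

theorem IsMASA.commute {A M : VonNeumannAlgebra H} (hA : IsMASA A M) {a b : H →L[ℂ] H}
    (ha : a ∈ A) (hb : b ∈ A) : a * b = b * a :=
  (hA.2 b (hA.1 hb)).1 hb a ha

theorem exists_sqrt_mem {M : VonNeumannAlgebra H} {x : H →L[ℂ] H} (hx : x ∈ M) (h0 : 0 ≤ x) :
    ∃ s ∈ M, IsSelfAdjoint s ∧ s * s = x := by
  refine ⟨cfc Real.sqrt x, cfc_mem_vn hx _, cfc_predicate _ _, ?_⟩
  rw [← cfc_mul ..]
  conv_rhs => rw [← cfc_id ℝ x]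
  refine cfc_congr fun t ht => ?_
  exact Real.mul_self_sqrt (spectrum_nonneg_of_nonneg h0 ht)

theorem norm_le_of_nonneg_of_le {S : H →L[ℂ] H} (h0 : 0 ≤ S) {r : ℝ} (hr : 0 ≤ r)
    (h : S ≤ algebraMap ℝ (H →L[ℂ] H) r) : ‖S‖ ≤ r :=
  (CStarAlgebra.norm_le_iff_le_algebraMap _ hr h0).2 h

/-- The approximate unit `S (S + 1/(n+1))⁻¹` of the hereditary subalgebra generated by `S`. -/
def approxUnit (n : ℕ) (S : H →L[ℂ] H) : H →L[ℂ] H :=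
  cfc (fun t : ℝ => (n + 1) * t / (1 + (n + 1) * |t|)) S

/-- The absolute value keeps the denominator positive on all of `ℝ`, so continuity needs no
reference to a spectrum. -/
theorem continuous_approxUnit_aux (n : ℕ) :
    Continuous fun t : ℝ => (n + 1) * t / (1 + (n + 1) * |t|) := by
  refine Continuous.div (by fun_prop) (by fun_prop) fun t => ?_
  positivity

theorem approxUnit_nonneg (n : ℕ) {S : H →L[ℂ] H} (hS : 0 ≤ S) : 0 ≤ approxUnit n S := by
  refine cfc_nonneg fun t ht => ?_
  have := spectrum_nonneg_of_nonneg hS ht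
  positivity

theorem approxUnit_le_one (n : ℕ) {S : H →L[ℂ] H} (hS : 0 ≤ S) : approxUnit n S ≤ 1 := by
  refine cfc_le_one _ _ fun t ht => ?_
  have := spectrum_nonneg_of_nonneg hS ht
  rw [abs_of_nonneg this, div_le_one (by positivity)]
  linarith

/-- This domination makes the approximate unit inherit `F = 0` from `S`. -/
theorem approxUnit_le_smul (n : ℕ) {S : H →L[ℂ] H} (hS : 0 ≤ S) :
    approxUnit n S ≤ ((n : ℝ) + 1) • S := by
  have hs := IsSelfAdjoint.of_nonneg hS
  conv_rhs => rw [← cfc_id ℝ S, ← cfc_smul ..]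
  refine cfc_mono (fun t ht => ?_) (continuous_approxUnit_aux n).continuousOn (by fun_prop)
  have := spectrum_nonneg_of_nonneg hS ht
  rw [abs_of_nonneg this, div_le_iff₀ (by positivity)]
  simp only [id, smul_eq_mul]
  have h2 : 0 ≤ ((n : ℝ) + 1) * t := by positivity
  nlinarith [mul_nonneg h2 h2]

theorem one_sub_div_sq_mul_le (n : ℕ) {t : ℝ} (ht : 0 ≤ t) :
    (1 - (n + 1) * t / (1 + (n + 1) * |t|)) * t * (1 - (n + 1) * t / (1 + (n + 1) * |t|))
      ≤ 1 / ((n : ℝ) + 1) := by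
  rw [abs_of_nonneg ht]
  obtain ⟨c, hc⟩ : ∃ c : ℝ, c = n + 1 := ⟨_, rfl⟩
  have hc0 : 0 < c := by rw [hc]; positivity
  rw [← hc]
  have hd : 0 < 1 + c * t := by positivity
  have e : 1 - c * t / (1 + c * t) = 1 / (1 + c * t) := by
    field_simp; ring
  rw [e, one_div_mul_eq_div, div_mul_div_comm, mul_one, div_le_div_iff₀ (by positivity) hc0]
  nlinarith [mul_nonneg hc0.le ht, sq_nonneg (c * t)]

theorem one_sub_approxUnit (n : ℕ) {S : H →L[ℂ] H} (hS : IsSelfAdjoint S) :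
    1 - approxUnit n S = cfc (fun t : ℝ => 1 - (n + 1) * t / (1 + (n + 1) * |t|)) S := by
  rw [cfc_sub _ _ S (by fun_prop) (continuous_approxUnit_aux n).continuousOn, cfc_const_one ℝ S]
  rfl

theorem cfc_mul_self_mul_cfc {S : H →L[ℂ] H} (hS : IsSelfAdjoint S) {g : ℝ → ℝ}
    (hg : Continuous g) : cfc g S * S * cfc g S = cfc (fun t => g t * t * g t) S := by
  rw [cfc_mul (fun t => g t * t) g S (hg.mul continuous_id).continuousOn hg.continuousOn,
    cfc_mul g (fun t => t) S hg.continuousOn continuousOn_id, cfc_id' ℝ S]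

/-- With `R = 1 - approxUnit n S`, the C*-identity gives `‖x R‖² = ‖R x* x R‖ ≤ ‖R S R‖`, and on the
spectrum `t / (1 + (n+1) t)² ≤ 1 / (n+1)`. -/
theorem norm_mul_one_sub_approxUnit (n : ℕ) {S x : H →L[ℂ] H} (hS : 0 ≤ S)
    (hx : star x * x ≤ S) : ‖x * (1 - approxUnit n S)‖ ^ 2 ≤ 1 / (n + 1) := by
  have hs := IsSelfAdjoint.of_nonneg hS
  have hc : Continuous fun t : ℝ => 1 - (n + 1) * t / (1 + (n + 1) * |t|) :=
    continuous_const.sub (continuous_approxUnit_aux n)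
  rw [one_sub_approxUnit n hs]
  set R := cfc (fun t : ℝ => 1 - (n + 1) * t / (1 + (n + 1) * |t|)) S with hR
  have hsa : IsSelfAdjoint R := cfc_predicate _ _
  have h1 : star R * (star x * x) * R ≤ star R * S * R :=
    star_left_conjugate_le_conjugate hx _
  have h3 : R * S * R = cfc (fun t : ℝ => (1 - (n + 1) * t / (1 + (n + 1) * |t|)) * t *
      (1 - (n + 1) * t / (1 + (n + 1) * |t|))) S := cfc_mul_self_mul_cfc hs hc
  have h2 : star R * S * R ≤ algebraMap ℝ _ (1 / ((n : ℝ) + 1)) := by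
    rw [hsa.star_eq, h3]
    exact cfc_le_algebraMap _ _ _
      (fun t ht => one_sub_div_sq_mul_le n (spectrum_nonneg_of_nonneg hS ht))
      ((hc.mul continuous_id).mul hc).continuousOn
  rw [sq, ← CStarRing.norm_star_mul_self]
  refine norm_le_of_nonneg_of_le (star_mul_self_nonneg _) (by positivity) ?_
  refine le_trans (le_of_eq ?_) (h1.trans h2)
  rw [star_mul]
  simp only [mul_assoc]

theorem tendsto_sqrt_one_div : Tendsto (fun n : ℕ => √(1 / ((n : ℝ) + 1))) atTop (𝓝 0) := by
  have := (Real.continuous_sqrt.tendsto _).comp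
    (tendsto_one_div_add_atTop_nhds_zero_nat (𝕜 := ℝ))
  rwa [Real.sqrt_zero] at this

namespace IsNormalExpectation

variable {M A : VonNeumannAlgebra H} {F : (H →L[ℂ] H) → (H →L[ℂ] H)}

theorem map_real_smul (hF : IsNormalExpectation M A F) (c : ℝ) {x : H →L[ℂ] H} (hx : x ∈ M) :
    F (c • x) = c • F x := by
  rw [← Complex.coe_smul, hF.map_smul _ _ hx, Complex.coe_smul]

theorem eq_zero_of_le (hF : IsNormalExpectation M A F) {x y : H →L[ℂ] H} (hx : x ∈ M)
    (hy : y ∈ M) (h0 : 0 ≤ x) (h : x ≤ y) (hFy : F y = 0) : F x = 0 :=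
  le_antisymm ((hF.mono hx hy h).trans_eq hFy) (hF.nonneg hx h0)

/-- There is an element of `M`, killed by `F`, which is a right unit for the left kernel of `F`. -/
theorem exists_right_unit (hF : IsNormalExpectation M A F) :
    ∃ u ∈ M, 0 ≤ u ∧ u ≤ 1 ∧ F u = 0 ∧ ∀ x ∈ M, F (star x * x) = 0 → x * u = x := by
  classical
  let N := {x : H →L[ℂ] H // x ∈ M ∧ F (star x * x) = 0}
  let S : Finset N → H →L[ℂ] H := fun s => ∑ x ∈ s, star (x : H →L[ℂ] H) * x
  have hm : ∀ x : N, star (x : H →L[ℂ] H) * x ∈ M := fun x => mul_mem (star_mem x.2.1) x.2.1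
  have hSM : ∀ s, S s ∈ M := fun s => sum_mem fun x _ => hm x
  have hS0 : ∀ s, 0 ≤ S s := fun s => Finset.sum_nonneg fun x _ => star_mul_self_nonneg _
  have hFS : ∀ s, F (S s) = 0 := fun s => by
    rw [hF.map_sum s hm]
    exact Finset.sum_eq_zero fun x _ => x.2.2
  -- The net is indexed by finite subsets of the left kernel and by the precision of the approximate
  -- unit; `u` is a weak limit point of it.
  let T : Finset N × ℕ → H →L[ℂ] H := fun i => approxUnit i.2 (S i.1)
  have hTM : ∀ i, T i ∈ M := fun i => cfc_mem_vn (hSM i.1) _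
  have hT0 : ∀ i, 0 ≤ T i := fun i => approxUnit_nonneg _ (hS0 _)
  have hT1 : ∀ i, T i ≤ 1 := fun i => approxUnit_le_one _ (hS0 _)
  have hTn : ∀ i, ‖T i‖ ≤ 1 := fun i =>
    norm_le_of_nonneg_of_le (hT0 i) zero_le_one (by simpa using hT1 i)
  have hFT : ∀ i, F (T i) = 0 := fun i => by
    refine hF.eq_zero_of_le (hTM i) (real_smul_mem_vn _ (hSM i.1)) (hT0 i)
      (approxUnit_le_smul i.2 (hS0 _)) ?_
    rw [hF.map_real_smul _ (hSM _), hFS, smul_zero]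
  let U : Ultrafilter (Finset N × ℕ) := Ultrafilter.of atTop
  have hU : (U : Filter (Finset N × ℕ)) ≤ atTop := Ultrafilter.of_le _
  obtain ⟨u, hu⟩ := exists_weakTendsto U (Eventually.of_forall hTn)
  have huM : u ∈ M := mem_of_weakTendsto M hu (Eventually.of_forall hTM)
  refine ⟨u, huM, nonneg_of_weakTendsto hu (Eventually.of_forall hT0),
    le_of_weakTendsto hu weakTendsto_const (Eventually.of_forall hT1), ?_, ?_⟩
  · have h1 := hF.weakTendsto (Eventually.of_forall hTM) (Eventually.of_forall hTn) huM hu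
    simp only [hFT] at h1
    exact h1.unique weakTendsto_const
  · intro x hx hFx
    have h1 := hu.mul_mul x 1
    simp only [mul_one] at h1
    -- `x T` has weak limit `x u`, and it converges strongly to `x` because `x* x ≤ S` once the
    -- finite set contains `x`.
    refine h1.unique (StrongTendsto.weakTendsto fun ξ => ?_)
    refine Tendsto.mono_left ?_ hU
    rw [tendsto_iff_norm_sub_tendsto_zero]
    have hlim : Tendsto (fun i : Finset N × ℕ => √(1 / ((i.2 : ℝ) + 1)) * ‖ξ‖) atTop (𝓝 0) := by
      have h3 : Tendsto (fun i : Finset N × ℕ => i.2) atTop atTop := by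
        rw [← prod_atTop_atTop_eq]; exact tendsto_snd
      simpa using (tendsto_sqrt_one_div.comp h3).mul_const ‖ξ‖
    refine squeeze_zero' (Eventually.of_forall fun _ => norm_nonneg _) ?_ hlim
    filter_upwards [eventually_ge_atTop (({⟨x, hx, hFx⟩} : Finset N), 0)] with i hi
    have hmem : (⟨x, hx, hFx⟩ : N) ∈ i.1 := hi.1 (Finset.mem_singleton_self _)
    have hnn : ∀ y ∈ i.1, 0 ≤ star (y : H →L[ℂ] H) * (y : H →L[ℂ] H) :=
      fun y _ => star_mul_self_nonneg y.1
    have hle : star x * x ≤ S i.1 := by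
      have := Finset.single_le_sum hnn hmem
      exact this
    have h4 := Real.le_sqrt_of_sq_le (norm_mul_one_sub_approxUnit i.2 (hS0 i.1) hle)
    have h5 : (x * T i) ξ - x ξ = -((x * (1 - approxUnit i.2 (S i.1))) ξ) := by
      rw [mul_sub, mul_one, sub_apply, neg_sub]
    have h6 := ContinuousLinearMap.le_opNorm (x * (1 - approxUnit i.2 (S i.1))) ξ
    rw [h5, norm_neg]
    exact h6.trans (mul_le_mul_of_nonneg_right h4 (norm_nonneg ξ))

/-- A normal conditional expectation onto a MASA is faithful. -/
theorem faithful (hF : IsNormalExpectation M A F) (hA : IsMASA A M) {x : H →L[ℂ] H}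
    (hx : x ∈ M) (hFx : F (star x * x) = 0) : x = 0 := by
  obtain ⟨u, huM, hu0, hu1, hFu, hun⟩ := hF.exists_right_unit
  have hus : IsSelfAdjoint u := IsSelfAdjoint.of_nonneg hu0
  have huu : star u * u ≤ u := by
    obtain ⟨s, hs, hss, rfl⟩ := exists_sqrt_mem huM hu0
    have := star_left_conjugate_le_conjugate hu1 s
    rw [hss.star_eq] at this
    rw [hus.star_eq]
    simpa [mul_assoc] using this
  -- This puts `u` itself in the left kernel, so that `u * u = u`.
  have hFuu : F (star u * u) = 0 :=
    hF.eq_zero_of_le (mul_mem (star_mem huM) huM) huM (star_mul_self_nonneg _) huu hFu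
  have hidem := hun u huM hFuu
  -- By bimodularity the left kernel is stable under right multiplication by `A`. Taking adjoints
  -- then gives commutation with `A`, and maximality puts `u` in `A`.
  have key : ∀ a ∈ A, u * a * u = u * a := by
    intro a ha
    refine hun _ (mul_mem huM (hF.le ha)) ?_
    have e : star (u * a) * (u * a) = star a * (star u * u) * a := by
      rw [star_mul]; noncomm_ring
    rw [e, hF.bimodule _ (star_mem ha) _ (mul_mem (star_mem huM) huM) _ ha, hFuu]
    simp
  have hcomm : ∀ a ∈ A, a * u = u * a := by
    intro a ha
    have h1 := congrArg star (key (star a) (star_mem ha))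
    simp only [star_mul, star_star, hus.star_eq, ← mul_assoc] at h1
    rw [← h1, key a ha]
  have huA : u ∈ A := (hA.2 u huM).2 hcomm
  have hu : u = 0 := by rw [← hF.map_of_mem u huA, hFu]
  rw [← hun x hx hFx, hu, mul_zero]

variable {ι : Type*} {l : Filter ι} {T : ι → H →L[ℂ] H}

/-- Along any finer ultrafilter a weak limit exists, is positive and is killed by `F`. Faithfulness,
applied to its square root, makes it zero. -/
theorem weakTendsto_zero (hF : IsNormalExpectation M A F) (hA : IsMASA A M)
    (hT : ∀ i, T i ∈ M) {C : ℝ} (hC : ∀ i, ‖T i‖ ≤ C) (h0 : ∀ i, 0 ≤ T i)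
    (h : WeakTendsto l (fun i => F (T i)) 0) : WeakTendsto l T 0 := by
  refine weakTendsto_of_ultrafilter fun U hU => ?_
  obtain ⟨T₀, hT₀⟩ := exists_weakTendsto U (Eventually.of_forall hC)
  have hM : T₀ ∈ M := mem_of_weakTendsto M hT₀ (Eventually.of_forall hT)
  have hp : 0 ≤ T₀ := nonneg_of_weakTendsto hT₀ (Eventually.of_forall h0)
  have h1 := (hF.weakTendsto (Eventually.of_forall hT) (Eventually.of_forall hC) hM hT₀).unique
    (h.mono hU)
  obtain ⟨s, hs, hss, rfl⟩ := exists_sqrt_mem hM hp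
  have h2 := hF.faithful hA hs (by rwa [hss.star_eq])
  rwa [h2, mul_zero] at hT₀

theorem norm_star_mul_self_le {C : ℝ} {x : H →L[ℂ] H} (h : ‖x‖ ≤ C) : ‖star x * x‖ ≤ C * C := by
  rw [CStarRing.norm_star_mul_self]
  exact mul_self_le_mul_self (norm_nonneg _) h

theorem strongTendsto_zero_iff (hF : IsNormalExpectation M A F) (hA : IsMASA A M)
    (hT : ∀ i, T i ∈ M) {C : ℝ} (hC : ∀ i, ‖T i‖ ≤ C) :
    StrongTendsto l T 0 ↔ WeakTendsto l (fun i => F (star (T i) * T i)) 0 := by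
  have hm : ∀ i, star (T i) * T i ∈ M := fun i => mul_mem (star_mem (hT i)) (hT i)
  rw [Paving.strongTendsto_zero_iff]
  constructor
  · intro h
    have := hF.weakTendsto (Eventually.of_forall hm)
      (Eventually.of_forall fun i => norm_star_mul_self_le (hC i)) (zero_mem M) h
    rwa [hF.map_zero] at this
  · exact hF.weakTendsto_zero hA hm (fun i => norm_star_mul_self_le (hC i))
      fun i => star_mul_self_nonneg _

/-- By Kadison-Schwarz `F(T)* F(T)` is dominated by `F (T* T)`, which is weakly null. -/
theorem strongTendsto_map (hF : IsNormalExpectation M A F) (hA : IsMASA A M)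
    (hT : ∀ i, T i ∈ M) {C : ℝ} (hC : ∀ i, ‖T i‖ ≤ C) (h : StrongTendsto l T 0) :
    StrongTendsto l (fun i => F (T i)) 0 := by
  rw [Paving.strongTendsto_zero_iff]
  refine weakTendsto_zero_of_le (Eventually.of_forall fun i => star_mul_self_nonneg _)
    (Eventually.of_forall fun i => hF.star_mul_le (hT i)) ⟨C * C, Eventually.of_forall fun i => ?_⟩
    ((hF.strongTendsto_zero_iff hA hT hC).1 h)
  exact norm_star_mul_self_le ((hF.norm_le (hT i)).trans (hC i))

/-- Commutativity is essential: with `b = s²` one has `a* s s a = s (a* a) s`, and `a* a ≤ K²`. -/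
theorem conj_le (hA : IsMASA A M) {a b : H →L[ℂ] H} (ha : a ∈ A) (hb : b ∈ A) (hb0 : 0 ≤ b)
    {K : ℝ} (hK : ‖a‖ ≤ K) : star a * b * a ≤ (K * K) • b := by
  obtain ⟨s, hs, hss, rfl⟩ := exists_sqrt_mem hb hb0
  have h1 : star a * a ≤ algebraMap ℝ _ (K * K) :=
    (CStarAlgebra.norm_le_iff_le_algebraMap _ (mul_self_nonneg _) (star_mul_self_nonneg _)).1
      (norm_star_mul_self_le hK)
  have h2 := star_left_conjugate_le_conjugate h1 s
  rw [hss.star_eq] at h2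
  have e1 : star a * (s * s) * a = s * (star a * a) * s := by
    have c1 := hA.commute (star_mem ha) hs
    have c2 := hA.commute hs ha
    calc star a * (s * s) * a = (star a * s) * (s * a) := by noncomm_ring
      _ = s * (star a * a) * s := by rw [c1, c2]; noncomm_ring
  have e2 : s * algebraMap ℝ _ (K * K) * s = (K * K) • (s * s) := by
    rw [Algebra.algebraMap_eq_smul_one]
    simp
  rwa [e1, ← e2]

/-- Bounded strongly null nets are stable under right multiplication by bounded nets in `A`. -/
theorem strongTendsto_mul_right (hF : IsNormalExpectation M A F) (hA : IsMASA A M)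
    (hT : ∀ i, T i ∈ M) {C : ℝ} (hC : ∀ i, ‖T i‖ ≤ C) (h : StrongTendsto l T 0)
    {a : ι → H →L[ℂ] H} (ha : ∀ i, a i ∈ A) {K : ℝ} (hK : ∀ i, ‖a i‖ ≤ K) :
    StrongTendsto l (fun i => T i * a i) 0 := by
  have hm : ∀ i, star (T i) * T i ∈ M := fun i => mul_mem (star_mem (hT i)) (hT i)
  have hn : ∀ i, ‖T i * a i‖ ≤ C * K := fun i =>
    (norm_mul_le _ _).trans (mul_le_mul (hC i) (hK i) (norm_nonneg _) ((norm_nonneg _).trans (hC i)))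
  have hTa : ∀ i, T i * a i ∈ M := fun i => mul_mem (hT i) (hF.le (ha i))
  have hTam : ∀ i, star (T i * a i) * (T i * a i) ∈ M :=
    fun i => mul_mem (star_mem (hTa i)) (hTa i)
  rw [hF.strongTendsto_zero_iff hA hTa hn]
  have h1 := (hF.strongTendsto_zero_iff hA hT hC).1 h
  have h2 : WeakTendsto l (fun i => (K * K) • F (star (T i) * T i)) 0 := by
    intro ξ η
    simpa [inner_smul_right_eq_smul] using (h1 ξ η).const_smul (K * K)
  refine weakTendsto_zero_of_le
    (Eventually.of_forall fun i => hF.nonneg (hTam i) (star_mul_self_nonneg _))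
    (Eventually.of_forall fun i => ?_) ⟨(C * K) * (C * K), Eventually.of_forall fun i =>
      (hF.norm_le (hTam i)).trans (norm_star_mul_self_le (hn i))⟩ h2
  have e : star (T i * a i) * (T i * a i) = star (a i) * (star (T i) * T i) * a i := by
    rw [star_mul]; noncomm_ring
  rw [e, hF.bimodule _ (star_mem (ha i)) _ (hm i) _ (ha i)]
  exact conj_le hA (ha i) (hF.mem _ (hm i)) (hF.nonneg (hm i) (star_mul_self_nonneg _)) (hK i)

end IsNormalExpectation

end Faithful

/-! ### Spectral projections and cutting by them -/

section SpectralProjection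

variable {H : Type*} [NormedAddCommGroup H] [InnerProductSpace ℂ H] [CompleteSpace H]

/-- Every operator in the commutant leaves `ker R` invariant. -/
theorem starProjection_ker_mem {M : VonNeumannAlgebra H} {R : H →L[ℂ] H} (hR : R ∈ M) :
    (R.ker).starProjection ∈ M := by
  rw [VonNeumannAlgebra.IsStarProjection.mem_iff isStarProjection_starProjection]
  intro y hy
  have hc := VonNeumannAlgebra.mem_commutant_iff.1 hy R hR
  rw [Submodule.range_starProjection, Module.End.mem_invtSubmodule]
  intro ξ hξ
  have h1 : R ξ = 0 := hξ
  have h2 := congrArg (fun S : H →L[ℂ] H => S ξ) hc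
  simp only [mul_apply_eq_comp, h1, map_zero] at h2
  exact h2

/-- Spectral projections of self-adjoint elements of a von Neumann algebra. -/
theorem exists_spectral_projection {M : VonNeumannAlgebra H} {T : H →L[ℂ] H} (hT : T ∈ M)
    (hs : IsSelfAdjoint T) (c : ℝ) :
    ∃ e ∈ M, IsStarProjection e ∧ e * T = T * e ∧ c • e ≤ e * T * e ∧
      (1 - e) * T * (1 - e) ≤ c • (1 - e) := by
  -- `R` and `R'` are the positive and negative parts of `T - c`. The spectral projection is the
  -- complement of the projection `p` onto `ker R`, and `R R' = 0` puts the range of `R'` inside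
  -- that of `p`.
  set R := cfc (fun t : ℝ => max (t - c) 0) T with hR
  set R' := cfc (fun t : ℝ => max (c - t) 0) T with hR'
  have hR0 : 0 ≤ R := cfc_nonneg fun t _ => le_max_right _ _
  have hR0' : 0 ≤ R' := cfc_nonneg fun t _ => le_max_right _ _
  have hdiff : T - c • (1 : H →L[ℂ] H) = R - R' := by
    rw [hR, hR', ← cfc_sub _ _ T (by fun_prop) (by fun_prop)]
    conv_lhs => rw [← cfc_id' ℝ T, ← Algebra.algebraMap_eq_smul_one, ← cfc_const c T,
      ← cfc_sub _ _ T (by fun_prop) (by fun_prop)]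
    refine cfc_congr fun t _ => ?_
    rcases le_total t c with h | h
    · rw [max_eq_right (by linarith), max_eq_left (by linarith)]; ring
    · rw [max_eq_left (by linarith), max_eq_right (by linarith)]; ring
  have hprod : R * R' = 0 := by
    rw [hR, hR', ← cfc_mul _ _ T (by fun_prop) (by fun_prop)]
    rw [← cfc_zero (R := ℝ) (a := T)]
    refine cfc_congr fun t _ => ?_
    simp only [Pi.zero_apply]
    rcases le_total t c with h | h
    · rw [max_eq_right (by linarith), zero_mul]
    · rw [max_eq_right (by linarith : c - t ≤ 0), mul_zero]
  set p := (R.ker).starProjection with hp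
  have hpM : p ∈ M := starProjection_ker_mem (cfc_mem_vn hT _)
  have hpp : IsStarProjection p := isStarProjection_starProjection
  have hpk : ∀ ξ, R (p ξ) = 0 := fun ξ =>
    (Submodule.starProjection_apply_mem (R.ker) ξ : p ξ ∈ R.ker)
  have hfix : ∀ ξ, R ξ = 0 → p ξ = ξ := fun ξ h =>
    Submodule.starProjection_eq_self_iff.2 (show ξ ∈ R.ker from h)
  have hRp : R * p = 0 := by
    ext ξ; exact hpk ξ
  have hpR' : p * R' = R' := by
    ext ξ
    refine hfix _ ?_
    have := congrArg (fun S : H →L[ℂ] H => S ξ) hprod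
    exact this
  have hRT : R * T = T * R := (Commute.refl T).cfc_real _
  have hpTp : p * (T * p) = T * p := by
    ext ξ
    refine hfix _ ?_
    have := congrArg (fun S : H →L[ℂ] H => S (p ξ)) hRT
    simp only [mul_apply_eq_comp, hpk, map_zero] at this
    exact this
  have hpT : p * T = T * p := by
    have := congrArg star hpTp
    simp only [star_mul, hs.star_eq, hpp.isSelfAdjoint.star_eq] at this
    rw [← this, mul_assoc, hpTp]
  have hpR : p * R = 0 := by
    have := congrArg star hRp
    rwa [star_mul, star_zero, hpp.isSelfAdjoint.star_eq, (IsSelfAdjoint.of_nonneg hR0).star_eq]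
      at this
  have hR'p : R' * p = R' := by
    have := congrArg star hpR'
    rwa [star_mul, hpp.isSelfAdjoint.star_eq, (IsSelfAdjoint.of_nonneg hR0').star_eq]
      at this
  have hTe : T = c • (1 : H →L[ℂ] H) + (R - R') := by rw [← hdiff]; abel
  refine ⟨1 - p, sub_mem (one_mem M) hpM, hpp.one_sub, ?_, ?_, ?_⟩
  · rw [sub_mul, mul_sub, hpT, one_mul, mul_one]
  · have e : (1 - p) * T * (1 - p) = c • (1 - p) + R := by
      rw [hTe]
      have h1 : p * p = p := hpp.isIdempotentElem
      have : (1 - p) * (c • (1 : H →L[ℂ] H) + (R - R')) * (1 - p)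
          = c • (1 - p - p + p * p) + (R - p * R - R * p + p * R * p)
            - (R' - p * R' - R' * p + p * R' * p) := by
        simp only [sub_mul, mul_sub, add_mul, mul_add, one_mul, mul_one, smul_mul_assoc,
          mul_smul_comm, smul_sub, smul_add]
        abel
      rw [this, h1, hpR, hRp, hpR', hR'p]
      simp
    rw [e]
    exact le_add_of_nonneg_right hR0
  · rw [sub_sub_cancel]
    have e : p * T * p = c • p - R' := by
      rw [hTe]
      have h1 : p * p = p := hpp.isIdempotentElem
      have : p * (c • (1 : H →L[ℂ] H) + (R - R')) * p
          = c • (p * p) + p * R * p - p * R' * p := by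
        simp only [sub_mul, mul_sub, add_mul, mul_add, mul_one, smul_mul_assoc,
          mul_smul_comm]
        abel
      rw [this, h1, hpR, hpR', hR'p]
      simp
    rw [e]
    exact sub_le_self _ hR0'

theorem sub_conj_eq_of_commute {R : Type*} [Ring R] {e T : R} (he : e * e = e)
    (hc : e * T = T * e) : T - e * T * e = (1 - e) * T * (1 - e) := by
  have h : e * T * e = e * T := by rw [mul_assoc, ← hc, ← mul_assoc, he]
  rw [sub_mul, one_mul, sub_mul, mul_sub, mul_sub, mul_one, mul_one, ← hc, h]
  abel

theorem conj_le_of_commute {e T : H →L[ℂ] H} (he : IsStarProjection e) (hT : 0 ≤ T)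
    (hc : e * T = T * e) : e * T * e ≤ T := by
  rw [← sub_nonneg, sub_conj_eq_of_commute he.isIdempotentElem.eq hc]
  have := star_left_conjugate_nonneg hT (1 - e)
  rwa [he.one_sub.isSelfAdjoint.star_eq] at this

theorem WeakTendsto.real_smul {ι : Type*} {l : Filter ι} {T : ι → H →L[ℂ] H} {T₀ : H →L[ℂ] H}
    (h : WeakTendsto l T T₀) (c : ℝ) : WeakTendsto l (fun i => c • T i) (c • T₀) := by
  intro ξ η
  have := (h ξ η).const_smul c
  simpa only [smul_apply, inner_smul_right_eq_smul] using this

theorem le_inv_smul_of_smul_le {S T : H →L[ℂ] H} {c : ℝ} (hc : 0 < c) (h : c • S ≤ T) :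
    S ≤ c⁻¹ • T := by
  have h7 := smul_le_smul_of_nonneg_left h (inv_nonneg.2 hc.le)
  rwa [smul_smul, inv_mul_cancel₀ hc.ne', one_smul] at h7

/-- For a projection `e* e = e`, so strong nullity follows from the weakly null upper bound `c⁻¹ T`.
-/
theorem strongTendsto_projection_of_smul_le {ι : Type*} {l : Filter ι} {e T : ι → H →L[ℂ] H}
    (he : ∀ i, IsStarProjection (e i)) {c : ℝ} (hc : 0 < c) (hle : ∀ i, c • e i ≤ T i)
    (hT : WeakTendsto l T 0) : StrongTendsto l e 0 := by
  rw [strongTendsto_zero_iff]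
  have e1 : ∀ i, star (e i) * e i = e i := fun i => by
    rw [(he i).isSelfAdjoint.star_eq, (he i).isIdempotentElem.eq]
  simp only [e1]
  have hT' := hT.real_smul c⁻¹
  rw [smul_zero] at hT'
  exact weakTendsto_zero_of_le (Eventually.of_forall fun i => (he i).nonneg)
    (Eventually.of_forall fun i => le_inv_smul_of_smul_le hc (hle i))
    ⟨1, Eventually.of_forall fun i => (he i).norm_le⟩ hT'

/-- A strongly null bounded net is small in norm after cutting by projections tending to `1`. -/
theorem exists_projection_norm_mul_le {M : VonNeumannAlgebra H} {ι : Type*} {l : Filter ι}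
    {y : ι → H →L[ℂ] H} (hy : ∀ i, y i ∈ M) (h : StrongTendsto l y 0) {δ : ℝ} (hδ : 0 < δ) :
    ∃ q : ι → H →L[ℂ] H, (∀ i, q i ∈ M ∧ IsStarProjection (q i)) ∧ (∀ i, ‖y i * q i‖ ≤ δ) ∧
      StrongTendsto l (fun i => 1 - q i) 0 := by
  -- Spectral cut of `y* y` at `δ²`: below it `‖y q‖ ≤ δ`, while the part above is dominated by `δ⁻²
  -- y* y`.
  have hsp := fun i => exists_spectral_projection (mul_mem (star_mem (hy i)) (hy i))
    (IsSelfAdjoint.star_mul_self (y i)) (δ ^ 2)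
  choose e heM hep hcomm hle1 hle2 using hsp
  refine ⟨fun i => 1 - e i, fun i => ⟨sub_mem (one_mem M) (heM i), (hep i).one_sub⟩,
    fun i => ?_, ?_⟩
  · have h1 : star (y i * (1 - e i)) * (y i * (1 - e i)) ≤ algebraMap ℝ _ (δ ^ 2) := by
      have e1 : star (y i * (1 - e i)) * (y i * (1 - e i))
          = (1 - e i) * (star (y i) * y i) * (1 - e i) := by
        rw [star_mul, (hep i).one_sub.isSelfAdjoint.star_eq]; simp only [mul_assoc]
      rw [e1, Algebra.algebraMap_eq_smul_one]
      refine (hle2 i).trans (smul_le_smul_of_nonneg_left ?_ (sq_nonneg δ))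
      exact sub_le_self _ (hep i).nonneg
    have h2 := norm_le_of_nonneg_of_le (star_mul_self_nonneg _) (sq_nonneg δ) h1
    rw [CStarRing.norm_star_mul_self, ← sq] at h2
    exact le_of_sq_le_sq h2 hδ.le
  · simp only [sub_sub_cancel]
    exact strongTendsto_projection_of_smul_le hep (by positivity : 0 < δ ^ 2)
      (fun i => (hle1 i).trans (conj_le_of_commute (hep i) (star_mul_self_nonneg _) (hcomm i)))
      (strongTendsto_zero_iff.1 h)

/-- Cauchy-Schwarz turns the quadratic form inequality into a lower bound for `T` on the range of
`P`. -/
theorem norm_le_of_smul_le_conj {P T : H →L[ℂ] H} (hP : IsStarProjection P) {c : ℝ}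
    (h : c • P ≤ P * T * P) (η : H) : c * ‖P η‖ ≤ ‖T (P η)‖ := by
  have h1 := ((ContinuousLinearMap.le_def _ _).1 h).re_inner_nonneg_right η
  have hsa := hP.isSelfAdjoint.adjoint_eq
  have e1 : inner ℂ η ((P * T * P) η) = inner ℂ (P η) (T (P η)) := by
    simp only [mul_apply_eq_comp]
    rw [← ContinuousLinearMap.adjoint_inner_left, hsa]
  have e2 : inner ℂ η (P η) = inner ℂ (P η) (P η) := by
    conv_lhs => rw [← hP.isIdempotentElem.eq]
    rw [mul_apply_eq_comp, ← ContinuousLinearMap.adjoint_inner_left, hsa]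
  have h2 : c * ‖P η‖ ^ 2 ≤ ‖P η‖ * ‖T (P η)‖ := by
    have h3 := Complex.re_le_norm (inner ℂ (P η) (T (P η)))
    have h4 := norm_inner_le_norm (𝕜 := ℂ) (P η) (T (P η))
    have h5 : 0 ≤ (inner ℂ (P η) (T (P η))).re - c * ‖P η‖ ^ 2 := by
      have := h1
      rw [sub_apply, inner_sub_right, e1, smul_apply, inner_smul_right_eq_smul, e2,
        inner_self_eq_norm_sq_to_K] at this
      simpa [← Complex.ofReal_pow] using this
    linarith
  rcases (norm_nonneg (P η)).eq_or_lt with h0 | h0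
  · rw [← h0, mul_zero]; exact norm_nonneg _
  · have : ‖P η‖ * (c * ‖P η‖) ≤ ‖P η‖ * ‖T (P η)‖ := by nlinarith
    exact le_of_mul_le_mul_left this h0

/-- An almost idempotent self-adjoint element is close to its spectral projection at `1/2`. -/
theorem norm_sub_spectral_projection_le {e g : H →L[ℂ] H} (he : IsStarProjection e)
    (hc : e * g = g * e) (h1 : (1 / 2 : ℝ) • e ≤ e * g * e)
    (h2 : (1 - e) * g * (1 - e) ≤ (1 / 2 : ℝ) • (1 - e)) (ξ : H) :
    ‖(e - g) ξ‖ ≤ 4 * ‖(g * g - g) ξ‖ := by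
  have h2' : (1 / 2 : ℝ) • (1 - e) ≤ (1 - e) * (1 - g) * (1 - e) := by
    have e1 : (1 - e) * (1 - g) * (1 - e) = (1 - e) - (1 - e) * g * (1 - e) := by
      rw [mul_sub (1 - e) 1 g, mul_one, sub_mul _ _ (1 - e), he.one_sub.isIdempotentElem.eq]
    rw [e1, le_sub_iff_add_le]
    calc (1 / 2 : ℝ) • (1 - e) + (1 - e) * g * (1 - e)
        ≤ (1 / 2 : ℝ) • (1 - e) + (1 / 2 : ℝ) • (1 - e) := by gcongr
      _ = 1 - e := by rw [← add_smul]; norm_num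
  -- In `e - g = e (1 - g) - (1 - e) g`, the operator `g` is at least `1/2` on the range of `e`, and
  -- `1 - g` on its complement. Each summand thus costs a factor `2` of `(g - g²) ξ`.
  have k1 := norm_le_of_smul_le_conj he h1 ((1 - g) ξ)
  have k2 := norm_le_of_smul_le_conj he.one_sub h2' (g ξ)
  have a1 : g * (e * (1 - g)) = e * (g - g * g) := by
    rw [← mul_assoc, ← hc, mul_assoc, mul_sub, mul_one]
  have a2 : (1 - g) * ((1 - e) * g) = (1 - e) * (g - g * g) := by
    have : e * (g * g) = g * (e * g) := by rw [← mul_assoc, hc, mul_assoc, hc]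
    rw [sub_mul 1 g, one_mul, sub_mul 1 e g, one_mul, mul_sub g, sub_mul 1 e, one_mul, mul_sub e,
      this]
    abel
  have b1 : g (e ((1 - g) ξ)) = e ((g - g * g) ξ) := congrArg (fun S : H →L[ℂ] H => S ξ) a1
  have b2 : (1 - g) ((1 - e) (g ξ)) = (1 - e) ((g - g * g) ξ) :=
    congrArg (fun S : H →L[ℂ] H => S ξ) a2
  have c1 : ‖e ((g - g * g) ξ)‖ ≤ ‖(g - g * g) ξ‖ := by
    simpa only [one_mul] using e.le_of_opNorm_le he.norm_le ((g - g * g) ξ)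
  have c2 : ‖(1 - e) ((g - g * g) ξ)‖ ≤ ‖(g - g * g) ξ‖ := by
    simpa only [one_mul] using (1 - e).le_of_opNorm_le he.one_sub.norm_le ((g - g * g) ξ)
  have d : (e - g) ξ = e ((1 - g) ξ) - (1 - e) (g ξ) := by
    simp
  have d2 : ‖(g * g - g) ξ‖ = ‖(g - g * g) ξ‖ := by
    rw [← neg_sub, neg_apply, norm_neg]
  rw [b1] at k1
  rw [b2] at k2
  rw [d, d2]
  refine (norm_sub_le _ _).trans ?_
  linarith

end SpectralProjection

/-! ### Null nets, their multipliers, and functional calculus modulo null nets -/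

section Nets

variable {H : Type*} [NormedAddCommGroup H] [InnerProductSpace ℂ H] [CompleteSpace H]
  {ι : Type*} [TopologicalSpace ι]

instance instCFCNets :
    ContinuousFunctionalCalculus ℝ (ι →ᵇ (H →L[ℂ] H)) IsSelfAdjoint :=
  IsSelfAdjoint.instContinuousFunctionalCalculus

instance instCFCNetsProd :
    ContinuousFunctionalCalculus ℝ ((ι →ᵇ (H →L[ℂ] H)) × (ι →ᵇ (H →L[ℂ] H))) IsSelfAdjoint :=
  IsSelfAdjoint.instContinuousFunctionalCalculus
    (A := (ι →ᵇ (H →L[ℂ] H)) × (ι →ᵇ (H →L[ℂ] H)))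

theorem isClosed_vn (M : VonNeumannAlgebra H) : IsClosed (M : Set (H →L[ℂ] H)) := by
  rw [← M.centralizer_centralizer]
  exact Set.isClosed_centralizer _

theorem StrongTendsto.neg {κ : Type*} {l : Filter κ} {T : κ → H →L[ℂ] H} (h : StrongTendsto l T 0) :
    StrongTendsto l (fun i => -T i) 0 := fun ξ => by
  simpa using (h ξ).neg

theorem StrongTendsto.mul_left {κ : Type*} {l : Filter κ} {S T : κ → H →L[ℂ] H}
    (h : StrongTendsto l T 0) {C : ℝ} (hS : ∀ i, ‖S i‖ ≤ C) :
    StrongTendsto l (fun i => S i * T i) 0 := fun ξ => by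
  have h1 : Tendsto (fun i => C * ‖T i ξ‖) l (𝓝 0) := by
    simpa using (h ξ).norm.const_mul C
  refine squeeze_zero_norm (fun i => ?_) h1
  exact ((S i).le_opNorm _).trans (mul_le_mul_of_nonneg_right (hS i) (norm_nonneg _))

theorem StrongTendsto.mul_const {κ : Type*} {l : Filter κ} {T : κ → H →L[ℂ] H}
    (h : StrongTendsto l T 0) (x : H →L[ℂ] H) : StrongTendsto l (fun i => T i * x) 0 :=
  fun ξ => by simpa using h (x ξ)

/-- Bounded nets in `M` converging strong-`*` to `0`. -/
def nullNets (M : VonNeumannAlgebra H) (l : Filter ι) : Set (ι →ᵇ (H →L[ℂ] H)) :=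
  {f | (∀ i, f i ∈ M) ∧ StrongTendsto l f 0 ∧ StrongTendsto l (fun i => star (f i)) 0}

variable {M : VonNeumannAlgebra H} {l : Filter ι} {f g : ι →ᵇ (H →L[ℂ] H)}

theorem norm_star_coe_le (f : ι →ᵇ (H →L[ℂ] H)) (i : ι) : ‖star (f i)‖ ≤ ‖f‖ := by
  rw [norm_star]; exact f.norm_coe_le_norm i

theorem zero_mem_nullNets : (0 : ι →ᵇ (H →L[ℂ] H)) ∈ nullNets M l :=
  ⟨fun _ => zero_mem M, fun ξ => by simpa using tendsto_const_nhds,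
    fun ξ => by simpa using tendsto_const_nhds⟩

theorem add_mem_nullNets (hf : f ∈ nullNets M l) (hg : g ∈ nullNets M l) :
    f + g ∈ nullNets M l := by
  refine ⟨fun i => add_mem (hf.1 i) (hg.1 i), ?_, ?_⟩
  · have := hf.2.1.add hg.2.1
    rwa [add_zero] at this
  · simpa using hf.2.2.add hg.2.2

theorem neg_mem_nullNets (hf : f ∈ nullNets M l) : -f ∈ nullNets M l := by
  refine ⟨fun i => neg_mem (hf.1 i), ?_, ?_⟩
  · exact hf.2.1.neg
  · simpa using hf.2.2.neg

theorem sub_mem_nullNets (hf : f ∈ nullNets M l) (hg : g ∈ nullNets M l) :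
    f - g ∈ nullNets M l := by
  rw [sub_eq_add_neg]; exact add_mem_nullNets hf (neg_mem_nullNets hg)

theorem sum_mem_nullNets {κ : Type*} (s : Finset κ) {f : κ → ι →ᵇ (H →L[ℂ] H)}
    (hf : ∀ k ∈ s, f k ∈ nullNets M l) : ∑ k ∈ s, f k ∈ nullNets M l := by
  classical
  induction s using Finset.induction_on with
  | empty => rw [Finset.sum_empty]; exact zero_mem_nullNets
  | insert a s ha ih =>
    rw [Finset.sum_insert ha]
    exact add_mem_nullNets (hf a (Finset.mem_insert_self a s))
      (ih fun k hk => hf k (Finset.mem_insert_of_mem hk))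

theorem star_mem_nullNets (hf : f ∈ nullNets M l) : star f ∈ nullNets M l := by
  refine ⟨fun i => star_mem (hf.1 i), hf.2.2, ?_⟩
  simpa using hf.2.1

theorem mul_mem_nullNets (hf : f ∈ nullNets M l) (hg : g ∈ nullNets M l) :
    f * g ∈ nullNets M l := by
  refine ⟨fun i => mul_mem (hf.1 i) (hg.1 i), hg.2.1.mul_left f.norm_coe_le_norm, ?_⟩
  simpa using hf.2.2.mul_left (norm_star_coe_le g)

/-- A uniform limit of strongly null nets is strongly null. Closedness is what allows continuous
functional calculus among multipliers and modulo null nets. -/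
theorem isClosed_nullNets (M : VonNeumannAlgebra H) (l : Filter ι) :
    IsClosed (nullNets M l) := by
  refine isClosed_of_closure_subset fun f hf => ?_
  rw [Metric.mem_closure_iff] at hf
  have hM : ∀ i, f i ∈ M := fun i => by
    have : f i ∈ closure (M : Set (H →L[ℂ] H)) := by
      rw [Metric.mem_closure_iff]
      intro ε hε
      obtain ⟨g, hg, h⟩ := hf ε hε
      exact ⟨g i, hg.1 i, (BoundedContinuousFunction.dist_coe_le_dist i).trans_lt h⟩
    rwa [(isClosed_vn M).closure_eq] at this
  have key : ∀ f' : ι →ᵇ (H →L[ℂ] H),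
      (∀ ε > 0, ∃ g : ι →ᵇ (H →L[ℂ] H), StrongTendsto l g 0 ∧ ‖f' - g‖ < ε) →
      StrongTendsto l f' 0 := by
    intro f' h ξ
    rw [Metric.tendsto_nhds]
    intro ε hε
    obtain ⟨g, hg, hfg⟩ := h (ε / 2 / (‖ξ‖ + 1)) (by positivity)
    have h1 := (Metric.tendsto_nhds.1 (hg ξ)) (ε / 2) (by positivity)
    filter_upwards [h1] with i hi
    simp only [zero_apply, dist_zero_right] at hi ⊢
    have h2 : ‖(f' i - g i) ξ‖ ≤ ε / 2 / (‖ξ‖ + 1) * ‖ξ‖ := by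
      refine ((f' i - g i).le_opNorm ξ).trans (mul_le_mul_of_nonneg_right ?_ (norm_nonneg _))
      exact ((f' - g).norm_coe_le_norm i).trans hfg.le
    have h3 : ε / 2 / (‖ξ‖ + 1) * ‖ξ‖ ≤ ε / 2 := by
      rw [div_mul_eq_mul_div, div_le_iff₀ (by positivity)]
      nlinarith [norm_nonneg ξ]
    have h4 : f' i ξ = (f' i - g i) ξ + g i ξ := by simp
    rw [h4]
    exact (norm_add_le _ _).trans_lt (by linarith)
  refine ⟨hM, key f fun ε hε => ?_, ?_⟩
  · obtain ⟨g, hg, h⟩ := hf ε hε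
    exact ⟨g, hg.2.1, by rwa [← dist_eq_norm]⟩
  · have := key (star f) fun ε hε => by
      obtain ⟨g, hg, h⟩ := hf ε hε
      refine ⟨star g, hg.2.2, ?_⟩
      rwa [← star_sub, norm_star, ← dist_eq_norm]
    exact this

/-- The two-sided multipliers of `nullNets M l` among bounded nets in `M`. -/
def multNets (M : VonNeumannAlgebra H) (l : Filter ι) : StarSubalgebra ℂ (ι →ᵇ (H →L[ℂ] H)) where
  carrier := {f | (∀ i, f i ∈ M) ∧ ∀ g ∈ nullNets M l, f * g ∈ nullNets M l ∧ g * f ∈ nullNets M l}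
  mul_mem' {f g} hf hg := by
    refine ⟨fun i => mul_mem (hf.1 i) (hg.1 i), fun k hk => ⟨?_, ?_⟩⟩
    · rw [mul_assoc]; exact (hf.2 _ (hg.2 k hk).1).1
    · rw [← mul_assoc]; exact (hg.2 _ (hf.2 k hk).2).2
  add_mem' {f g} hf hg := by
    refine ⟨fun i => add_mem (hf.1 i) (hg.1 i), fun k hk => ⟨?_, ?_⟩⟩
    · rw [add_mul]; exact add_mem_nullNets (hf.2 k hk).1 (hg.2 k hk).1
    · rw [mul_add]; exact add_mem_nullNets (hf.2 k hk).2 (hg.2 k hk).2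
  algebraMap_mem' c := by
    refine ⟨fun i => M.toStarSubalgebra.algebraMap_mem c, fun k hk => ?_⟩
    have h : c • k ∈ nullNets M l := by
      refine ⟨fun i => smul_mem_vn c (hk.1 i), fun ξ => ?_, fun ξ => ?_⟩
      · simpa using (hk.2.1 ξ).const_smul c
      · simpa using (hk.2.2 ξ).const_smul (star c)
    rw [← Algebra.commutes c k, ← Algebra.smul_def]
    exact ⟨h, h⟩
  star_mem' {f} hf := by
    refine ⟨fun i => star_mem (hf.1 i), fun k hk => ⟨?_, ?_⟩⟩
    · have h : star f * k = star (star k * f) := by ext; simp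
      rw [h]; exact star_mem_nullNets (hf.2 _ (star_mem_nullNets hk)).2
    · have h : k * star f = star (f * star k) := by ext; simp
      rw [h]; exact star_mem_nullNets (hf.2 _ (star_mem_nullNets hk)).1

theorem mem_multNets : f ∈ multNets M l ↔
    (∀ i, f i ∈ M) ∧ ∀ g ∈ nullNets M l, f * g ∈ nullNets M l ∧ g * f ∈ nullNets M l := Iff.rfl

theorem nullNets_subset_multNets (hf : f ∈ nullNets M l) : f ∈ multNets M l :=
  ⟨hf.1, fun _ hg => ⟨mul_mem_nullNets hf hg, mul_mem_nullNets hg hf⟩⟩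

theorem isClosed_multNets (M : VonNeumannAlgebra H) (l : Filter ι) :
    IsClosed (multNets M l : Set (ι →ᵇ (H →L[ℂ] H))) := by
  have h1 : (multNets M l : Set (ι →ᵇ (H →L[ℂ] H))) =
      (⋂ i, {f | f i ∈ (M : Set (H →L[ℂ] H))}) ∩
      ⋂ g ∈ nullNets M l, ({f | f * g ∈ nullNets M l} ∩ {f | g * f ∈ nullNets M l}) := by
    ext f
    simp only [SetLike.mem_coe, mem_multNets, Set.mem_inter_iff, Set.mem_iInter, Set.mem_ofPred_eq]
  rw [h1]
  refine IsClosed.inter (isClosed_iInter fun i => ?_)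
    (isClosed_iInter fun g => isClosed_iInter fun _ => IsClosed.inter ?_ ?_)
  · exact (isClosed_vn M).preimage (continuous_eval_const i)
  · exact (isClosed_nullNets M l).preimage (continuous_id.mul continuous_const)
  · exact (isClosed_nullNets M l).preimage (continuous_const.mul continuous_id)

/-- Pairs of multipliers with the same class modulo `nullNets M l`. -/
def equalNets (M : VonNeumannAlgebra H) (l : Filter ι) :
    StarSubalgebra ℂ ((ι →ᵇ (H →L[ℂ] H)) × (ι →ᵇ (H →L[ℂ] H))) where
  carrier := {p | p.1 ∈ multNets M l ∧ p.2 ∈ multNets M l ∧ p.1 - p.2 ∈ nullNets M l}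
  mul_mem' {p q} hp hq := by
    refine ⟨mul_mem hp.1 hq.1, mul_mem hp.2.1 hq.2.1, ?_⟩
    have e : (p * q).1 - (p * q).2 = p.1 * (q.1 - q.2) + (p.1 - p.2) * q.2 := by
      rw [Prod.fst_mul, Prod.snd_mul, mul_sub, sub_mul]; abel
    rw [e]
    exact add_mem_nullNets (hp.1.2 _ hq.2.2).1 (hq.2.1.2 _ hp.2.2).2
  add_mem' {p q} hp hq := by
    refine ⟨add_mem hp.1 hq.1, add_mem hp.2.1 hq.2.1, ?_⟩
    have e : (p + q).1 - (p + q).2 = (p.1 - p.2) + (q.1 - q.2) := by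
      rw [Prod.fst_add, Prod.snd_add]; abel
    rw [e]
    exact add_mem_nullNets hp.2.2 hq.2.2
  algebraMap_mem' c := by
    refine ⟨(multNets M l).algebraMap_mem c, (multNets M l).algebraMap_mem c, ?_⟩
    have e : ((algebraMap ℂ ((ι →ᵇ (H →L[ℂ] H)) × (ι →ᵇ (H →L[ℂ] H))) c).1 -
        (algebraMap ℂ ((ι →ᵇ (H →L[ℂ] H)) × (ι →ᵇ (H →L[ℂ] H))) c).2) = 0 := sub_self _
    rw [e]
    exact zero_mem_nullNets
  star_mem' {p} hp := by
    refine ⟨star_mem hp.1, star_mem hp.2.1, ?_⟩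
    have e : (star p).1 - (star p).2 = star (p.1 - p.2) := by
      rw [star_sub]; rfl
    rw [e]
    exact star_mem_nullNets hp.2.2

theorem isClosed_equalNets (M : VonNeumannAlgebra H) (l : Filter ι) :
    IsClosed (equalNets M l : Set ((ι →ᵇ (H →L[ℂ] H)) × (ι →ᵇ (H →L[ℂ] H)))) := by
  have h1 : (equalNets M l : Set ((ι →ᵇ (H →L[ℂ] H)) × (ι →ᵇ (H →L[ℂ] H)))) =
      Prod.fst ⁻¹' (multNets M l : Set (ι →ᵇ (H →L[ℂ] H))) ∩
      (Prod.snd ⁻¹' (multNets M l : Set (ι →ᵇ (H →L[ℂ] H))) ∩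
      (fun p => p.1 - p.2) ⁻¹' nullNets M l) := rfl
  rw [h1]
  exact ((isClosed_multNets M l).preimage continuous_fst).inter
    (((isClosed_multNets M l).preimage continuous_snd).inter
    ((isClosed_nullNets M l).preimage (continuous_fst.sub continuous_snd)))

/-- The pairs with equal classes form a closed *-subalgebra of the product, and functional calculus
on a pair acts coordinatewise. Hence it respects classes, with no need for a C*-structure on the
quotient. -/
theorem cfc_sub_cfc_mem_nullNets (hf : f ∈ multNets M l) (hg : g ∈ multNets M l)
    (hfs : IsSelfAdjoint f) (hgs : IsSelfAdjoint g) (hfg : f - g ∈ nullNets M l) {φ : ℝ → ℝ}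
    (hφ : Continuous φ) : cfc φ f - cfc φ g ∈ nullNets M l := by
  have hmem : (f, g) ∈ equalNets M l := ⟨hf, hg, hfg⟩
  have hs : IsSelfAdjoint (f, g) := by
    rw [IsSelfAdjoint, Prod.star_def]; exact Prod.ext hfs.star_eq hgs.star_eq
  have hc := isClosed_equalNets M l
  have h1 : cfc φ (f, g) ∈ equalNets M l := cfc_mem (𝕜' := ℂ) (hs := hc) φ hmem
  rw [cfc_map_prod (S := ℂ) φ f g hφ.continuousOn hs hfs hgs] at h1
  exact h1.2.2

theorem cfc_mem_multNets (hf : f ∈ multNets M l) (φ : ℝ → ℝ) : cfc φ f ∈ multNets M l :=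
  cfc_mem (𝕜' := ℂ) (hs := isClosed_multNets M l) φ hf

/-- Evaluation of nets as a `*`-homomorphism. -/
def evalNet (i : ι) : (ι →ᵇ (H →L[ℂ] H)) →⋆ₐ[ℂ] (H →L[ℂ] H) where
  toFun f := f i
  map_one' := rfl
  map_mul' _ _ := rfl
  map_zero' := rfl
  map_add' _ _ := rfl
  commutes' _ := rfl
  map_star' _ := rfl

theorem cfc_net_apply (hf : IsSelfAdjoint f) {φ : ℝ → ℝ} (hφ : Continuous φ) (i : ι) :
    (cfc φ f) i = cfc φ (f i) := by
  have hfi : IsSelfAdjoint (f i) := congrArg (fun h : ι →ᵇ (H →L[ℂ] H) => h i) hf.star_eq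
  exact StarAlgHom.map_cfc (S := ℂ) (evalNet (H := H) i) φ f hφ.continuousOn
    (continuous_eval_const i) hf hfi

theorem const_mem_multNets {x : H →L[ℂ] H} (hx : x ∈ M) :
    BoundedContinuousFunction.const ι x ∈ multNets M l := by
  refine ⟨fun _ => hx, fun g hg => ⟨⟨fun i => mul_mem hx (hg.1 i), ?_, ?_⟩,
    ⟨fun i => mul_mem (hg.1 i) hx, ?_, ?_⟩⟩⟩
  · exact hg.2.1.mul_left (C := ‖x‖) fun _ => le_rfl
  · simpa using hg.2.2.mul_const (star x)
  · exact hg.2.1.mul_const x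
  · simpa using hg.2.2.mul_left (S := fun _ => star x) (C := ‖star x‖) fun _ => le_rfl

theorem sub_compress_eq {R : Type*} [Ring R] (f q : R) :
    f - q * f * q = (1 - q) * f + f * (1 - q) - (1 - q) * (f * (1 - q)) := by
  noncomm_ring

/-- Cutting a multiplier by projections tending strongly to `1` does not change its class. -/
theorem sub_compress_mem_nullNets {q : ι →ᵇ (H →L[ℂ] H)} (hf : f ∈ multNets M l)
    (hq : 1 - q ∈ nullNets M l) : f - q * f * q ∈ nullNets M l := by
  have e : f - q * f * q = (1 - q) * f + f * (1 - q) - (1 - q) * (f * (1 - q)) :=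
    sub_compress_eq f q
  rw [e]
  have h1 := (hf.2 _ hq).1
  exact sub_mem_nullNets (add_mem_nullNets (hf.2 _ hq).2 h1) (mul_mem_nullNets hq h1)

theorem one_sub_mem_nullNets {q : ι →ᵇ (H →L[ℂ] H)} (hq : ∀ i, q i ∈ M ∧ IsStarProjection (q i))
    (h : StrongTendsto l (fun i => 1 - q i) 0) : 1 - q ∈ nullNets M l := by
  have e : ∀ i, (1 - q) i = 1 - q i := fun _ => rfl
  refine ⟨fun i => sub_mem (one_mem M) (hq i).1, h, ?_⟩
  simp only [e, (hq _).2.one_sub.isSelfAdjoint.star_eq]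
  exact h

namespace IsNormalExpectation

variable {A : VonNeumannAlgebra H} {F : (H →L[ℂ] H) → (H →L[ℂ] H)}

/-- Bounded nets in `A` are multipliers. -/
theorem mem_multNets (hF : IsNormalExpectation M A F) (hA : IsMASA A M) (hf : ∀ i, f i ∈ A) :
    f ∈ multNets M l := by
  refine ⟨fun i => hF.le (hf i), fun g hg => ⟨⟨fun i => mul_mem (hF.le (hf i)) (hg.1 i), ?_, ?_⟩,
    ⟨fun i => mul_mem (hg.1 i) (hF.le (hf i)), ?_, ?_⟩⟩⟩
  · exact hg.2.1.mul_left f.norm_coe_le_norm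
  -- The adjoint of `f g` is `g* f*`, with the net from `A` on the right: here the expectation is
  -- needed.
  · simpa using hF.strongTendsto_mul_right hA (fun i => star_mem (hg.1 i)) (norm_star_coe_le g)
      hg.2.2 (fun i => star_mem (hf i)) (norm_star_coe_le f)
  · exact hF.strongTendsto_mul_right hA hg.1 g.norm_coe_le_norm hg.2.1 hf f.norm_coe_le_norm
  · simpa using hg.2.2.mul_left (norm_star_coe_le f)

end IsNormalExpectation

end Nets

/-! ### Partitions of unity, pinchings and truncation -/

section Partitions

variable {H : Type*} [NormedAddCommGroup H] [InnerProductSpace ℂ H] [CompleteSpace H]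

/-- A finite partition of unity by projections in `A`. -/
def IsPartition (A : VonNeumannAlgebra H) {κ : Type*} [Fintype κ] (p : κ → H →L[ℂ] H) : Prop :=
  (∀ k, p k ∈ A ∧ IsStarProjection (p k)) ∧ ∑ k, p k = 1

theorem norm_projection_sq {p : H →L[ℂ] H} (hp : IsStarProjection p) (ξ : H) :
    ‖p ξ‖ ^ 2 = (inner ℂ ξ (p ξ)).re := by
  have h : inner ℂ ξ (p ξ) = inner ℂ (p ξ) (p ξ) := by
    conv_lhs => rw [← hp.isIdempotentElem.eq]
    rw [mul_apply_eq_comp, ← ContinuousLinearMap.adjoint_inner_left,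
      hp.isSelfAdjoint.adjoint_eq]
  rw [h, inner_self_eq_norm_sq_to_K, ← RCLike.ofReal_pow]
  exact (Complex.ofReal_re _).symm

namespace IsPartition

variable {A : VonNeumannAlgebra H} {κ : Type*} [Fintype κ] {p : κ → H →L[ℂ] H}

theorem sum_norm_sq (hp : IsPartition A p) (ξ : H) : ∑ k, ‖p k ξ‖ ^ 2 = ‖ξ‖ ^ 2 := by
  have h1 : ∑ k, p k ξ = ξ := by
    have := congrArg (fun S : H →L[ℂ] H => S ξ) hp.2
    simpa using this
  calc ∑ k, ‖p k ξ‖ ^ 2 = ∑ k, (inner ℂ ξ (p k ξ)).re :=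
        Finset.sum_congr rfl fun k _ => norm_projection_sq (hp.1 k).2 ξ
    _ = (inner ℂ ξ (∑ k, p k ξ)).re := by rw [inner_sum, Complex.re_sum]
    _ = ‖ξ‖ ^ 2 := by
      rw [h1, inner_self_eq_norm_sq_to_K, ← RCLike.ofReal_pow]
      exact Complex.ofReal_re _

/-- Apply Pythagoras to `p k ξ`: its `k`-th component already has the full norm, which leaves
nothing for the others. -/
theorem mul_eq_zero (hp : IsPartition A p) {j k : κ} (hjk : j ≠ k) : p j * p k = 0 := by
  classical
  ext ξ
  have h1 := hp.sum_norm_sq (p k ξ)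
  have h2 : p k (p k ξ) = p k ξ :=
    congrArg (fun S : H →L[ℂ] H => S ξ) (hp.1 k).2.isIdempotentElem.eq
  have h3 : ‖p k (p k ξ)‖ ^ 2 + ‖p j (p k ξ)‖ ^ 2 ≤ ∑ i, ‖p i (p k ξ)‖ ^ 2 := by
    rw [← Finset.sum_pair (f := fun i => ‖p i (p k ξ)‖ ^ 2) hjk.symm]
    exact Finset.sum_le_sum_of_subset_of_nonneg (Finset.subset_univ _) fun _ _ _ => sq_nonneg _
  rw [h1, h2] at h3
  have h4 : ‖p j (p k ξ)‖ ^ 2 = 0 := le_antisymm (by linarith) (sq_nonneg _)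
  exact norm_eq_zero.1 (pow_eq_zero_iff two_ne_zero |>.1 h4)

/-- Expand `‖Z ξ‖²` along the partition, then use Cauchy-Schwarz over the index and Pythagoras for
`ξ` and `Z ξ`. -/
theorem norm_pinch_le' (hp : IsPartition A p) {T : κ → H →L[ℂ] H} {C : ℝ} (hC : 0 ≤ C)
    (hT : ∀ k, ‖T k‖ ≤ C) : ‖∑ k, p k * T k * p k‖ ≤ C := by
  refine ContinuousLinearMap.opNorm_le_bound _ hC fun ξ => ?_
  set Z := ∑ k, p k * T k * p k with hZ
  have h1 : ‖Z ξ‖ ^ 2 ≤ C * ‖ξ‖ * ‖Z ξ‖ := by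
    calc ‖Z ξ‖ ^ 2 = (inner ℂ (Z ξ) (Z ξ)).re := by
          rw [inner_self_eq_norm_sq_to_K, ← RCLike.ofReal_pow]; exact (Complex.ofReal_re _).symm
      _ = ∑ k, (inner ℂ (p k (Z ξ)) (T k (p k ξ))).re := by
          have : Z ξ = ∑ k, p k (T k (p k ξ)) := by
            rw [hZ, sum_apply]; rfl
          conv_lhs => rw [this, inner_sum, Complex.re_sum, ← this]
          refine Finset.sum_congr rfl fun k _ => ?_
          rw [← ContinuousLinearMap.adjoint_inner_left, (hp.1 k).2.isSelfAdjoint.adjoint_eq]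
      _ ≤ ∑ k, C * (‖p k ξ‖ * ‖p k (Z ξ)‖) := by
          refine Finset.sum_le_sum fun k _ => ?_
          refine (Complex.re_le_norm _).trans ((norm_inner_le_norm _ _).trans ?_)
          have := (T k).le_of_opNorm_le (hT k) (p k ξ)
          calc ‖p k (Z ξ)‖ * ‖T k (p k ξ)‖ ≤ ‖p k (Z ξ)‖ * (C * ‖p k ξ‖) := by gcongr
            _ = _ := by ring
      _ = C * ∑ k, ‖p k ξ‖ * ‖p k (Z ξ)‖ := by rw [Finset.mul_sum]
      _ ≤ C * (‖ξ‖ * ‖Z ξ‖) := by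
          refine mul_le_mul_of_nonneg_left ?_ hC
          have := Finset.sum_mul_sq_le_sq_mul_sq Finset.univ (fun k => ‖p k ξ‖)
            (fun k => ‖p k (Z ξ)‖)
          rw [hp.sum_norm_sq, hp.sum_norm_sq, ← mul_pow] at this
          exact le_of_sq_le_sq this (by positivity)
      _ = C * ‖ξ‖ * ‖Z ξ‖ := by ring
  rcases (norm_nonneg (Z ξ)).eq_or_lt with h0 | h0
  · rw [← h0]; positivity
  · rw [sq] at h1
    exact le_of_mul_le_mul_right h1 h0

theorem norm_pinch_le (hp : IsPartition A p) (x : H →L[ℂ] H) : ‖∑ k, p k * x * p k‖ ≤ ‖x‖ :=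
  hp.norm_pinch_le' (norm_nonneg x) fun _ => le_rfl

theorem mul_pinch (hp : IsPartition A p) (x : H →L[ℂ] H) (k : κ) :
    p k * ∑ j, p j * x * p j = p k * x * p k := by
  classical
  rw [Finset.mul_sum, Finset.sum_eq_single k]
  · rw [← mul_assoc, ← mul_assoc, (hp.1 k).2.isIdempotentElem.eq]
  · intro j _ hj
    rw [← mul_assoc, ← mul_assoc, hp.mul_eq_zero hj.symm, zero_mul, zero_mul]
  · intro h; exact absurd (Finset.mem_univ k) h

theorem pinch_mul (hp : IsPartition A p) (x : H →L[ℂ] H) (k : κ) :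
    (∑ j, p j * x * p j) * p k = p k * x * p k := by
  classical
  rw [Finset.sum_mul, Finset.sum_eq_single k]
  · rw [mul_assoc, (hp.1 k).2.isIdempotentElem.eq]
  · intro j _ hj
    rw [mul_assoc, hp.mul_eq_zero hj, mul_zero]
  · intro h; exact absurd (Finset.mem_univ k) h

theorem pinch_of_commute (hp : IsPartition A p) {a : H →L[ℂ] H} (ha : ∀ k, a * p k = p k * a) :
    ∑ k, p k * a * p k = a := by
  have : ∀ k, p k * a * p k = a * p k := fun k => by
    rw [← ha, mul_assoc, (hp.1 k).2.isIdempotentElem.eq]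
  rw [Finset.sum_congr rfl fun k _ => this k, ← Finset.mul_sum, hp.2, mul_one]

/-- Bimodularity moves the pinching onto `F x`, which commutes with the partition because `A` is
abelian. -/
theorem map_pinch {M : VonNeumannAlgebra H} {F : (H →L[ℂ] H) → (H →L[ℂ] H)}
    (hF : IsNormalExpectation M A F) (hA : IsMASA A M) (hp : IsPartition A p) {x : H →L[ℂ] H}
    (hx : x ∈ M) : F (∑ k, p k * x * p k) = F x := by
  rw [hF.map_sum _ fun k => mul_mem (mul_mem (hF.le (hp.1 k).1) hx) (hF.le (hp.1 k).1)]
  have : ∀ k, F (p k * x * p k) = p k * F x * p k := fun k =>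
    hF.bimodule _ (hp.1 k).1 _ hx _ (hp.1 k).1
  rw [Finset.sum_congr rfl fun k _ => this k]
  exact hp.pinch_of_commute fun k => hA.commute (hF.mem _ hx) (hp.1 k).1

end IsPartition

theorem isPavableWith_iff {A : VonNeumannAlgebra H} {ε : ℝ} {n : ℕ} {x : H →L[ℂ] H} :
    IsPavableWith (A : Set (H →L[ℂ] H)) ε n x ↔
    ∃ (p : Fin n → H →L[ℂ] H) (a : H →L[ℂ] H), IsPartition A p ∧ a ∈ A ∧ ‖a‖ ≤ ‖x‖ ∧
      ‖∑ i, p i * x * p i - a‖ ≤ ε * ‖x‖ :=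
  ⟨fun ⟨p, a, h1, h2, h3, h4, h5⟩ => ⟨p, a, ⟨h1, h4⟩, h2, h3, h5⟩,
    fun ⟨p, a, ⟨h1, h4⟩, h2, h3, h5⟩ => ⟨p, a, h1, h2, h3, h4, h5⟩⟩

section Topology

theorem tendsto_so_iff {κ : Type*} {l : Filter κ} {T : κ → H →L[ℂ] H} {T₀ : H →L[ℂ] H} :
    Tendsto (fun i => so (T i)) l (𝓝 (so T₀)) ↔ StrongTendsto l T T₀ :=
  PointwiseConvergenceCLM.tendsto_iff_forall_tendsto

theorem tendsto_so_zero_iff {κ : Type*} {l : Filter κ} {T : κ → H →L[ℂ] H} :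
    Tendsto (fun i => so (T i)) l (𝓝 0) ↔ StrongTendsto l T 0 := by
  rw [← tendsto_so_iff, show so (0 : H →L[ℂ] H) = 0 from map_zero _]

/-- Choosing an operator in every strong neighbourhood of `0` gives a strongly null net. -/
theorem strongTendsto_of_forall_mem {T : {V : Set (H →Lₚₜ[ℂ] H) // V ∈ 𝓝 0} → H →L[ℂ] H}
    (hT : ∀ V, so (T V) ∈ V.1) :
    StrongTendsto (comap Subtype.val (𝓝 (0 : H →Lₚₜ[ℂ] H)).smallSets) T 0 := by
  rw [← tendsto_so_zero_iff]
  intro W hW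
  have h1 : ∀ᶠ V in (𝓝 (0 : H →Lₚₜ[ℂ] H)).smallSets, V ⊆ W :=
    eventually_smallSets.2 ⟨W, hW, fun _ h => h⟩
  have h2 := h1.comap (Subtype.val : {V : Set (H →Lₚₜ[ℂ] H) // V ∈ 𝓝 0} → _)
  exact mem_map.2 (h2.mono fun V hV => hV (hT V))

instance neBot_comap_smallSets : (comap (Subtype.val :
    {V : Set (H →Lₚₜ[ℂ] H) // V ∈ 𝓝 0} → Set (H →Lₚₜ[ℂ] H)) (𝓝 0).smallSets).NeBot := by
  rw [comap_neBot_iff]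
  intro t ht
  obtain ⟨W, hW, h⟩ := eventually_smallSets.1 (show ∀ᶠ V in (𝓝 0).smallSets, V ∈ t from ht)
  exact ⟨⟨W, hW⟩, h W subset_rfl⟩

/-- Strong lower semicontinuity of the norm, tested on one nearly norming vector. -/
theorem eventually_lt_norm {κ : Type*} {l : Filter κ} {T : κ → H →L[ℂ] H} {T₀ : H →L[ℂ] H}
    (h : StrongTendsto l T T₀) {r : ℝ} (hr : r < ‖T₀‖) : ∀ᶠ i in l, r < ‖T i‖ := by
  obtain ⟨ξ, hξ, hr'⟩ := T₀.exists_lt_apply_of_lt_opNorm hr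
  filter_upwards [(h ξ).norm.eventually (lt_mem_nhds hr')] with i hi
  refine hi.trans_le (((T i).le_opNorm ξ).trans ?_)
  exact mul_le_of_le_one_right (norm_nonneg _) hξ.le

theorem norm_le_of_strongTendsto {κ : Type*} {l : Filter κ} [l.NeBot] {T : κ → H →L[ℂ] H}
    {T₀ : H →L[ℂ] H} (h : StrongTendsto l T T₀) {r : ℝ} (hr : ∀ᶠ i in l, ‖T i‖ ≤ r) :
    ‖T₀‖ ≤ r := by
  by_contra hlt
  obtain ⟨i, h1, h2⟩ := ((eventually_lt_norm h (not_le.1 hlt)).and hr).exists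
  exact absurd h2 (not_le.2 h1)

end Topology

/-- The truncation of the real line to `[-c, c]`. -/
def clamp (c t : ℝ) : ℝ := max (-c) (min t c)

@[fun_prop]
theorem continuous_clamp (c : ℝ) : Continuous (clamp c) := by
  unfold clamp; fun_prop

theorem abs_clamp_le {c : ℝ} (hc : 0 ≤ c) (t : ℝ) : |clamp c t| ≤ c := by
  rw [abs_le, clamp]
  exact ⟨le_max_left _ _, max_le (by linarith) (min_le_right _ _)⟩

theorem clamp_of_abs_le {c t : ℝ} (h : |t| ≤ c) : clamp c t = t := by
  rw [abs_le] at h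
  rw [clamp, min_eq_left h.2, max_eq_right h.1]

theorem abs_sub_clamp_le {c : ℝ} (hc : 0 ≤ c) (t : ℝ) : |t - clamp c t| ≤ max (|t| - c) 0 := by
  unfold clamp
  rcases le_total t c with h | h
  · rw [min_eq_left h]
    rcases le_total (-c) t with h' | h'
    · rw [max_eq_right h', sub_self, abs_zero]; exact le_max_right _ _
    · rw [max_eq_left h', abs_of_nonpos (by linarith : t - -c ≤ 0),
        abs_of_nonpos (by linarith : t ≤ 0)]
      exact le_max_of_le_left (by linarith)
  · rw [min_eq_right h, max_eq_right (by linarith), abs_of_nonneg (by linarith : 0 ≤ t - c),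
      abs_of_nonneg (by linarith : 0 ≤ t)]
    exact le_max_left _ _

theorem abs_le_norm_of_mem_spectrum {a : H →L[ℂ] H} (ha : IsSelfAdjoint a) {t : ℝ}
    (ht : t ∈ spectrum ℝ a) : |t| ≤ ‖a‖ := by
  have := norm_apply_le_norm_cfc (fun x : ℝ => x) a ht
  rwa [cfc_id' ℝ a] at this

end Partitions

/-! ### So-paving versus app-paving -/

section AppPaving

variable {H : Type*} [NormedAddCommGroup H] [InnerProductSpace ℂ H] [CompleteSpace H]
  {M A : VonNeumannAlgebra H} {F : (H →L[ℂ] H) → (H →L[ℂ] H)}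

theorem isSoPavableWith_iff {ε : ℝ} {n : ℕ} {x : H →L[ℂ] H} :
    IsSoPavableWith M A ε n x ↔ ∀ V ∈ 𝓝 (0 : H →Lₚₜ[ℂ] H),
    ∃ (p : Fin n → H →L[ℂ] H) (a q : H →L[ℂ] H), IsPartition A p ∧ a ∈ A ∧
      (q ∈ M ∧ IsStarProjection q) ∧ ‖a‖ ≤ ‖x‖ ∧
      ‖q * (∑ i, p i * x * p i - a) * q‖ ≤ ε * ‖x‖ ∧ so (1 - q) ∈ V :=
  forall₂_congr fun _ _ =>
    ⟨fun ⟨p, a, q, h1, h2, h3, h4, h5, h6, h7⟩ => ⟨p, a, q, ⟨h1, h5⟩, h2, h3, h4, h6, h7⟩,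
    fun ⟨p, a, q, ⟨h1, h5⟩, h2, h3, h4, h6, h7⟩ => ⟨p, a, q, h1, h2, h3, h4, h5, h6, h7⟩⟩

/-- The element `0` is set apart because the strict slack used elsewhere is proportional to `‖x‖`. A
partition of length `n` must still be supplied. -/
theorem IsPartition.isSoPavableWith_zero {n : ℕ} {p : Fin n → H →L[ℂ] H} (hp : IsPartition A p)
    (ε : ℝ) : IsSoPavableWith M A ε n 0 := by
  rw [isSoPavableWith_iff]
  intro V hV
  refine ⟨p, 0, 1, hp, zero_mem A, ⟨one_mem M, .one _⟩, by simp, by simp, ?_⟩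
  rw [sub_self, show so (0 : H →L[ℂ] H) = 0 from map_zero _]
  exact mem_of_mem_nhds hV

/-- If `∑ pₖ x pₖ - a` is, up to a strongly null net, bounded by `r < s`, then cutting with
projections close to `1` makes it bounded by `s`. -/
theorem isSoPavableWith_of_net {κ : Type*} {l : Filter κ} [l.NeBot] {n : ℕ} {x : H →L[ℂ] H}
    (p : κ → Fin n → H →L[ℂ] H) (a w y : κ → H →L[ℂ] H) {r s ε : ℝ}
    (hp : ∀ i, IsPartition A (p i)) (ha : ∀ i, a i ∈ A) (hax : ∀ i, ‖a i‖ ≤ ‖x‖)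
    (hy : ∀ i, y i ∈ M) (hy0 : StrongTendsto l y 0)
    (hw : ∀ i, ‖w i‖ ≤ r) (hrs : r < s) (hs : s ≤ ε * ‖x‖)
    (he : ∀ i, ∑ k, p i k * x * p i k - a i = w i + y i) : IsSoPavableWith M A ε n x := by
  rw [isSoPavableWith_iff]
  intro V hV
  obtain ⟨q, hq, hyq, hq1⟩ := exists_projection_norm_mul_le hy hy0 (sub_pos.2 hrs)
  obtain ⟨i, hi⟩ := ((tendsto_so_zero_iff.2 hq1).eventually hV).exists
  refine ⟨p i, a i, q i, hp i, ha i, hq i, hax i, ?_, hi⟩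
  rw [he]
  have hn : ‖q i‖ ≤ 1 := (hq i).2.norm_le
  have e : q i * (w i + y i) * q i = q i * w i * q i + q i * (y i * q i) := by
    rw [mul_add, add_mul, mul_assoc (q i) (y i)]
  have hr : 0 ≤ r := (norm_nonneg _).trans (hw i)
  calc ‖q i * (w i + y i) * q i‖ ≤ ‖q i * w i * q i‖ + ‖q i * (y i * q i)‖ := by
        rw [e]; exact norm_add_le _ _
    _ ≤ ‖q i‖ * ‖w i‖ * ‖q i‖ + ‖q i‖ * ‖y i * q i‖ := by
        refine add_le_add ((norm_mul_le _ _).trans ?_) (norm_mul_le _ _)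
        exact mul_le_mul_of_nonneg_right (norm_mul_le _ _) (norm_nonneg _)
    _ ≤ 1 * r * 1 + 1 * (s - r) := by
        gcongr
        · exact hw i
        · exact hyq i
    _ ≤ ε * ‖x‖ := by linarith

theorem isSoPavableWith_of_isAppPavableWith (hF : IsNormalExpectation M A F) (hA : IsMASA A M)
    {x : H →L[ℂ] H} (hx : x ∈ M) {n : ℕ} {ε κ ε' : ℝ} (hε : 0 < ε) (hκ : 1 ≤ κ)
    (h : IsAppPavableWith M A ε n κ x) (hεε' : ε < ε') :
    IsSoPavableWith M A (2 * κ * ε') n x := by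
  -- The approximating net is indexed by the pavable elements themselves, with the neighbourhood
  -- filter of `x` pulled back.
  rw [IsAppPavableWith, mem_closure_iff_comap_neBot] at h
  set S := {y : H →L[ℂ] H | y ∈ M ∧ IsPavableWith (A : Set (H →L[ℂ] H)) ε n y ∧ ‖y‖ ≤ κ * ‖x‖}
  set l := comap (Subtype.val : so '' S → H →Lₚₜ[ℂ] H) (𝓝 (so x)) with hl
  choose y hyS hy using fun i : so '' S => i.2
  have hyx : StrongTendsto l y x := by
    rw [← tendsto_so_iff]
    simp only [hy]
    exact tendsto_comap
  choose p a hp ha hay hpa using fun i => isPavableWith_iff.1 (hyS i).2.1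
  rcases eq_or_ne x 0 with rfl | hx0
  · obtain ⟨i⟩ := l.nonempty_of_neBot
    exact (hp i).isSoPavableWith_zero _
  have hxpos : 0 < ‖x‖ := norm_pos_iff.2 hx0
  have hpM : ∀ i k, p i k ∈ M := fun i k => hF.le ((hp i).1 k).1
  set d : so '' S → H →L[ℂ] H := fun i => x - y i with hd
  have hdM : ∀ i, d i ∈ M := fun i => sub_mem hx (hyS i).1
  have hdn : ∀ i, ‖d i‖ ≤ ‖x‖ + κ * ‖x‖ := fun i =>
    (norm_sub_le _ _).trans (add_le_add_right (hyS i).2.2 _)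
  have hd0 : StrongTendsto l d 0 := by
    have := (strongTendsto_const (l := l) (T₀ := x)).sub hyx
    rwa [sub_self] at this
  have hZ : StrongTendsto l (fun i => ∑ k, p i k * d i * p i k) 0 := by
    have hk : ∀ k, StrongTendsto l (fun i => p i k * (d i * p i k)) 0 := fun k =>
      (hF.strongTendsto_mul_right hA hdM hdn hd0 (fun i => ((hp i).1 k).1)
        (fun i => ((hp i).1 k).2.norm_le)).mul_left fun i => ((hp i).1 k).2.norm_le
    intro ξ
    have := tendsto_finsetSum Finset.univ fun k _ => hk k ξ
    simpa [sum_apply, mul_assoc] using this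
  -- The element of `A` is `F x` for every index, so its norm is automatically at most `‖x‖`.
  refine isSoPavableWith_of_net (l := l) p (fun _ => F x)
    (fun i => ∑ k, p i k * y i * p i k - F (y i))
    (fun i => ∑ k, p i k * d i * p i k - F (d i)) hp (fun _ => hF.mem _ hx)
    (fun _ => hF.norm_le hx) (fun i => sub_mem (sum_mem fun k _ =>
      mul_mem (mul_mem (hpM i k) (hdM i)) (hpM i k)) (hF.le (hF.mem _ (hdM i)))) ?_
    (r := 2 * κ * ε * ‖x‖) (fun i => ?_) ?_ le_rfl (fun i => ?_)
  · have := hZ.sub (hF.strongTendsto_map hA hdM hdn hd0)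
    rwa [sub_zero] at this
  · set w := ∑ k, p i k * y i * p i k - a i with hw
    have hyM := (hyS i).1
    have hsM : ∑ k, p i k * y i * p i k ∈ M :=
      sum_mem fun k _ => mul_mem (mul_mem (hpM i k) hyM) (hpM i k)
    have hFw : F w = F (y i) - a i := by
      rw [hw, hF.map_sub hsM (hF.le (ha i)), (hp i).map_pinch hF hA hyM, hF.map_of_mem _ (ha i)]
    -- Replacing the given `a i` by `F (y i)` subtracts `F w`, which at most doubles the error: the
    -- origin of the factor `2`.
    have e : ∑ k, p i k * y i * p i k - F (y i) = w - F w := by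
      rw [hFw, hw]; abel
    have hwn : ‖w‖ ≤ ε * (κ * ‖x‖) :=
      (hpa i).trans (mul_le_mul_of_nonneg_left (hyS i).2.2 hε.le)
    rw [e]
    have := hF.norm_le (sub_mem hsM (hF.le (ha i)))
    refine (norm_sub_le _ _).trans ?_
    linarith
  · have : 0 < 2 * κ * ‖x‖ := by positivity
    nlinarith
  · have h1 : F (d i) = F x - F (y i) := hF.map_sub hx (hyS i).1
    have h2 : ∑ k, p i k * d i * p i k
        = ∑ k, p i k * x * p i k - ∑ k, p i k * y i * p i k := by
      simp only [hd, mul_sub, sub_mul, Finset.sum_sub_distrib]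
    rw [h1, h2]
    abel

/-- A bounded family of operators as a bounded net. -/
def bddNet {ι : Type*} [TopologicalSpace ι] [DiscreteTopology ι] (T : ι → H →L[ℂ] H) {C : ℝ}
    (hC : ∀ i, ‖T i‖ ≤ C) : ι →ᵇ (H →L[ℂ] H) :=
  BoundedContinuousFunction.ofNormedAddCommGroupDiscrete T C hC

theorem norm_le_of_abs_spectrum {a : H →L[ℂ] H} {g : ℝ → ℝ} {c : ℝ} (hc : 0 ≤ c)
    (h : ∀ t, |t| ≤ ‖a‖ → |g t| ≤ c) (ha : IsSelfAdjoint a) : ‖cfc g a‖ ≤ c :=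
  norm_cfc_le hc fun t ht => h t (abs_le_norm_of_mem_spectrum ha ht)

section Nets

variable {ι : Type*} [TopologicalSpace ι] {l : Filter ι}

theorem star_mul_net (f g : ι →ᵇ (H →L[ℂ] H)) : star (f * g) = star g * star f := by
  ext; simp

theorem pinch_mem_multNets {κ : Type*} [Fintype κ] {P : κ → ι →ᵇ (H →L[ℂ] H)}
    {f : ι →ᵇ (H →L[ℂ] H)} (hP : ∀ k, P k ∈ multNets M l) (hf : f ∈ multNets M l) :
    ∑ k, P k * f * P k ∈ multNets M l :=
  sum_mem fun k _ => mul_mem (mul_mem (hP k) hf) (hP k)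

/-- If a self-adjoint multiplier is bounded by `c` after cutting with projections converging to
`1`, then its part of modulus more than `c` is null. -/
theorem cfc_sub_clamp_mem_nullNets {z q : ι →ᵇ (H →L[ℂ] H)} (hz : z ∈ multNets M l)
    (hzs : IsSelfAdjoint z) (hqp : ∀ i, IsStarProjection (q i)) (hq : 1 - q ∈ nullNets M l)
    {c : ℝ} (hc : ∀ i, ‖q i * z i * q i‖ ≤ c) :
    cfc (fun t => t - clamp c t) z ∈ nullNets M l := by
  have hqs : star q = q := by
    ext1 i; exact (hqp i).isSelfAdjoint.star_eq
  set b := q * z * q with hb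
  have hbs : IsSelfAdjoint b := by
    rw [IsSelfAdjoint, hb, star_mul_net, star_mul_net, hqs, hzs.star_eq, mul_assoc]
  have h1 : z - b ∈ nullNets M l := sub_compress_mem_nullNets hz hq
  have hbm : b ∈ multNets M l := by
    have := sub_mem hz (nullNets_subset_multNets h1)
    rwa [sub_sub_cancel] at this
  have hg : Continuous fun t => t - clamp c t := by fun_prop
  have h2 := cfc_sub_cfc_mem_nullNets hz hbm hzs hbs h1 hg
  -- The spectrum of each `b i` lies in `[-c, c]`, where truncation is the identity.
  have h3 : cfc (fun t => t - clamp c t) b = 0 := by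
    ext1 i
    rw [cfc_net_apply hbs hg]
    have hbi : IsSelfAdjoint (b i) :=
      congrArg (fun h : ι →ᵇ (H →L[ℂ] H) => h i) hbs.star_eq
    have : cfc (fun t => t - clamp c t) (b i) = cfc (0 : ℝ → ℝ) (b i) :=
      cfc_congr fun t ht => by
        have := clamp_of_abs_le ((abs_le_norm_of_mem_spectrum hbi ht).trans (hc i))
        simp [this]
    rw [this, cfc_zero]
    rfl
  rwa [h3, sub_zero] at h2

end Nets

/-- The chosen `δ` gives equality. It pays both for shrinking `a` by `1 - δ` and for a drop of the
norm to `(1 - δ) ‖x‖`. -/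
theorem exists_slack {ε ε' : ℝ} (hε : 0 < ε) (h : ε < ε') :
    ∃ δ : ℝ, 0 < δ ∧ δ < 1 ∧ ε + δ ≤ ε' * (1 - δ) := by
  refine ⟨(ε' - ε) / (1 + ε'), div_pos (by linarith) (by linarith),
    (div_lt_one (by linarith)).2 (by linarith), ?_⟩
  have h1 : (1 + ε') ≠ 0 := by linarith
  have h2 : (ε' - ε) / (1 + ε') * (1 + ε') = ε' - ε := div_mul_cancel₀ _ h1
  nlinarith

theorem isAppPavableWith_of_isSoPavableWith (hF : IsNormalExpectation M A F) (hA : IsMASA A M)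
    {x : H →L[ℂ] H} (hx : x ∈ M) (hxs : IsSelfAdjoint x) {n : ℕ} {ε ε' : ℝ} (hε : 0 < ε)
    (h : IsSoPavableWith M A ε n x) (hεε' : ε < ε') : IsAppPavableWith M A ε' n 3 x := by
  obtain ⟨δ, hδ0, hδ1, hδ⟩ := exists_slack hε hεε'
  rw [isSoPavableWith_iff] at h
  let ι := {V : Set (H →Lₚₜ[ℂ] H) // V ∈ 𝓝 0}
  choose p a q hp ha hq hax hqz hqV using fun V : ι => h V.1 V.2
  let l : Filter ι := comap Subtype.val (𝓝 (0 : H →Lₚₜ[ℂ] H)).smallSets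
  have : l.NeBot := neBot_comap_smallSets
  let _ : TopologicalSpace ι := ⊥
  have : DiscreteTopology ι := ⟨rfl⟩
  have hq1 : StrongTendsto l (fun i => 1 - q i) 0 := strongTendsto_of_forall_mem hqV
  -- Self-adjointness is needed for the real functional calculus. As `x` is self-adjoint, passing to
  -- real parts does not worsen the compressed estimate.
  set b : ι → H →L[ℂ] H := fun i => (realPart (a i) : H →L[ℂ] H) with hb
  have hbA : ∀ i, b i ∈ A := fun i => by
    rw [hb]; simp only [realPart_apply_coe]
    exact real_smul_mem_vn _ (add_mem (ha i) (star_mem (ha i)))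
  have hbs : ∀ i, IsSelfAdjoint (b i) := fun i => (realPart (a i)).2
  have hbn : ∀ i, ‖b i‖ ≤ ‖x‖ := fun i => (realPart.norm_le (a i)).trans (hax i)
  set z : ι → H →L[ℂ] H := fun i => ∑ k, p i k * x * p i k - b i with hz
  have hqzs : ∀ i, IsSelfAdjoint (z i) := fun i =>
    (isSelfAdjoint_sum _ fun k _ => by
      have := hxs.conjugate (p i k)
      rwa [((hp i).1 k).2.isSelfAdjoint.star_eq] at this).sub (hbs i)
  have hzn : ∀ i, ‖z i‖ ≤ 2 * ‖x‖ := fun i =>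
    (norm_sub_le _ _).trans (by linarith [(hp i).norm_pinch_le x, hbn i])
  have hqz : ∀ i, ‖q i * z i * q i‖ ≤ ε * ‖x‖ := fun i => by
    have e : q i * z i * q i
        = (realPart (q i * (∑ k, p i k * x * p i k - a i) * q i) : H →L[ℂ] H) := by
      have hqs := (hq i).2.isSelfAdjoint.star_eq
      have hP : star (∑ k, p i k * x * p i k) = ∑ k, p i k * x * p i k := by
        rw [star_sum]
        refine Finset.sum_congr rfl fun k _ => ?_
        rw [star_mul, star_mul, ((hp i).1 k).2.isSelfAdjoint.star_eq, hxs.star_eq, mul_assoc]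
      rw [hz, hb]
      simp only [realPart_apply_coe]
      rw [star_mul, star_mul, hqs, star_sub, hP, ← mul_assoc, ← add_mul, ← mul_add,
        mul_assoc, mul_assoc, ← mul_smul_comm, ← smul_mul_assoc]
      congr 2
      have h2 : ∀ y : H →L[ℂ] H, y = (2 : ℝ)⁻¹ • (y + y) := fun y => by
        rw [← two_smul ℝ y, smul_smul]; norm_num
      conv_lhs => rw [h2 (∑ k, p i k * x * p i k)]
      rw [← smul_sub]
      congr 1
      abel
    rw [e]
    exact (realPart.norm_le _).trans (hqz i)
  let P : Fin n → ι →ᵇ (H →L[ℂ] H) := fun k =>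
    bddNet (fun i => p i k) fun i => ((hp i).1 k).2.norm_le
  let Q : ι →ᵇ (H →L[ℂ] H) := bddNet q fun i => (hq i).2.norm_le
  let B : ι →ᵇ (H →L[ℂ] H) := bddNet b hbn
  let Z : ι →ᵇ (H →L[ℂ] H) := bddNet z hzn
  have hZ : Z = ∑ k, P k * BoundedContinuousFunction.const ι x * P k - B := by
    ext1 i
    rw [BoundedContinuousFunction.sub_apply, BoundedContinuousFunction.sum_apply]
    rfl
  have hZm : Z ∈ multNets M l := by
    rw [hZ]
    exact sub_mem (pinch_mem_multNets (fun k => hF.mem_multNets hA fun i => ((hp i).1 k).1)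
      (const_mem_multNets hx)) (hF.mem_multNets hA hbA)
  have hZs : IsSelfAdjoint Z := by
    rw [IsSelfAdjoint]; ext1 i; exact (hqzs i).star_eq
  have hg : Continuous fun t => t - clamp (ε * ‖x‖) t := by fun_prop
  have hnull := cfc_sub_clamp_mem_nullNets hZm hZs (q := Q) (fun i => (hq i).2)
    (one_sub_mem_nullNets hq hq1) hqz
  set w : ι → H →L[ℂ] H := fun i => cfc (fun t => t - clamp (ε * ‖x‖) t) (z i) with hw
  have hw0 : StrongTendsto l w 0 := by
    have := hnull.2.1
    have e : ∀ i, (cfc (fun t => t - clamp (ε * ‖x‖) t) Z) i = w i := fun i =>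
      cfc_net_apply hZs hg i
    intro ξ
    simpa only [e] using this ξ
  have hc : 0 ≤ ε * ‖x‖ := by positivity
  have hwn : ∀ i, ‖w i‖ ≤ 2 * ‖x‖ := fun i =>
    norm_le_of_abs_spectrum (by positivity) (fun t ht => by
      refine (abs_sub_clamp_le hc t).trans (max_le ?_ (by positivity))
      linarith [hzn i]) (hqzs i)
  have hzM : ∀ i, z i ∈ M := fun i => sub_mem (sum_mem fun k _ =>
    mul_mem (mul_mem (hF.le ((hp i).1 k).1) hx) (hF.le ((hp i).1 k).1)) (hF.le (hbA i))
  have hyx : StrongTendsto l (fun i => x - w i) x := by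
    have := (strongTendsto_const (l := l) (T₀ := x)).sub hw0
    rwa [sub_zero] at this
  -- Paving `x - w i` is measured against its own norm, which may be smaller than `‖x‖`.
  have hlow : ∀ᶠ i in l, (1 - δ) * ‖x‖ ≤ ‖x - w i‖ := by
    rcases eq_or_ne x 0 with hx0 | hx0
    · rw [hx0, norm_zero, mul_zero]
      exact Eventually.of_forall fun _ => norm_nonneg _
    · have : 0 < ‖x‖ := norm_pos_iff.2 hx0
      exact (eventually_lt_norm hyx (by nlinarith : (1 - δ) * ‖x‖ < ‖x‖)).mono fun _ h => h.le
  refine mem_closure_of_tendsto (tendsto_so_iff.2 hyx) (hlow.mono fun i hi => ?_)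
  refine ⟨x - w i, ⟨sub_mem hx (cfc_mem_vn (hzM i) _), ?_, ?_⟩, rfl⟩
  · rw [isPavableWith_iff]
    refine ⟨p i, (1 - δ) • b i, hp i, real_smul_mem_vn _ (hbA i), ?_, ?_⟩
    · rw [norm_smul, Real.norm_of_nonneg (by linarith)]
      exact (mul_le_mul_of_nonneg_left (hbn i) (by linarith)).trans hi
    -- Both the pinching and `b i` commute with the partition, hence so does `w i`. Pinching thus
    -- fixes `w i`, and only the truncation of `z i` remains.
    · have hcomm : ∀ k, z i * p i k = p i k * z i := fun k => by
        rw [hz]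
        simp only
        rw [sub_mul, mul_sub, (hp i).mul_pinch, (hp i).pinch_mul,
          hA.commute (hbA i) ((hp i).1 k).1]
      have hwp : ∑ k, p i k * w i * p i k = w i :=
        (hp i).pinch_of_commute fun k => (Commute.cfc_real (hcomm k) _).eq
      have e1 : ∑ k, p i k * (x - w i) * p i k = ∑ k, p i k * x * p i k - w i := by
        conv_rhs => rw [← hwp]
        simp only [mul_sub, sub_mul, Finset.sum_sub_distrib]
      have e2 : z i - w i = cfc (clamp (ε * ‖x‖)) (z i) := by
        have hzi := hqzs i
        rw [hw]
        simp only
        conv_lhs => rw [← cfc_id' ℝ (z i)]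
        rw [cfc_id' ℝ (z i), cfc_sub (fun t => t) (clamp (ε * ‖x‖)) (z i) (by fun_prop)
          (by fun_prop), cfc_id' ℝ (z i), sub_sub_cancel]
      have e3 : ∑ k, p i k * (x - w i) * p i k - (1 - δ) • b i
          = cfc (clamp (ε * ‖x‖)) (z i) + δ • b i := by
        have hzi : z i = ∑ k, p i k * x * p i k - b i := rfl
        rw [e1, ← e2, hzi, sub_smul, one_smul]
        abel
      have h1 : ‖cfc (clamp (ε * ‖x‖)) (z i)‖ ≤ ε * ‖x‖ :=
        norm_le_of_abs_spectrum hc (fun t _ => abs_clamp_le hc t) (hqzs i)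
      have h2 : ‖δ • b i‖ ≤ δ * ‖x‖ := by
        rw [norm_smul, Real.norm_of_nonneg hδ0.le]
        exact mul_le_mul_of_nonneg_left (hbn i) hδ0.le
      rw [e3]
      refine (norm_add_le _ _).trans ?_
      have h3 : ε' * ((1 - δ) * ‖x‖) ≤ ε' * ‖x - w i‖ :=
        mul_le_mul_of_nonneg_left hi (by linarith)
      have h4 : (ε + δ) * ‖x‖ ≤ ε' * (1 - δ) * ‖x‖ :=
        mul_le_mul_of_nonneg_right hδ (norm_nonneg x)
      linarith
  · refine (norm_sub_le _ _).trans ?_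
    linarith [hwn i]

theorem isSoPavable_iff_isAppPavable (hF : IsNormalExpectation M A F) (hA : IsMASA A M)
    {x : H →L[ℂ] H} (hx : x ∈ M) (hxs : IsSelfAdjoint x) :
    IsSoPavable M A x ↔ IsAppPavable M A x := by
  constructor
  · intro h
    refine ⟨3, fun ε hε => ?_⟩
    obtain ⟨n, hn⟩ := h (ε / 2) (by positivity)
    exact ⟨n, isAppPavableWith_of_isSoPavableWith hF hA hx hxs (by positivity) hn (by linarith)⟩
  · rintro ⟨κ, h⟩ ε hε
    -- App-pavability puts no lower bound on its constant; enlarging it to at least `1` is harmless.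
    have hκ : 1 ≤ max κ 1 := le_max_right _ _
    have hκ0 : 0 < max κ 1 := by linarith
    obtain ⟨n, hn⟩ := h (ε / (4 * max κ 1)) (by positivity)
    refine ⟨n, ?_⟩
    have h1 : IsAppPavableWith M A (ε / (4 * max κ 1)) n (max κ 1) x := by
      refine closure_mono (Set.image_mono ?_) hn
      rintro y ⟨h1, h2, h3⟩
      exact ⟨h1, h2, h3.trans (mul_le_mul_of_nonneg_right (le_max_left _ _) (norm_nonneg _))⟩
    have h2 := isSoPavableWith_of_isAppPavableWith hF hA hx (by positivity) hκ h1
      (ε' := ε / (2 * max κ 1)) (by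
        apply div_lt_div_of_pos_left hε (by positivity); linarith)
    rwa [mul_div_cancel₀ ε (by positivity)] at h2

end AppPaving

/-! ### Countable decomposability: from nets to sequences -/

section State

variable {H : Type*} [NormedAddCommGroup H] [InnerProductSpace ℂ H] [CompleteSpace H]
  {M A : VonNeumannAlgebra H} {F : (H →L[ℂ] H) → (H →L[ℂ] H)}

open Classical in
/-- The functional `φ ∘ F`, as a function on all of `B(H)`. -/
def compState (φ : A.toStarSubalgebra →ₗ[ℂ] ℂ) (F : (H →L[ℂ] H) → (H →L[ℂ] H)) (x : H →L[ℂ] H) :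
    ℂ :=
  if h : F x ∈ A.toStarSubalgebra then φ ⟨F x, h⟩ else 0

variable {φ : A.toStarSubalgebra →ₗ[ℂ] ℂ} {ι : Type*} {l : Filter ι}

theorem compState_apply (hF : IsNormalExpectation M A F) {x : H →L[ℂ] H} (hx : x ∈ M) :
    compState φ F x = φ ⟨F x, hF.mem x hx⟩ :=
  dif_pos (hF.mem x hx)

theorem tendsto_compState (hF : IsNormalExpectation M A F) (hφ : IsNormalFaithfulState A φ)
    {T : ι → H →L[ℂ] H} {T₀ : H →L[ℂ] H} (hT : ∀ i, T i ∈ M) {C : ℝ} (hC : ∀ i, ‖T i‖ ≤ C)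
    (hT₀ : T₀ ∈ M) (h : WeakTendsto l T T₀) :
    Tendsto (fun i => compState φ F (T i)) l (𝓝 (compState φ F T₀)) := by
  have h1 := hF.weakTendsto (Eventually.of_forall hT) (Eventually.of_forall hC) hT₀ h
  have h2 := h1.sigmaWeak (C := C)
    (Eventually.of_forall fun i => (hF.norm_le (hT i)).trans (hC i))
  let T' : ι → A.toStarSubalgebra := fun i => ⟨F (T i), hF.mem _ (hT i)⟩
  have h3 : Tendsto T' l (@nhds _ (sigmaWeakOn A) ⟨F T₀, hF.mem _ hT₀⟩) :=
    tendsto_sigmaWeakOn.2 h2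
  have h4 := (@Continuous.tendsto _ _ (sigmaWeakOn A) _ _ hφ.normal _).comp h3
  rw [compState_apply hF hT₀]
  refine h4.congr fun i => ?_
  rw [compState_apply hF (hT i)]
  rfl

theorem compState_zero (hF : IsNormalExpectation M A F) : compState φ F 0 = 0 := by
  rw [compState_apply hF (zero_mem M)]
  have : (⟨F 0, hF.mem 0 (zero_mem M)⟩ : A.toStarSubalgebra) = 0 := Subtype.ext hF.map_zero
  rw [this, map_zero]

/-- If `A` is countably decomposable, a single functional detects strong convergence to `0` of
projections of `M`. -/
theorem strongTendsto_iff_compState (hF : IsNormalExpectation M A F) (hA : IsMASA A M)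
    (hφ : IsNormalFaithfulState A φ) {e : ι → H →L[ℂ] H}
    (he : ∀ i, e i ∈ M ∧ IsStarProjection (e i)) :
    StrongTendsto l e 0 ↔ Tendsto (fun i => compState φ F (e i)) l (𝓝 0) := by
  have he1 : ∀ i, ‖e i‖ ≤ 1 := fun i => (he i).2.norm_le
  refine ⟨fun h => ?_, fun h => ?_⟩
  · rw [← compState_zero (φ := φ) hF]
    exact tendsto_compState hF hφ (fun i => (he i).1) he1 (zero_mem M) h.weakTendsto
  · have e1 : ∀ i, star (e i) * e i = e i := fun i => by
      rw [(he i).2.isSelfAdjoint.star_eq, (he i).2.isIdempotentElem.eq]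
    rw [strongTendsto_zero_iff]
    simp only [e1]
    refine weakTendsto_of_ultrafilter fun U hU => ?_
    obtain ⟨T₀, hT₀⟩ := exists_weakTendsto (T := e) U (C := 1)
      (Eventually.of_forall he1)
    have hM : T₀ ∈ M := mem_of_weakTendsto M hT₀ (Eventually.of_forall fun i => (he i).1)
    have hp : 0 ≤ T₀ := nonneg_of_weakTendsto hT₀ (Eventually.of_forall fun i => (he i).2.nonneg)
    have h1 := tendsto_nhds_unique
      (tendsto_compState hF hφ (fun i => (he i).1) he1 hM hT₀) (h.mono_left hU)
    -- Two faithfulness arguments in a row: that of the state gives `F T₀ = 0`, that of `F` gives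
    -- `T₀ = 0`.
    obtain ⟨s, hs, hss, hsF⟩ := exists_sqrt_mem (hF.mem _ hM) (hF.nonneg hM hp)
    have h2 : φ (star (⟨s, hs⟩ : A.toStarSubalgebra) * ⟨s, hs⟩) = 0 := by
      rw [← h1, compState_apply hF hM]
      congr 1
      refine Subtype.ext ?_
      change star s * s = F T₀
      rw [hss.star_eq, hsF]
    have h3 : s = 0 := congrArg Subtype.val (hφ.faithful _ h2)
    have h4 : F T₀ = 0 := by rw [← hsF, h3, mul_zero]
    obtain ⟨t, ht, hts, rfl⟩ := exists_sqrt_mem hM hp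
    have h5 := hF.faithful hA ht (by rwa [hts.star_eq])
    rwa [h5, mul_zero] at hT₀

/-- If every term of a sequence is so-pavable, the pavings can be chosen with cutting projections
converging strongly to `1`. -/
theorem exists_sequence_paving (hF : IsNormalExpectation M A F) (hA : IsMASA A M)
    (hφ : IsCountablyDecomposable A) {n : ℕ} {ε : ℝ} {x : ℕ → H →L[ℂ] H}
    (hx : ∀ m, IsSoPavableWith M A ε n (x m)) :
    ∃ (p : ℕ → Fin n → H →L[ℂ] H) (a q : ℕ → H →L[ℂ] H), (∀ m, IsPartition A (p m)) ∧
      (∀ m, a m ∈ A) ∧ (∀ m, q m ∈ M ∧ IsStarProjection (q m)) ∧ (∀ m, ‖a m‖ ≤ ‖x m‖) ∧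
      (∀ m, ‖q m * (∑ i, p m i * x m * p m i - a m) * q m‖ ≤ ε * ‖x m‖) ∧
      StrongTendsto atTop (fun m => 1 - q m) 0 := by
  obtain ⟨φ, hφ⟩ := hφ
  have key : ∀ m : ℕ, ∃ (p : Fin n → H →L[ℂ] H) (a q : H →L[ℂ] H), IsPartition A p ∧
      a ∈ A ∧ (q ∈ M ∧ IsStarProjection q) ∧ ‖a‖ ≤ ‖x m‖ ∧
      ‖q * (∑ i, p i * x m * p i - a) * q‖ ≤ ε * ‖x m‖ ∧ ‖compState φ F (1 - q)‖ < 1 / ((m : ℝ) + 1) := by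
    intro m
    have h := isSoPavableWith_iff.1 (hx m)
    choose p a q hp ha hq hax hqz hqV using
      fun V : {V : Set (H →Lₚₜ[ℂ] H) // V ∈ 𝓝 0} => h V.1 V.2
    have h1 := strongTendsto_of_forall_mem hqV
    rw [strongTendsto_iff_compState hF hA hφ fun V => ⟨sub_mem (one_mem M) (hq V).1, (hq V).2.one_sub⟩] at h1
    have h2 := h1.norm
    rw [norm_zero] at h2
    -- Along shrinking neighbourhoods the functional at `1 - q` tends to zero, so the `m`-th term
    -- can be asked to fall below `1 / (m + 1)`.
    obtain ⟨V, hV⟩ := (h2.eventually (gt_mem_nhds (by positivity : 0 < 1 / ((m : ℝ) + 1)))).exists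
    exact ⟨p V, a V, q V, hp V, ha V, hq V, hax V, hqz V, hV⟩
  choose p a q hp ha hq hax hqz hqm using key
  refine ⟨p, a, q, hp, ha, hq, hax, hqz, ?_⟩
  rw [strongTendsto_iff_compState hF hA hφ fun m =>
    ⟨sub_mem (one_mem M) (hq m).1, (hq m).2.one_sub⟩]
  exact squeeze_zero_norm (fun m => (hqm m).le) tendsto_one_div_add_atTop_nhds_zero_nat

end State

/-! ### From so-pavings in `M` to norm pavings in the ultrapower -/

section Ultrapower

variable {H : Type*} [NormedAddCommGroup H] [InnerProductSpace ℂ H] [CompleteSpace H]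
  {M A : VonNeumannAlgebra H} {F : (H →L[ℂ] H) → (H →L[ℂ] H)} {ω : Ultrafilter ℕ}

theorem mem_nullSeq_iff {f : ℕ →ᵇ (H →L[ℂ] H)} :
    f ∈ nullSeq M ω ↔ f ∈ nullNets M (ω : Filter ℕ) :=
  ⟨fun h => ⟨h.1, fun ξ => (h.2 ξ).1, fun ξ => (h.2 ξ).2⟩,
    fun h => ⟨h.1, fun ξ => ⟨h.2.1 ξ, h.2.2 ξ⟩⟩⟩

theorem mem_multiplier_iff {f : ℕ →ᵇ (H →L[ℂ] H)} :
    f ∈ multiplier M ω ↔ f ∈ multNets M (ω : Filter ℕ) := by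
  change ((∀ m, f m ∈ M) ∧ ∀ g ∈ nullSeq M ω, f * g ∈ nullSeq M ω ∧ g * f ∈ nullSeq M ω) ↔ _
  simp only [mem_nullSeq_iff]
  exact mem_multNets.symm

theorem smul_mem_nullNets {f : ℕ →ᵇ (H →L[ℂ] H)} (c : ℂ) (hf : f ∈ nullNets M (ω : Filter ℕ)) :
    c • f ∈ nullNets M (ω : Filter ℕ) := by
  refine ⟨fun i => smul_mem_vn c (hf.1 i), fun ξ => ?_, fun ξ => ?_⟩
  · simpa using (hf.2.1 ξ).const_smul c
  · simpa using (hf.2.2 ξ).const_smul (star c)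

namespace Ultrapower

theorem mk_eq_mk_iff {f g : multiplier M ω} : mk M ω f = mk M ω g ↔
    (f : ℕ →ᵇ (H →L[ℂ] H)) - g ∈ nullNets M (ω : Filter ℕ) := by
  rw [← mem_nullSeq_iff]
  exact Ideal.Quotient.eq

theorem mk_surjective (z : Ultrapower M ω) : ∃ f, mk M ω f = z :=
  Ideal.Quotient.mk_surjective z

theorem norm_mk_le (f : multiplier M ω) : ‖mk M ω f‖ ≤ ‖(f : ℕ →ᵇ (H →L[ℂ] H))‖ :=
  csInf_le ⟨0, by rintro r ⟨g, -, rfl⟩; exact norm_nonneg _⟩ ⟨f, rfl, rfl⟩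

theorem le_norm {z : Ultrapower M ω} {r : ℝ}
    (h : ∀ f : multiplier M ω, mk M ω f = z → r ≤ ‖(f : ℕ →ᵇ (H →L[ℂ] H))‖) : r ≤ ‖z‖ := by
  obtain ⟨f, hf⟩ := mk_surjective z
  refine le_csInf ⟨_, f, hf, rfl⟩ ?_
  rintro s ⟨g, hg, rfl⟩
  exact h g hg

theorem norm_nonneg' (z : Ultrapower M ω) : 0 ≤ ‖z‖ := le_norm fun _ _ => norm_nonneg _

theorem exists_rep_lt {z : Ultrapower M ω} {r : ℝ} (h : ‖z‖ < r) :
    ∃ f : multiplier M ω, mk M ω f = z ∧ ‖(f : ℕ →ᵇ (H →L[ℂ] H))‖ < r := by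
  obtain ⟨f, hf⟩ := mk_surjective z
  obtain ⟨_, ⟨g, hg, rfl⟩, hr⟩ := exists_lt_of_csInf_lt
    (s := {r : ℝ | ∃ f : multiplier M ω, mk M ω f = z ∧ r = ‖f‖}) ⟨_, f, hf, rfl⟩ h
  exact ⟨g, hg, hr⟩

/-- Any representative converges strongly to `x` along `ω`, so lower semicontinuity of the norm
gives the nontrivial inequality. -/
theorem norm_ofElement (x : H →L[ℂ] H) (hx : x ∈ M) : ‖ofElement ω x hx‖ = ‖x‖ := by
  apply le_antisymm
  · refine (norm_mk_le _).trans ?_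
    exact (BoundedContinuousFunction.norm_le (norm_nonneg x)).2 fun _ => le_rfl
  · refine le_norm fun f hf => ?_
    have h1 := (mk_eq_mk_iff.1 hf).2.1
    have h2 : StrongTendsto (ω : Filter ℕ) (fun m => (f : ℕ →ᵇ (H →L[ℂ] H)) m) x := by
      have := (h1.add (strongTendsto_const (T₀ := x)))
      rw [zero_add] at this
      intro ξ
      refine (this ξ).congr fun m => ?_
      simp
    exact norm_le_of_strongTendsto h2
      (Eventually.of_forall fun m => BoundedContinuousFunction.norm_coe_le_norm _ m)

/-- A self-adjoint element of the ultrapower has a self-adjoint representative of the same norm. -/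
theorem exists_selfAdjoint_rep {z : Ultrapower M ω} (hz : IsSelfAdjoint z) :
    ∃ f : multiplier M ω, mk M ω f = z ∧ IsSelfAdjoint (f : ℕ →ᵇ (H →L[ℂ] H)) ∧
      ‖(f : ℕ →ᵇ (H →L[ℂ] H))‖ ≤ ‖z‖ := by
  have hre : ∀ g : multiplier M ω, mk M ω g = z → ∃ f : multiplier M ω, mk M ω f = z ∧
      IsSelfAdjoint (f : ℕ →ᵇ (H →L[ℂ] H)) ∧
      ‖(f : ℕ →ᵇ (H →L[ℂ] H))‖ ≤ ‖(g : ℕ →ᵇ (H →L[ℂ] H))‖ := by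
    intro g hg
    have h1 : mk M ω (star g) = mk M ω g := by rw [← star_mk, hg, hz.star_eq]
    have h2 := mk_eq_mk_iff.1 h1
    let r : ℕ →ᵇ (H →L[ℂ] H) := (2⁻¹ : ℂ) • ((g : ℕ →ᵇ (H →L[ℂ] H)) + star (g : ℕ →ᵇ (H →L[ℂ] H)))
    have hr : r ∈ multiplier M ω :=
      (multiplier M ω).smul_mem (add_mem g.2 (star_mem g.2)) _
    refine ⟨⟨r, hr⟩, ?_, ?_, ?_⟩
    · refine Eq.trans (mk_eq_mk_iff.2 ?_) hg
      have e : r - g = (2⁻¹ : ℂ) • (star (g : ℕ →ᵇ (H →L[ℂ] H)) - g) := by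
        ext1 m
        change (2⁻¹ : ℂ) • ((g : ℕ →ᵇ (H →L[ℂ] H)) m + star ((g : ℕ →ᵇ (H →L[ℂ] H)) m))
          - (g : ℕ →ᵇ (H →L[ℂ] H)) m =
          (2⁻¹ : ℂ) • (star ((g : ℕ →ᵇ (H →L[ℂ] H)) m) - (g : ℕ →ᵇ (H →L[ℂ] H)) m)
        module
      change r - g ∈ _
      rw [e]
      exact smul_mem_nullNets _ h2
    · rw [IsSelfAdjoint]
      ext1 m
      change star ((2⁻¹ : ℂ) • ((g : ℕ →ᵇ (H →L[ℂ] H)) m + star ((g : ℕ →ᵇ (H →L[ℂ] H)) m))) = _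
      rw [star_smul, star_add, star_star, add_comm]
      simp [r]
    · refine (BoundedContinuousFunction.norm_le (norm_nonneg _)).2 fun m => ?_
      change ‖(2⁻¹ : ℂ) • ((g : ℕ →ᵇ (H →L[ℂ] H)) m + star ((g : ℕ →ᵇ (H →L[ℂ] H)) m))‖ ≤ _
      have h3 : ‖(2⁻¹ : ℂ)‖ = 2⁻¹ := by norm_num
      have h4 := norm_add_le ((g : ℕ →ᵇ (H →L[ℂ] H)) m) (star ((g : ℕ →ᵇ (H →L[ℂ] H)) m))
      have h5 := BoundedContinuousFunction.norm_coe_le_norm (g : ℕ →ᵇ (H →L[ℂ] H)) m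
      rw [norm_star] at h4
      rw [norm_smul, h3]
      linarith
  obtain ⟨g, hg⟩ := mk_surjective z
  obtain ⟨f, hf, hfs, -⟩ := hre g hg
  have hc : Continuous (clamp ‖z‖) := continuous_clamp _
  have hfm := mem_multiplier_iff.1 f.2
  -- Truncating at `‖z‖` attains the infimum. The class does not change: a representative `b` of
  -- norm below `‖z‖ + ε/2` is moved by at most `ε/2`, modulo null sequences this is also the change
  -- of `f`, and the null sequences are closed.
  have hcm : cfc (clamp ‖z‖) (f : ℕ →ᵇ (H →L[ℂ] H)) ∈ multiplier M ω :=
    mem_multiplier_iff.2 (cfc_mem_multNets hfm _)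
  refine ⟨⟨_, hcm⟩, ?_, cfc_predicate _ _, ?_⟩
  · refine Eq.trans (mk_eq_mk_iff.2 ?_) hf
    change cfc (clamp ‖z‖) (f : ℕ →ᵇ (H →L[ℂ] H)) - f ∈ _
    rw [← (isClosed_nullNets (M := M) (l := (ω : Filter ℕ))).closure_eq, Metric.mem_closure_iff]
    intro ε hε
    obtain ⟨b, hb, hbn⟩ := exists_rep_lt (lt_add_of_pos_right ‖z‖ (half_pos hε))
    obtain ⟨b, hb, hbs, hbn'⟩ := hre b hb
    have hbf : (f : ℕ →ᵇ (H →L[ℂ] H)) - b ∈ nullNets M (ω : Filter ℕ) :=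
      mk_eq_mk_iff.1 (hf.trans hb.symm)
    have hbm := mem_multiplier_iff.1 b.2
    have h1 := cfc_sub_cfc_mem_nullNets hfm hbm hfs hbs hbf hc
    refine ⟨_, sub_mem_nullNets h1 hbf, ?_⟩
    rw [dist_eq_norm]
    refine lt_of_le_of_lt ?_ (half_lt_self hε)
    refine (BoundedContinuousFunction.norm_le (half_pos hε).le).2 fun m => ?_
    have hbsm : IsSelfAdjoint ((b : ℕ →ᵇ (H →L[ℂ] H)) m) :=
      congrArg (fun h : ℕ →ᵇ (H →L[ℂ] H) => h m) hbs.star_eq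
    have e : (cfc (clamp ‖z‖) (f : ℕ →ᵇ (H →L[ℂ] H)) - f -
        (cfc (clamp ‖z‖) (f : ℕ →ᵇ (H →L[ℂ] H)) - cfc (clamp ‖z‖) (b : ℕ →ᵇ (H →L[ℂ] H)) -
          (f - b))) m = cfc (fun t => clamp ‖z‖ t - t) ((b : ℕ →ᵇ (H →L[ℂ] H)) m) := by
      rw [cfc_sub (clamp ‖z‖) (fun t => t) _ hc.continuousOn continuousOn_id, cfc_id' ℝ _ hbsm,
        ← cfc_net_apply hbs hc]
      simp only [BoundedContinuousFunction.sub_apply]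
      abel
    rw [e]
    refine norm_cfc_le (half_pos hε).le fun t ht => ?_
    have h2 := abs_le_norm_of_mem_spectrum hbsm ht
    have h3 := abs_sub_clamp_le (norm_nonneg' z) t
    have h4 := BoundedContinuousFunction.norm_coe_le_norm (b : ℕ →ᵇ (H →L[ℂ] H)) m
    rw [Real.norm_eq_abs, abs_sub_comm]
    refine h3.trans (max_le ?_ (half_pos hε).le)
    linarith
  · refine (BoundedContinuousFunction.norm_le (norm_nonneg' z)).2 fun m => ?_
    rw [cfc_net_apply hfs hc]
    exact norm_le_of_abs_spectrum (norm_nonneg' z) (fun t _ => abs_clamp_le (norm_nonneg' z) t)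
      (congrArg (fun h : ℕ →ᵇ (H →L[ℂ] H) => h m) hfs.star_eq)

theorem mk_mul (f g : multiplier M ω) : mk M ω (f * g) = mk M ω f * mk M ω g :=
  RingHom.map_mul _ f g

theorem mk_add (f g : multiplier M ω) : mk M ω (f + g) = mk M ω f + mk M ω g :=
  RingHom.map_add _ f g

theorem mk_sub (f g : multiplier M ω) : mk M ω (f - g) = mk M ω f - mk M ω g :=
  RingHom.map_sub _ f g

theorem mk_one : mk M ω 1 = 1 := RingHom.map_one _

theorem mk_sum {κ : Type*} (s : Finset κ) (f : κ → multiplier M ω) :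
    mk M ω (∑ k ∈ s, f k) = ∑ k ∈ s, mk M ω (f k) := by
  classical
  induction s using Finset.induction_on with
  | empty => exact RingHom.map_zero _
  | insert a s ha ih => rw [Finset.sum_insert ha, Finset.sum_insert ha, mk_add, ih]

theorem coe_sum {κ : Type*} (s : Finset κ) (f : κ → multiplier M ω) :
    ((∑ k ∈ s, f k : multiplier M ω) : ℕ →ᵇ (H →L[ℂ] H)) =
      ∑ k ∈ s, (f k : ℕ →ᵇ (H →L[ℂ] H)) := by
  classical
  induction s using Finset.induction_on with
  | empty => rfl
  | insert a s ha ih =>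
    rw [Finset.sum_insert ha, Finset.sum_insert ha, ← ih]
    rfl

theorem mem_multiplier (hF : IsNormalExpectation M A F) (hA : IsMASA A M)
    {g : ℕ →ᵇ (H →L[ℂ] H)} (hg : ∀ m, g m ∈ A) : g ∈ multiplier M ω :=
  mem_multiplier_iff.2 (hF.mem_multNets hA hg)

/-- A paving of a class in the ultrapower, given by representing sequences. -/
theorem isPavableWith_of_rep (hF : IsNormalExpectation M A F) (hA : IsMASA A M) {n : ℕ} {ε : ℝ}
    (f : multiplier M ω) {p : ℕ → Fin n → H →L[ℂ] H} (hp : ∀ m, IsPartition A (p m))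
    {a : multiplier M ω} (ha : ∀ m, (a : ℕ →ᵇ (H →L[ℂ] H)) m ∈ A)
    (hax : ‖mk M ω a‖ ≤ ‖mk M ω f‖) {g y : ℕ →ᵇ (H →L[ℂ] H)} (hg : ‖g‖ ≤ ε * ‖mk M ω f‖)
    (hy : y ∈ nullNets M (ω : Filter ℕ))
    (h : ∀ m, ∑ k, p m k * (f : ℕ →ᵇ (H →L[ℂ] H)) m * p m k - (a : ℕ →ᵇ (H →L[ℂ] H)) m
      = g m + y m) : IsPavableWith (ofSubalgebra M ω A) ε n (mk M ω f) := by
  let P : Fin n → multiplier M ω := fun k =>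
    ⟨bddNet (fun m => p m k) fun m => ((hp m).1 k).2.norm_le,
      mem_multiplier hF hA fun m => ((hp m).1 k).1⟩
  refine ⟨fun k => mk M ω (P k), mk M ω a, fun k => ⟨⟨P k, fun m => ((hp m).1 k).1, rfl⟩, ?_⟩,
    ⟨a, ha, rfl⟩, hax, ?_, ?_⟩
  · refine ⟨?_, ?_⟩
    · change mk M ω (P k) * mk M ω (P k) = _
      rw [← mk_mul]
      congr 1
      refine Subtype.ext ?_
      ext1 m
      exact ((hp m).1 k).2.isIdempotentElem.eq
    · rw [IsSelfAdjoint, star_mk]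
      congr 1
      refine Subtype.ext ?_
      ext1 m
      exact ((hp m).1 k).2.isSelfAdjoint.star_eq
  · rw [← mk_sum, ← mk_one]
    congr 1
    refine Subtype.ext ?_
    ext1 m
    rw [coe_sum, BoundedContinuousFunction.sum_apply]
    exact (hp m).2
  · let Z : multiplier M ω := ∑ k, P k * f * P k - a
    have hZ : ∑ k, mk M ω (P k) * mk M ω f * mk M ω (P k) - mk M ω a = mk M ω Z := by
      rw [mk_sub, mk_sum]
      simp only [mk_mul]
    have hZm : (Z : ℕ →ᵇ (H →L[ℂ] H)) = g + y := by
      ext1 m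
      refine Eq.trans ?_ (h m)
      change ((∑ k, P k * f * P k : multiplier M ω) : ℕ →ᵇ (H →L[ℂ] H)) m - _ = _
      rw [coe_sum, BoundedContinuousFunction.sum_apply]
      rfl
    -- No multiplier property is assumed of `g`; it follows from `g = Z - y`.
    have hgm : g ∈ multiplier M ω := by
      have : g = (Z : ℕ →ᵇ (H →L[ℂ] H)) - y := by rw [hZm, add_sub_cancel_right]
      rw [this]
      exact sub_mem Z.2 (mem_multiplier_iff.2 (nullNets_subset_multNets hy))
    have hZg : mk M ω Z = mk M ω ⟨g, hgm⟩ := by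
      rw [mk_eq_mk_iff, hZm, add_sub_cancel_left]
      exact hy
    rw [hZ, hZg]
    exact (norm_mk_le _).trans hg

/-- Termwise so-pavings of a multiplier give a paving modulo a null sequence. -/
theorem exists_multiplier_paving (hF : IsNormalExpectation M A F) (hA : IsMASA A M)
    (hφ : IsCountablyDecomposable A) (hω : (ω : Filter ℕ) ≤ Filter.cofinite) {n : ℕ} {ε C : ℝ}
    (hε : 0 < ε) (f : multiplier M ω) (hf : ∀ m, ‖(f : ℕ →ᵇ (H →L[ℂ] H)) m‖ ≤ C)
    (h : ∀ m, IsSoPavableWith M A ε n ((f : ℕ →ᵇ (H →L[ℂ] H)) m)) :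
    ∃ (p : ℕ → Fin n → H →L[ℂ] H) (a : multiplier M ω) (g y : ℕ →ᵇ (H →L[ℂ] H)),
      (∀ m, IsPartition A (p m)) ∧ (∀ m, (a : ℕ →ᵇ (H →L[ℂ] H)) m ∈ A) ∧
      ‖(a : ℕ →ᵇ (H →L[ℂ] H))‖ ≤ C ∧ ‖g‖ ≤ ε * C ∧ y ∈ nullNets M (ω : Filter ℕ) ∧
      ∀ m, ∑ k, p m k * (f : ℕ →ᵇ (H →L[ℂ] H)) m * p m k - (a : ℕ →ᵇ (H →L[ℂ] H)) m
        = g m + y m := by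
  obtain ⟨p, a, q, hp, ha, hq, hax, hqz, hq1⟩ := exists_sequence_paving hF hA hφ h
  rw [Nat.cofinite_eq_atTop] at hω
  have hC : 0 ≤ C := (norm_nonneg _).trans (hf 0)
  let P : Fin n → ℕ →ᵇ (H →L[ℂ] H) := fun k =>
    bddNet (fun m => p m k) fun m => ((hp m).1 k).2.norm_le
  let a' : multiplier M ω := ⟨bddNet a fun m => (hax m).trans (hf m), mem_multiplier hF hA ha⟩
  let Q : ℕ →ᵇ (H →L[ℂ] H) := bddNet q fun m => (hq m).2.norm_le
  have hQ : 1 - Q ∈ nullNets M (ω : Filter ℕ) :=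
    one_sub_mem_nullNets hq fun ξ => (hq1 ξ).mono_left hω
  let Z : ℕ →ᵇ (H →L[ℂ] H) := ∑ k, P k * f * P k - a'
  have hZ : Z ∈ multNets M (ω : Filter ℕ) :=
    sub_mem (pinch_mem_multNets (fun k => hF.mem_multNets hA fun m => ((hp m).1 k).1)
      (mem_multiplier_iff.1 f.2)) (mem_multiplier_iff.1 a'.2)
  have hZm : ∀ m, Z m = ∑ k, p m k * (f : ℕ →ᵇ (H →L[ℂ] H)) m * p m k - a m := by
    intro m
    simp only [Z, BoundedContinuousFunction.sub_apply, BoundedContinuousFunction.sum_apply]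
    rfl
  refine ⟨p, a', Q * Z * Q, Z - Q * Z * Q, hp, ha, ?_, ?_, sub_compress_mem_nullNets hZ hQ,
    fun m => ?_⟩
  · exact (BoundedContinuousFunction.norm_le hC).2 fun m => (hax m).trans (hf m)
  · refine (BoundedContinuousFunction.norm_le (mul_nonneg hε.le hC)).2 fun m => ?_
    have h1 := hqz m
    rw [← hZm] at h1
    exact h1.trans (mul_le_mul_of_nonneg_left (hf m) hε.le)
  · rw [BoundedContinuousFunction.sub_apply, add_sub_cancel, hZm]
    rfl

/-- A multiplier whose norm is that of its class, and all of whose terms are so-pavable, has a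
norm pavable class. -/
theorem isPavableWith_mk (hF : IsNormalExpectation M A F) (hA : IsMASA A M)
    (hφ : IsCountablyDecomposable A) (hω : (ω : Filter ℕ) ≤ Filter.cofinite) {n : ℕ} {ε : ℝ}
    (hε : 0 < ε) (f : multiplier M ω) (hf : ‖(f : ℕ →ᵇ (H →L[ℂ] H))‖ ≤ ‖mk M ω f‖)
    (h : ∀ m, IsSoPavableWith M A ε n ((f : ℕ →ᵇ (H →L[ℂ] H)) m)) :
    IsPavableWith (ofSubalgebra M ω A) ε n (mk M ω f) := by
  obtain ⟨p, a, g, y, hp, ha, hax, hg, hy, e⟩ := exists_multiplier_paving hF hA hφ hω hε f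
    (fun m => (BoundedContinuousFunction.norm_coe_le_norm _ m).trans hf) h
  exact isPavableWith_of_rep hF hA f hp ha ((norm_mk_le _).trans hax) hg hy e

theorem isPavableWith_ofElement (hF : IsNormalExpectation M A F) (hA : IsMASA A M)
    (hφ : IsCountablyDecomposable A) (hω : (ω : Filter ℕ) ≤ Filter.cofinite) {n : ℕ} {ε : ℝ}
    (hε : 0 < ε) {x : H →L[ℂ] H} (hx : x ∈ M) (h : IsSoPavableWith M A ε n x) :
    IsPavableWith (ofSubalgebra M ω A) ε n (ofElement ω x hx) := by
  have h1 : BoundedContinuousFunction.const ℕ x ∈ multiplier M ω :=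
    mem_multiplier_iff.2 (const_mem_multNets hx)
  refine isPavableWith_mk hF hA hφ hω hε ⟨BoundedContinuousFunction.const ℕ x, h1⟩ ?_ fun _ => h
  refine le_trans ?_ (norm_ofElement x hx).ge
  exact (BoundedContinuousFunction.norm_le (norm_nonneg x)).2 fun _ => le_rfl

/-- The norm-attaining self-adjoint representative has only self-adjoint terms, so neither `ε` nor
`n` is lost. -/
theorem isPavableWith_of_isSelfAdjoint (hF : IsNormalExpectation M A F) (hA : IsMASA A M)
    (hφ : IsCountablyDecomposable A) (hω : (ω : Filter ℕ) ≤ Filter.cofinite) {n : ℕ} {ε : ℝ}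
    (hε : 0 < ε) (h : ∀ x ∈ M, IsSelfAdjoint x → IsSoPavableWith M A ε n x)
    {z : Ultrapower M ω} (hz : IsSelfAdjoint z) :
    IsPavableWith (ofSubalgebra M ω A) ε n z := by
  obtain ⟨f, rfl, hfs, hfn⟩ := exists_selfAdjoint_rep hz
  refine isPavableWith_mk hF hA hφ hω hε f hfn fun m => h _ (f.2.1 m) ?_
  exact congrArg (fun h : ℕ →ᵇ (H →L[ℂ] H) => h m) hfs.star_eq

end Ultrapower

end Ultrapower

/-! ### Lifting asymptotic partitions of unity -/

section Lifting

variable {H : Type*} [NormedAddCommGroup H] [InnerProductSpace ℂ H] [CompleteSpace H]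
  {A : VonNeumannAlgebra H}

/-- The complement `∏_{j<k} (1 - e j)` of the first `k` projections. -/
def residual (e : ℕ → H →L[ℂ] H) : ℕ → H →L[ℂ] H
  | 0 => 1
  | k + 1 => residual e k * (1 - e k)

theorem projection_mul_mem (hcomm : ∀ a ∈ A, ∀ b ∈ A, a * b = b * a)
    {p q : H →L[ℂ] H} (hp : p ∈ A ∧ IsStarProjection p) (hq : q ∈ A ∧ IsStarProjection q) :
    p * q ∈ A ∧ IsStarProjection (p * q) := by
  have h := hcomm p hp.1 q hq.1
  refine ⟨mul_mem hp.1 hq.1, ?_, ?_⟩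
  · change p * q * (p * q) = p * q
    rw [mul_assoc, ← mul_assoc q, ← h, mul_assoc p q q, hq.2.isIdempotentElem.eq, ← mul_assoc,
      hp.2.isIdempotentElem.eq]
  · rw [IsSelfAdjoint, star_mul, hp.2.isSelfAdjoint.star_eq, hq.2.isSelfAdjoint.star_eq, h]

section Residual

variable {e : ℕ → H →L[ℂ] H}

theorem residual_mem (hcomm : ∀ a ∈ A, ∀ b ∈ A, a * b = b * a)
    (he : ∀ k, e k ∈ A ∧ IsStarProjection (e k)) (k : ℕ) :
    residual e k ∈ A ∧ IsStarProjection (residual e k) := by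
  induction k with
  | zero => exact ⟨one_mem A, .one _⟩
  | succ k ih =>
    exact projection_mul_mem hcomm ih ⟨sub_mem (one_mem A) (he k).1, (he k).2.one_sub⟩

theorem sum_residual_mul (e : ℕ → H →L[ℂ] H) (n : ℕ) :
    ∑ k ∈ Finset.range n, residual e k * e k = 1 - residual e n := by
  induction n with
  | zero => simp [residual]
  | succ n ih =>
    rw [Finset.sum_range_succ, ih, residual, mul_sub, mul_one]
    abel

theorem residual_mul_eq_zero (hcomm : ∀ a ∈ A, ∀ b ∈ A, a * b = b * a)
    (he : ∀ k, e k ∈ A ∧ IsStarProjection (e k)) {k n : ℕ} (hk : k < n) :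
    residual e n * e k = 0 := by
  induction n with
  | zero => exact absurd hk (Nat.not_lt_zero k)
  | succ n ih =>
    rw [residual, mul_assoc]
    rcases Nat.lt_succ_iff_lt_or_eq.1 hk with h | rfl
    · rw [hcomm _ (sub_mem (one_mem A) (he n).1) _ (he k).1, ← mul_assoc, ih h, zero_mul]
    · rw [sub_mul, one_mul, (he k).2.isIdempotentElem.eq, sub_self, mul_zero]

/-- The partition obtained by making the projections `e 0, …, e (n - 1)` disjoint, and adding the
remainder. -/
theorem isPartition_residual (hcomm : ∀ a ∈ A, ∀ b ∈ A, a * b = b * a)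
    (he : ∀ k, e k ∈ A ∧ IsStarProjection (e k)) (n : ℕ) :
    IsPartition A (Fin.snoc (α := fun _ : Fin (n + 1) => H →L[ℂ] H)
      (fun k : Fin n => residual e k * e k) (residual e n)) := by
  refine ⟨fun k => ?_, ?_⟩
  · induction k using Fin.lastCases with
    | last => rw [Fin.snoc_last]; exact residual_mem hcomm he n
    | cast k =>
      rw [Fin.snoc_castSucc]
      exact projection_mul_mem hcomm (residual_mem hcomm he k) (he k)
  · rw [Fin.sum_univ_castSucc]
    simp only [Fin.snoc_castSucc, Fin.snoc_last]
    rw [Fin.sum_univ_eq_sum_range (fun k => residual e k * e k), sum_residual_mul,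
      sub_add_cancel]

/-- Let `d = e j * e k` and pair `(∑ e - 1) ξ` with `d ξ`. The indices `j` and `k` each contribute
`‖d ξ‖²`, the others are nonnegative, and `-1` removes one copy. Cauchy-Schwarz finishes. -/
theorem norm_mul_apply_le_norm_sum_sub_one (hcomm : ∀ a ∈ A, ∀ b ∈ A, a * b = b * a)
    (he : ∀ k, e k ∈ A ∧ IsStarProjection (e k)) {s : Finset ℕ} {j k : ℕ} (hj : j ∈ s)
    (hk : k ∈ s) (hjk : j ≠ k) (ξ : H) :
    ‖(e j * e k) ξ‖ ≤ ‖(∑ i ∈ s, e i - 1) ξ‖ := by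
  have hd := projection_mul_mem hcomm (he j) (he k)
  set d := e j * e k with hd'
  have h1 : ∀ i, (inner ℂ (d ξ) (e i ξ)).re = ‖(d * e i) ξ‖ ^ 2 := fun i => by
    rw [norm_projection_sq (projection_mul_mem hcomm hd (he i)).2]
    change _ = (inner ℂ ξ (d (e i ξ))).re
    rw [← ContinuousLinearMap.adjoint_inner_left d, hd.2.isSelfAdjoint.adjoint_eq]
  have hdj : d * e j = d := by
    rw [hcomm _ hd.1 _ (he j).1, hd', ← mul_assoc, (he j).2.isIdempotentElem.eq]
  have hdk : d * e k = d := by rw [hd', mul_assoc, (he k).2.isIdempotentElem.eq]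
  have h2 : ‖d ξ‖ ^ 2 + ‖d ξ‖ ^ 2 ≤ ∑ i ∈ s, ‖(d * e i) ξ‖ ^ 2 := by
    have := Finset.sum_le_sum_of_subset_of_nonneg (f := fun i => ‖(d * e i) ξ‖ ^ 2)
      (s := {j, k}) (t := s) (by
        intro i hi
        rcases Finset.mem_insert.1 hi with rfl | hi
        · exact hj
        · rw [Finset.mem_singleton.1 hi]; exact hk) fun _ _ _ => sq_nonneg _
    rwa [Finset.sum_pair hjk, hdj, hdk] at this
  have h3 : (inner ℂ (d ξ) ((∑ i ∈ s, e i - 1) ξ)).re =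
      ∑ i ∈ s, ‖(d * e i) ξ‖ ^ 2 - ‖d ξ‖ ^ 2 := by
    have e1 : (∑ i ∈ s, e i - 1) ξ = ∑ i ∈ s, e i ξ - ξ := by
      rw [sub_apply, sum_apply]; rfl
    have e2 : (inner ℂ (d ξ) ξ).re = ‖d ξ‖ ^ 2 := by
      rw [norm_projection_sq hd.2, ← ContinuousLinearMap.adjoint_inner_left,
        hd.2.isSelfAdjoint.adjoint_eq]
    rw [e1, inner_sub_right, inner_sum, Complex.sub_re, Complex.re_sum, e2]
    simp only [h1]
  have h4 : ‖d ξ‖ ^ 2 ≤ ‖d ξ‖ * ‖(∑ i ∈ s, e i - 1) ξ‖ :=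
    calc ‖d ξ‖ ^ 2 ≤ (inner ℂ (d ξ) ((∑ i ∈ s, e i - 1) ξ)).re := by rw [h3]; linarith
      _ ≤ _ := (Complex.re_le_norm _).trans (norm_inner_le_norm _ _)
  rcases (norm_nonneg (d ξ)).eq_or_lt with h | h
  · rw [← h]; exact norm_nonneg _
  · rw [sq] at h4
    exact le_of_mul_le_mul_left h4 h

end Residual

variable {ι : Type*} {l : Filter ι}

theorem strongTendsto_sum {κ : Type*} (s : Finset κ) {T : κ → ι → H →L[ℂ] H}
    (h : ∀ k ∈ s, StrongTendsto l (T k) 0) :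
    StrongTendsto l (fun i => ∑ k ∈ s, T k i) 0 := fun ξ => by
  have := tendsto_finsetSum s fun k hk => h k hk ξ
  simpa using this

theorem strongTendsto_of_norm_le {S T : ι → H →L[ℂ] H} (hT : StrongTendsto l T 0) {c : ℝ}
    (h : ∀ i ξ, ‖S i ξ‖ ≤ c * ‖T i ξ‖) : StrongTendsto l S 0 := fun ξ => by
  have := (hT ξ).norm.const_mul c
  rw [zero_apply, norm_zero, mul_zero] at this
  exact squeeze_zero_norm (fun i => h i ξ) this

theorem StrongTendsto.zero_add {S T : ι → H →L[ℂ] H} (hS : StrongTendsto l S 0)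
    (hT : StrongTendsto l T 0) : StrongTendsto l (fun i => S i + T i) 0 := by
  simpa using hS.add hT

theorem StrongTendsto.zero_sub {S T : ι → H →L[ℂ] H} (hS : StrongTendsto l S 0)
    (hT : StrongTendsto l T 0) : StrongTendsto l (fun i => S i - T i) 0 := by
  simpa using hS.sub hT

/-- Nets of projections that are asymptotically a partition of unity are asymptotic to nets of
partitions of unity. -/
theorem exists_partition_of_projections (hcomm : ∀ a ∈ A, ∀ b ∈ A, a * b = b * a) {n : ℕ}
    {e : ι → ℕ → H →L[ℂ] H} (he : ∀ i k, e i k ∈ A ∧ IsStarProjection (e i k))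
    (h : StrongTendsto l (fun i => ∑ k ∈ Finset.range (n + 1), e i k - 1) 0) :
    ∃ p : ι → Fin (n + 1) → H →L[ℂ] H, (∀ i, IsPartition A (p i)) ∧
      ∀ k : Fin (n + 1), StrongTendsto l (fun i => p i k - e i k) 0 := by
  have hR : ∀ i k, residual (e i) k ∈ A ∧ IsStarProjection (residual (e i) k) :=
    fun i => residual_mem hcomm (he i)
  have hprod : ∀ j < n + 1, ∀ k < n + 1, j ≠ k → StrongTendsto l (fun i => e i j * e i k) 0 :=
    fun j hj k hk hjk => strongTendsto_of_norm_le h (c := 1) fun i ξ => by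
      rw [one_mul]
      exact norm_mul_apply_le_norm_sum_sub_one hcomm (he i) (Finset.mem_range.2 hj)
        (Finset.mem_range.2 hk) hjk ξ
  have hcut : ∀ k < n + 1, StrongTendsto l (fun i => (1 - residual (e i) k) * e i k) 0 := by
    intro k hk
    have e1 : ∀ i, (1 - residual (e i) k) * e i k =
        ∑ j ∈ Finset.range k, residual (e i) j * (e i j * e i k) := fun i => by
      rw [← sum_residual_mul, Finset.sum_mul]
      exact Finset.sum_congr rfl fun j _ => mul_assoc _ _ _
    simp only [e1]
    refine strongTendsto_sum _ fun j hj => ?_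
    have hjk := Finset.mem_range.1 hj
    exact (hprod j (hjk.trans hk) k hk hjk.ne).mul_left fun i => (hR i j).2.norm_le
  -- The full residual kills every `e k`, so it equals minus its product with `∑ e - 1`.
  have hres : StrongTendsto l (fun i => residual (e i) (n + 1)) 0 := by
    have e1 : ∀ i, residual (e i) (n + 1) = -(residual (e i) (n + 1) *
        (∑ k ∈ Finset.range (n + 1), e i k - 1)) := fun i => by
      rw [mul_sub, mul_one, Finset.mul_sum, Finset.sum_eq_zero fun k hk =>
        residual_mul_eq_zero hcomm (he i) (Finset.mem_range.1 hk), _root_.zero_sub, neg_neg]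
    have := (h.mul_left (S := fun i => residual (e i) (n + 1)) fun i => (hR i _).2.norm_le).neg
    simpa only [← e1] using this
  refine ⟨_, fun i => isPartition_residual hcomm (he i) n, fun k => ?_⟩
  induction k using Fin.lastCases with
  | last =>
    simp only [Fin.snoc_last, Fin.val_last]
    -- The last member takes the whole remainder, so that the sum is exactly `1`. It exceeds the
    -- disjointified `e n` by the full residual, which is null.
    have e1 : ∀ i, residual (e i) n - e i n =
        residual (e i) (n + 1) - (1 - residual (e i) n) * e i n := fun i => by
      rw [residual, mul_sub, mul_one, sub_mul, one_mul]
      abel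
    simp only [e1]
    exact hres.zero_sub (hcut n n.lt_succ_self)
  | cast k =>
    simp only [Fin.snoc_castSucc, Fin.val_castSucc]
    have e1 : ∀ i, residual (e i) k * e i k - e i k = -((1 - residual (e i) k) * e i k) :=
      fun i => by rw [sub_mul, one_mul, neg_sub]
    simp only [e1]
    exact (hcut k (k.2.trans n.lt_succ_self)).neg

/-- A bounded net in `A` that is asymptotically a projection is asymptotic to a net of
projections of `A`. -/
theorem exists_projection_of_asymptotic (hcomm : ∀ a ∈ A, ∀ b ∈ A, a * b = b * a)
    {f : ι → H →L[ℂ] H} (hf : ∀ i, f i ∈ A) {C : ℝ} (hC : ∀ i, ‖f i‖ ≤ C)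
    (h1 : StrongTendsto l (fun i => star (f i) - f i) 0)
    (h2 : StrongTendsto l (fun i => f i * f i - f i) 0) :
    ∃ e : ι → H →L[ℂ] H, (∀ i, e i ∈ A ∧ IsStarProjection (e i)) ∧
      StrongTendsto l (fun i => e i - f i) 0 := by
  let g : ι → H →L[ℂ] H := fun i => (2⁻¹ : ℝ) • (f i + star (f i))
  have hg : ∀ i, g i ∈ A := fun i => real_smul_mem_vn _ (add_mem (hf i) (star_mem (hf i)))
  have hgs : ∀ i, IsSelfAdjoint (g i) := fun i => by
    simp only [IsSelfAdjoint, g, star_smul, star_add, star_star, star_trivial]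
    rw [add_comm]
  have hgf : ∀ i, g i - f i = (2⁻¹ : ℝ) • (star (f i) - f i) := fun i => by
    simp only [g]; module
  have h3 : StrongTendsto l (fun i => g i - f i) 0 := by
    simp only [hgf]
    refine strongTendsto_of_norm_le h1 (c := 2⁻¹) fun i ξ => ?_
    rw [smul_apply, norm_smul]
    norm_num
  have hgC : ∀ i, ‖g i‖ ≤ C := fun i => by
    have h4 := norm_add_le (f i) (star (f i))
    have h3 : ‖(2⁻¹ : ℝ)‖ = 2⁻¹ := by norm_num
    rw [norm_star] at h4
    simp only [g]
    rw [norm_smul, h3]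
    linarith [hC i]
  -- The spectral projection at `1/2` of the real part rounds an asymptotic projection to a genuine
  -- one.
  choose e heA he hec h5 h6 using fun i => exists_spectral_projection (hg i) (hgs i) (1 / 2)
  refine ⟨e, fun i => ⟨heA i, he i⟩, ?_⟩
  have h7 : StrongTendsto l (fun i => g i * g i - g i) 0 := by
    have e1 : ∀ i, g i * g i - g i =
        (f i * f i - f i) + ((g i + f i) * (g i - f i) - (g i - f i)) := fun i => by
      rw [add_mul, mul_sub, mul_sub, hcomm _ (hf i) _ (hg i)]
      abel
    simp only [e1]
    exact h2.zero_add ((h3.mul_left (C := C + C) fun i =>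
      (norm_add_le _ _).trans (add_le_add (hgC i) (hC i))).zero_sub h3)
  have h8 : StrongTendsto l (fun i => e i - g i) 0 :=
    strongTendsto_of_norm_le h7 fun i ξ =>
      norm_sub_spectral_projection_le (he i) (hec i) (h5 i) (h6 i) ξ
  have h9 := h8.zero_add h3
  simpa only [sub_add_sub_cancel] using h9

/-- Partitions of unity modulo strong null nets lift to nets of partitions of unity. -/
theorem exists_partition_of_asymptotic [l.NeBot] (hcomm : ∀ a ∈ A, ∀ b ∈ A, a * b = b * a)
    {n : ℕ} {f : Fin n → ι → H →L[ℂ] H} (hf : ∀ k i, f k i ∈ A) {C : Fin n → ℝ}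
    (hC : ∀ k i, ‖f k i‖ ≤ C k) (h1 : ∀ k, StrongTendsto l (fun i => star (f k i) - f k i) 0)
    (h2 : ∀ k, StrongTendsto l (fun i => f k i * f k i - f k i) 0)
    (h3 : StrongTendsto l (fun i => ∑ k, f k i - 1) 0) :
    ∃ p : ι → Fin n → H →L[ℂ] H, (∀ i, IsPartition A (p i)) ∧
      ∀ k, StrongTendsto l (fun i => p i k - f k i) 0 := by
  cases n with
  | zero =>
    -- An empty sum asymptotic to `1` forces the Hilbert space to vanish.
    have h4 : ∀ ξ : H, ξ = 0 := fun ξ => by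
      have h5 := h3 ξ
      simp only [Finset.univ_eq_empty, Finset.sum_empty, _root_.zero_sub] at h5
      simpa using tendsto_nhds_unique tendsto_const_nhds h5
    refine ⟨fun _ _ => 0, fun i => ⟨fun k => k.elim0, ?_⟩, fun k => k.elim0⟩
    ext ξ
    exact (h4 _).trans (h4 _).symm
  | succ n =>
    choose e he hef using fun k => exists_projection_of_asymptotic hcomm (hf k) (hC k) (h1 k) (h2 k)
    let e' : ι → ℕ → H →L[ℂ] H := fun i k => if h : k < n + 1 then e ⟨k, h⟩ i else 0
    have he'e : ∀ i (k : Fin (n + 1)), e' i k = e k i := fun i k => dif_pos k.2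
    have he' : ∀ i k, e' i k ∈ A ∧ IsStarProjection (e' i k) := fun i k => by
      by_cases h : k < n + 1
      · simp only [e', dif_pos h]; exact he _ i
      · simp only [e', dif_neg h]; exact ⟨zero_mem A, .zero _⟩
    have h4 : StrongTendsto l (fun i => ∑ k ∈ Finset.range (n + 1), e' i k - 1) 0 := by
      have e1 : ∀ i, ∑ k ∈ Finset.range (n + 1), e' i k - 1 =
          (∑ k, (e k i - f k i)) + (∑ k, f k i - 1) := fun i => by
        rw [← Fin.sum_univ_eq_sum_range (fun k => e' i k), Finset.sum_sub_distrib]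
        simp only [he'e]
        abel
      simp only [e1]
      exact (strongTendsto_sum _ fun k _ => hef k).zero_add h3
    obtain ⟨p, hp, hpe⟩ := exists_partition_of_projections hcomm he' h4
    refine ⟨p, hp, fun k => ?_⟩
    have := (hpe k).zero_add (hef k)
    simpa only [he'e, sub_add_sub_cancel] using this

end Lifting

/-! ### From norm pavings in the ultrapower to so-pavings in `M` -/

section UltrapowerToAlgebra

variable {H : Type*} [NormedAddCommGroup H] [InnerProductSpace ℂ H] [CompleteSpace H]
  {M A : VonNeumannAlgebra H} {F : (H →L[ℂ] H) → (H →L[ℂ] H)} {ω : Ultrafilter ℕ}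

theorem StrongTendsto.congr {ι : Type*} {l : Filter ι} {S T : ι → H →L[ℂ] H} {T₀ : H →L[ℂ] H}
    (h : StrongTendsto l S T₀) (e : ∀ i, S i = T i) : StrongTendsto l T T₀ := by
  rwa [← funext e]

namespace Ultrapower

theorem strongTendsto_of_mk_eq {f g : multiplier M ω} (h : mk M ω f = mk M ω g) :
    StrongTendsto (ω : Filter ℕ)
      (fun m => (f : ℕ →ᵇ (H →L[ℂ] H)) m - (g : ℕ →ᵇ (H →L[ℂ] H)) m) 0 :=
  (mk_eq_mk_iff.1 h).2.1

/-- Partitions of unity in `A^ω` are represented by sequences of partitions of unity in `A`, up to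
strongly null sequences. -/
theorem exists_partition_lift (hA : IsMASA A M) {n : ℕ} {P : Fin n → Ultrapower M ω}
    (hP : ∀ k, P k ∈ ofSubalgebra M ω A ∧ IsStarProjection (P k)) (hsum : ∑ k, P k = 1) :
    ∃ (f : Fin n → multiplier M ω) (p : ℕ → Fin n → H →L[ℂ] H),
      (∀ k, mk M ω (f k) = P k) ∧ (∀ m, IsPartition A (p m)) ∧
      ∀ k, StrongTendsto (ω : Filter ℕ) (fun m => p m k - (f k : ℕ →ᵇ (H →L[ℂ] H)) m) 0 := by
  choose f hfA hf using fun k => (hP k).1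
  obtain ⟨p, hp, hpf⟩ := exists_partition_of_asymptotic (A := A) (l := (ω : Filter ℕ))
    (fun a ha b hb => hA.commute ha hb)
    (f := fun k m => (f k : ℕ →ᵇ (H →L[ℂ] H)) m) (fun k m => hfA k m)
    (C := fun k => ‖(f k : ℕ →ᵇ (H →L[ℂ] H))‖)
    (fun k m => BoundedContinuousFunction.norm_coe_le_norm _ m)
    (fun k => strongTendsto_of_mk_eq (f := star (f k)) (g := f k) (by
      rw [← star_mk, hf, (hP k).2.isSelfAdjoint.star_eq]))
    (fun k => strongTendsto_of_mk_eq (f := f k * f k) (g := f k) (by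
      rw [mk_mul, hf]; exact (hP k).2.isIdempotentElem.eq))
    (by
      have h := strongTendsto_of_mk_eq (f := ∑ k, f k) (g := 1) (by
        rw [mk_sum, mk_one, ← hsum]; exact Finset.sum_congr rfl fun k _ => hf k)
      refine h.congr fun m => ?_
      rw [coe_sum, BoundedContinuousFunction.sum_apply]
      rfl)
  exact ⟨f, p, hf, hp, hpf⟩

/-- Replacing the projections of a pinching by asymptotically equal ones. -/
theorem strongTendsto_mul_mul_sub (hF : IsNormalExpectation M A F) (hA : IsMASA A M)
    {x : H →L[ℂ] H} (hx : x ∈ M) {p : ℕ → H →L[ℂ] H} (hp : ∀ m, p m ∈ A ∧ IsStarProjection (p m))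
    {f : multiplier M ω}
    (h : StrongTendsto (ω : Filter ℕ) (fun m => p m - (f : ℕ →ᵇ (H →L[ℂ] H)) m) 0) :
    StrongTendsto (ω : Filter ℕ) (fun m => p m * x * p m -
      (f : ℕ →ᵇ (H →L[ℂ] H)) m * x * (f : ℕ →ᵇ (H →L[ℂ] H)) m) 0 := by
  have hfn : ∀ m, ‖(f : ℕ →ᵇ (H →L[ℂ] H)) m‖ ≤ ‖(f : ℕ →ᵇ (H →L[ℂ] H))‖ :=
    fun m => BoundedContinuousFunction.norm_coe_le_norm _ m
  -- Telescoping `p x p - f x f = (p - f) x p + f x (p - f)`; the first term needs stability under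
  -- right multiplication by `A`.
  have h1 : StrongTendsto (ω : Filter ℕ)
      (fun m => (p m - (f : ℕ →ᵇ (H →L[ℂ] H)) m) * x * p m) 0 := by
    refine hF.strongTendsto_mul_right hA
      (fun m => mul_mem (sub_mem (hF.le (hp m).1) (f.2.1 m)) hx)
      (C := (1 + ‖(f : ℕ →ᵇ (H →L[ℂ] H))‖) * ‖x‖) (fun m => ?_) (h.mul_const x)
      (fun m => (hp m).1) fun m => (hp m).2.norm_le
    exact (norm_mul_le _ _).trans (mul_le_mul_of_nonneg_right
      ((norm_sub_le _ _).trans (add_le_add (hp m).2.norm_le (hfn m))) (norm_nonneg x))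
  have h2 : StrongTendsto (ω : Filter ℕ)
      (fun m => (f : ℕ →ᵇ (H →L[ℂ] H)) m * x * (p m - (f : ℕ →ᵇ (H →L[ℂ] H)) m)) 0 :=
    h.mul_left (C := ‖(f : ℕ →ᵇ (H →L[ℂ] H))‖ * ‖x‖) fun m =>
      (norm_mul_le _ _).trans (mul_le_mul_of_nonneg_right (hfn m) (norm_nonneg x))
  have h3 := h1.zero_add h2
  refine h3.congr fun m => ?_
  rw [sub_mul, sub_mul, mul_sub]
  abel

/-- Lifting the partition, the element of `A^ω` and the small difference leaves a strongly null
error, which projections cut away. -/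
theorem isSoPavableWith_of_isPavableWith (hF : IsNormalExpectation M A F) (hA : IsMASA A M)
    {n : ℕ} {ε ε' : ℝ} {x : H →L[ℂ] H} (hx : x ∈ M)
    (h : IsPavableWith (ofSubalgebra M ω A) ε n (ofElement ω x hx)) (hεε' : ε < ε') :
    IsSoPavableWith M A ε' n x := by
  obtain ⟨P, a, hP, ⟨α, hα, rfl⟩, hax, hsum, hz⟩ := h
  obtain ⟨f, p, hf, hp, hpf⟩ := exists_partition_lift hA hP hsum
  rcases eq_or_ne x 0 with rfl | hx0
  · exact (hp 0).isSoPavableWith_zero ε'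
  have hN : 0 < ‖x‖ := norm_pos_iff.2 hx0
  rw [norm_ofElement] at hax hz
  set η := (ε' - ε) * ‖x‖ / 4 with hη'
  have hη : 0 < η := by have := sub_pos.2 hεε'; positivity
  obtain ⟨β, hβ, hβn⟩ := exists_rep_lt (hax.trans_lt (lt_add_of_pos_right _ hη))
  obtain ⟨w, hw, hwn⟩ := exists_rep_lt (hz.trans_lt (lt_add_of_pos_right _ hη))
  have hβm : ∀ m, ‖(β : ℕ →ᵇ (H →L[ℂ] H)) m‖ ≤ ‖x‖ + η := fun m =>
    (BoundedContinuousFunction.norm_coe_le_norm _ m).trans hβn.le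
  have hwm : ∀ m, ‖(w : ℕ →ᵇ (H →L[ℂ] H)) m‖ ≤ ε * ‖x‖ + η := fun m =>
    (BoundedContinuousFunction.norm_coe_le_norm _ m).trans hwn.le
  -- `α` has terms in `A` and `β` has nearly minimal norm; `F β` has both properties, and `α - F β =
  -- F (α - β)` is null.
  let b : ℕ → H →L[ℂ] H := fun m => F ((β : ℕ →ᵇ (H →L[ℂ] H)) m)
  have hb : ∀ m, b m ∈ A := fun m => hF.mem _ (β.2.1 m)
  have hbn : ∀ m, ‖b m‖ ≤ ‖x‖ + η := fun m => (hF.norm_le (β.2.1 m)).trans (hβm m)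
  have hNη : 0 < ‖x‖ + η := by positivity
  -- Scaling by `c` restores the exact bound `‖x‖` and adds at most `η` to the error. The total `ε
  -- ‖x‖ + 2 η` stays below `ε' ‖x‖`.
  set c : ℝ := ‖x‖ / (‖x‖ + η) with hc
  have hc0 : 0 ≤ c := by positivity
  have hc1 : c ≤ 1 := (div_le_one hNη).2 (by linarith)
  have hcN : c * (‖x‖ + η) = ‖x‖ := div_mul_cancel₀ _ hNη.ne'
  let y : ℕ → H →L[ℂ] H := fun m => ∑ k, p m k * x * p m k - b m - (w : ℕ →ᵇ (H →L[ℂ] H)) m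
  have hy : ∀ m, y m ∈ M := fun m => sub_mem (sub_mem (sum_mem fun k _ =>
    mul_mem (mul_mem (hF.le ((hp m).1 k).1) hx) (hF.le ((hp m).1 k).1)) (hF.le (hb m))) (w.2.1 m)
  have hy0 : StrongTendsto (ω : Filter ℕ) y 0 := by
    have h1 := strongTendsto_sum (l := (ω : Filter ℕ)) Finset.univ fun k _ =>
      strongTendsto_mul_mul_sub hF hA hx (fun m => (hp m).1 k) (hpf k)
    let X : multiplier M ω :=
      ⟨BoundedContinuousFunction.const ℕ x, mem_multiplier_iff.2 (const_mem_multNets hx)⟩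
    have h2 := strongTendsto_of_mk_eq (f := ∑ k, f k * X * f k - α) (g := w) (by
      rw [hw, mk_sub, mk_sum]
      congr 1
      refine Finset.sum_congr rfl fun k _ => ?_
      rw [mk_mul, mk_mul, hf]
      rfl)
    have h3 : StrongTendsto (ω : Filter ℕ) (fun m => (α : ℕ →ᵇ (H →L[ℂ] H)) m - b m) 0 := by
      have h4 := hF.strongTendsto_map hA (C := ‖(α : ℕ →ᵇ (H →L[ℂ] H))‖ + ‖(β : ℕ →ᵇ (H →L[ℂ] H))‖)
        (fun m => sub_mem (α.2.1 m) (β.2.1 m)) (fun m => (norm_sub_le _ _).trans (add_le_add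
          (BoundedContinuousFunction.norm_coe_le_norm _ m)
          (BoundedContinuousFunction.norm_coe_le_norm _ m))) (strongTendsto_of_mk_eq hβ.symm)
      refine h4.congr fun m => ?_
      rw [hF.map_sub (α.2.1 m) (β.2.1 m), hF.map_of_mem _ (hα m)]
    have h5 := (h1.zero_add h2).zero_add h3
    refine h5.congr fun m => ?_
    have e : ((∑ k, f k * X * f k - α : multiplier M ω) : ℕ →ᵇ (H →L[ℂ] H)) m =
        ∑ k, (f k : ℕ →ᵇ (H →L[ℂ] H)) m * x * (f k : ℕ →ᵇ (H →L[ℂ] H)) m -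
          (α : ℕ →ᵇ (H →L[ℂ] H)) m := by
      change ((∑ k, f k * X * f k : multiplier M ω) : ℕ →ᵇ (H →L[ℂ] H)) m - _ = _
      rw [coe_sum, BoundedContinuousFunction.sum_apply]
      rfl
    rw [e, Finset.sum_sub_distrib]
    simp only [y]
    abel
  refine isSoPavableWith_of_net (l := (ω : Filter ℕ)) p (fun m => c • b m)
    (fun m => (w : ℕ →ᵇ (H →L[ℂ] H)) m + (1 - c) • b m) y (r := ε * ‖x‖ + η + η) (s := ε' * ‖x‖)
    hp (fun m => real_smul_mem_vn c (hb m)) (fun m => ?_) hy hy0 (fun m => ?_) ?_ le_rfl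
    fun m => ?_
  · rw [norm_smul, Real.norm_of_nonneg hc0, ← hcN]
    exact mul_le_mul_of_nonneg_left (hbn m) hc0
  · refine (norm_add_le _ _).trans (add_le_add (hwm m) ?_)
    rw [norm_smul, Real.norm_of_nonneg (sub_nonneg.2 hc1)]
    calc (1 - c) * ‖b m‖ ≤ (1 - c) * (‖x‖ + η) :=
          mul_le_mul_of_nonneg_left (hbn m) (sub_nonneg.2 hc1)
      _ = η := by rw [sub_mul, hcN]; ring
  · have : 4 * η = (ε' - ε) * ‖x‖ := by rw [hη']; ring
    linarith
  · simp only [y]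
    rw [sub_smul, one_smul]
    abel

end Ultrapower

end UltrapowerToAlgebra

/-! ### Uniform paving of all elements of the ultrapower -/

section Uniform

variable {H : Type*} [NormedAddCommGroup H] [InnerProductSpace ℂ H] [CompleteSpace H]
  {M A : VonNeumannAlgebra H} {F : (H →L[ℂ] H) → (H →L[ℂ] H)} {ω : Ultrafilter ℕ}

theorem IsPartition.reindex {κ κ' : Type*} [Fintype κ] [Fintype κ'] {p : κ → H →L[ℂ] H}
    (hp : IsPartition A p) (e : κ' ≃ κ) : IsPartition A fun k => p (e k) :=
  ⟨fun k => hp.1 (e k), (e.sum_comp p).trans hp.2⟩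

theorem IsPartition.prod (hcomm : ∀ a ∈ A, ∀ b ∈ A, a * b = b * a) {κ κ' : Type*} [Fintype κ]
    [Fintype κ'] {p : κ → H →L[ℂ] H} {q : κ' → H →L[ℂ] H} (hp : IsPartition A p)
    (hq : IsPartition A q) : IsPartition A fun jk : κ × κ' => p jk.1 * q jk.2 := by
  refine ⟨fun jk => projection_mul_mem hcomm (hp.1 jk.1) (hq.1 jk.2), ?_⟩
  rw [Fintype.sum_prod_type]
  simp only [← Finset.mul_sum, hq.2, mul_one, hp.2]

theorem IsPartition.sum_prod (hcomm : ∀ a ∈ A, ∀ b ∈ A, a * b = b * a) {κ κ' : Type*} [Fintype κ]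
    [Fintype κ'] {p : κ → H →L[ℂ] H} {q : κ' → H →L[ℂ] H} (hp : IsPartition A p)
    (hq : IsPartition A q) (x : H →L[ℂ] H) :
    ∑ jk : κ × κ', p jk.1 * q jk.2 * x * (p jk.1 * q jk.2) =
      ∑ j, p j * (∑ k, q k * x * q k) * p j := by
  rw [Fintype.sum_prod_type]
  refine Finset.sum_congr rfl fun j _ => ?_
  rw [Finset.mul_sum, Finset.sum_mul]
  refine Finset.sum_congr rfl fun k _ => ?_
  rw [hcomm _ (hp.1 j).1 _ (hq.1 k).1, ← mul_assoc, hcomm _ (hq.1 k).1 _ (hp.1 j).1]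
  simp only [mul_assoc]

theorem IsPartition.sum_prod_comm (hcomm : ∀ a ∈ A, ∀ b ∈ A, a * b = b * a) {κ κ' : Type*}
    [Fintype κ] [Fintype κ'] {p : κ → H →L[ℂ] H} {q : κ' → H →L[ℂ] H} (hp : IsPartition A p)
    (hq : IsPartition A q) (x : H →L[ℂ] H) :
    ∑ j, p j * (∑ k, q k * x * q k) * p j = ∑ k, q k * (∑ j, p j * x * p j) * q k := by
  rw [← hp.sum_prod hcomm hq, ← hq.sum_prod hcomm hp, ← (Equiv.prodComm κ κ').sum_comp]
  refine Finset.sum_congr rfl fun jk _ => ?_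
  simp only [Equiv.prodComm_apply, Prod.fst_swap, Prod.snd_swap]
  rw [hcomm _ (hp.1 jk.1).1 _ (hq.1 jk.2).1]

theorem pinch_mem_nullNets {ι : Type*} [TopologicalSpace ι] {l : Filter ι} {κ : Type*} [Fintype κ]
    {P : κ → ι →ᵇ (H →L[ℂ] H)} {f : ι →ᵇ (H →L[ℂ] H)} (hP : ∀ k, P k ∈ multNets M l)
    (hf : f ∈ nullNets M l) : ∑ k, P k * f * P k ∈ nullNets M l :=
  sum_mem_nullNets _ fun k _ => ((hP k).2 _ ((hP k).2 f hf).1).2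

/-- A normal expectation, applied termwise to bounded sequences. -/
def IsNormalExpectation.mapNet (hF : IsNormalExpectation M A F) (f : ℕ →ᵇ (H →L[ℂ] H))
    (hf : ∀ m, f m ∈ M) : ℕ →ᵇ (H →L[ℂ] H) :=
  bddNet (fun m => F (f m)) (C := ‖f‖) fun m =>
    (hF.norm_le (hf m)).trans (f.norm_coe_le_norm m)

theorem IsNormalExpectation.mapNet_mem_nullNets (hF : IsNormalExpectation M A F)
    (hA : IsMASA A M) {f : ℕ →ᵇ (H →L[ℂ] H)} {l : Filter ℕ} (hf : f ∈ nullNets M l) :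
    hF.mapNet f hf.1 ∈ nullNets M l := by
  refine ⟨fun m => hF.le (hF.mem _ (hf.1 m)),
    hF.strongTendsto_map hA hf.1 f.norm_coe_le_norm hf.2.1, ?_⟩
  refine (hF.strongTendsto_map hA (fun m => star_mem (hf.1 m)) (norm_star_coe_le f)
    hf.2.2).congr fun m => ?_
  exact hF.map_star (hf.1 m)

namespace Ultrapower

/-- The termwise expectation decreases the norm of classes. -/
theorem norm_mk_mapNet_le (hF : IsNormalExpectation M A F) (hA : IsMASA A M)
    (f : multiplier M ω) (h : hF.mapNet f f.2.1 ∈ multiplier M ω) :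
    ‖mk M ω ⟨hF.mapNet f f.2.1, h⟩‖ ≤ ‖mk M ω f‖ := by
  refine le_norm fun g hg => ?_
  -- Applying `F` to any other representative `g` gives the same class, with norm at most that of
  -- `g`.
  have hg' : hF.mapNet g g.2.1 ∈ multiplier M ω :=
    mem_multiplier hF hA fun m => hF.mem _ (g.2.1 m)
  have e : mk M ω ⟨hF.mapNet f f.2.1, h⟩ = mk M ω ⟨hF.mapNet g g.2.1, hg'⟩ := by
    have h1 := hF.mapNet_mem_nullNets hA (mk_eq_mk_iff.1 hg.symm)
    rw [mk_eq_mk_iff]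
    convert h1 using 1
    ext1 m
    exact (hF.map_sub (f.2.1 m) (g.2.1 m)).symm
  rw [e]
  refine (norm_mk_le _).trans ((BoundedContinuousFunction.norm_le (norm_nonneg _)).2 fun m => ?_)
  exact (hF.norm_le (g.2.1 m)).trans (BoundedContinuousFunction.norm_coe_le_norm _ m)

/-- The factor `2` leaves room above the infimum when `‖z‖ > 0`; when `‖z‖ = 0`, closedness of the
null sequences makes `0` a representative. -/
theorem exists_rep_le_two_mul (z : Ultrapower M ω) :
    ∃ f : multiplier M ω, mk M ω f = z ∧ ‖(f : ℕ →ᵇ (H →L[ℂ] H))‖ ≤ 2 * ‖z‖ := by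
  rcases (norm_nonneg' z).eq_or_lt with h | h
  · obtain ⟨f, hf⟩ := mk_surjective z
    refine ⟨0, ?_, ?_⟩
    · refine Eq.trans (mk_eq_mk_iff.2 ?_) hf
      rw [← (isClosed_nullNets M (ω : Filter ℕ)).closure_eq, Metric.mem_closure_iff]
      intro ε hε
      obtain ⟨g, hg, hgn⟩ := exists_rep_lt (h.symm.trans_lt hε)
      refine ⟨_, mk_eq_mk_iff.1 (hg.trans hf.symm), ?_⟩
      rw [dist_eq_norm, sub_sub_sub_cancel_right]
      change ‖(0 : ℕ →ᵇ (H →L[ℂ] H)) - _‖ < ε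
      rwa [zero_sub, norm_neg]
    · change ‖(0 : ℕ →ᵇ (H →L[ℂ] H))‖ ≤ _
      rw [norm_zero, ← h, mul_zero]
  · obtain ⟨f, hf, hfn⟩ := exists_rep_lt (show ‖z‖ < 2 * ‖z‖ by linarith)
    exact ⟨f, hf, hfn.le⟩

/-- Every multiplier is `u + i v` for self-adjoint multipliers `u`, `v` of no larger norm. -/
theorem exists_re_im (f : multiplier M ω) :
    ∃ u v : multiplier M ω,
      (∀ m, IsSelfAdjoint ((u : ℕ →ᵇ (H →L[ℂ] H)) m)) ∧
      (∀ m, IsSelfAdjoint ((v : ℕ →ᵇ (H →L[ℂ] H)) m)) ∧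
      (∀ m, ‖(u : ℕ →ᵇ (H →L[ℂ] H)) m‖ ≤ ‖(f : ℕ →ᵇ (H →L[ℂ] H))‖) ∧
      (∀ m, ‖(v : ℕ →ᵇ (H →L[ℂ] H)) m‖ ≤ ‖(f : ℕ →ᵇ (H →L[ℂ] H))‖) ∧
      ∀ m, (f : ℕ →ᵇ (H →L[ℂ] H)) m =
        (u : ℕ →ᵇ (H →L[ℂ] H)) m + Complex.I • (v : ℕ →ᵇ (H →L[ℂ] H)) m := by
  have hfm : ∀ m, ‖(f : ℕ →ᵇ (H →L[ℂ] H)) m‖ ≤ ‖(f : ℕ →ᵇ (H →L[ℂ] H))‖ :=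
    fun m => BoundedContinuousFunction.norm_coe_le_norm _ m
  have h2 : ‖(2⁻¹ : ℂ)‖ = 2⁻¹ := by norm_num
  refine ⟨⟨(2⁻¹ : ℂ) • ((f : ℕ →ᵇ (H →L[ℂ] H)) + star (f : ℕ →ᵇ (H →L[ℂ] H))),
      (multiplier M ω).smul_mem (add_mem f.2 (star_mem f.2)) _⟩,
    ⟨(-Complex.I * 2⁻¹ : ℂ) • ((f : ℕ →ᵇ (H →L[ℂ] H)) - star (f : ℕ →ᵇ (H →L[ℂ] H))),
      (multiplier M ω).smul_mem (sub_mem f.2 (star_mem f.2)) _⟩,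
    fun m => ?_, fun m => ?_, fun m => ?_, fun m => ?_, fun m => ?_⟩
  · change IsSelfAdjoint
      ((2⁻¹ : ℂ) • ((f : ℕ →ᵇ (H →L[ℂ] H)) m + star ((f : ℕ →ᵇ (H →L[ℂ] H)) m)))
    rw [IsSelfAdjoint, star_smul, star_add, star_star, add_comm]
    simp
  · change IsSelfAdjoint
      ((-Complex.I * 2⁻¹ : ℂ) • ((f : ℕ →ᵇ (H →L[ℂ] H)) m - star ((f : ℕ →ᵇ (H →L[ℂ] H)) m)))
    rw [IsSelfAdjoint, star_smul, star_sub, star_star]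
    have : star (-Complex.I * 2⁻¹ : ℂ) = -(-Complex.I * 2⁻¹) := by simp
    rw [this, neg_smul, ← smul_neg, neg_sub]
  · change ‖(2⁻¹ : ℂ) • ((f : ℕ →ᵇ (H →L[ℂ] H)) m + star ((f : ℕ →ᵇ (H →L[ℂ] H)) m))‖ ≤ _
    have h4 := norm_add_le ((f : ℕ →ᵇ (H →L[ℂ] H)) m) (star ((f : ℕ →ᵇ (H →L[ℂ] H)) m))
    rw [norm_star] at h4
    rw [norm_smul, h2]
    linarith [hfm m]
  · change ‖(-Complex.I * 2⁻¹ : ℂ) •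
      ((f : ℕ →ᵇ (H →L[ℂ] H)) m - star ((f : ℕ →ᵇ (H →L[ℂ] H)) m))‖ ≤ _
    have h4 := norm_sub_le ((f : ℕ →ᵇ (H →L[ℂ] H)) m) (star ((f : ℕ →ᵇ (H →L[ℂ] H)) m))
    rw [norm_star] at h4
    rw [norm_smul, norm_mul, norm_neg, Complex.norm_I, one_mul, h2]
    linarith [hfm m]
  · change _ = (2⁻¹ : ℂ) • ((f : ℕ →ᵇ (H →L[ℂ] H)) m + star ((f : ℕ →ᵇ (H →L[ℂ] H)) m)) +
      Complex.I • (-Complex.I * 2⁻¹ : ℂ) •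
        ((f : ℕ →ᵇ (H →L[ℂ] H)) m - star ((f : ℕ →ᵇ (H →L[ℂ] H)) m))
    have : Complex.I * (-Complex.I * 2⁻¹) = 2⁻¹ := by
      rw [← mul_assoc, mul_neg, Complex.I_mul_I, neg_neg, one_mul]
    rw [smul_smul, this]
    module

/-- Uniform so-paving of the self-adjoint elements of `M` gives uniform norm paving of all
elements of the ultrapower. -/
theorem isPavableWith_of_forall_isSoPavableWith (hF : IsNormalExpectation M A F)
    (hA : IsMASA A M) (hφ : IsCountablyDecomposable A) (hω : (ω : Filter ℕ) ≤ Filter.cofinite)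
    {n : ℕ} {ε : ℝ} (hε : 0 < ε)
    (h : ∀ x ∈ M, IsSelfAdjoint x → IsSoPavableWith M A ε n x) (z : Ultrapower M ω) :
    IsPavableWith (ofSubalgebra M ω A) (8 * ε) (n * n) z := by
  have hcomm : ∀ a ∈ A, ∀ b ∈ A, a * b = b * a := fun a ha b hb => hA.commute ha hb
  obtain ⟨f, rfl, hfn⟩ := exists_rep_le_two_mul z
  obtain ⟨u, v, hus, hvs, hun, hvn, huv⟩ := exists_re_im f
  obtain ⟨p, a, g, y, hp, ha, -, hg, hy, e⟩ := exists_multiplier_paving hF hA hφ hω hε u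
    (fun m => (hun m).trans hfn) fun m => h _ (u.2.1 m) (hus m)
  obtain ⟨p', a', g', y', hp', ha', -, hg', hy', e'⟩ := exists_multiplier_paving hF hA hφ hω hε v
    (fun m => (hvn m).trans hfn) fun m => h _ (v.2.1 m) (hvs m)
  set K := ε * (2 * ‖mk M ω f‖) with hK
  have hK0 : 0 ≤ K := (norm_nonneg g).trans hg
  let P : Fin n → ℕ →ᵇ (H →L[ℂ] H) := fun k =>
    bddNet (fun m => p m k) fun m => ((hp m).1 k).2.norm_le
  let P' : Fin n → ℕ →ᵇ (H →L[ℂ] H) := fun k =>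
    bddNet (fun m => p' m k) fun m => ((hp' m).1 k).2.norm_le
  have hP : ∀ k, P k ∈ multNets M (ω : Filter ℕ) := fun k =>
    hF.mem_multNets hA fun m => ((hp m).1 k).1
  have hP' : ∀ k, P' k ∈ multNets M (ω : Filter ℕ) := fun k =>
    hF.mem_multNets hA fun m => ((hp' m).1 k).1
  let Y : ℕ →ᵇ (H →L[ℂ] H) := ∑ k, P' k * y * P' k + Complex.I • ∑ k, P k * y' * P k
  have hY : Y ∈ nullNets M (ω : Filter ℕ) :=
    add_mem_nullNets (pinch_mem_nullNets hP' hy)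
      (smul_mem_nullNets _ (pinch_mem_nullNets hP hy'))
  have hYm : ∀ m, Y m = ∑ k, p' m k * y m * p' m k + Complex.I • ∑ k, p m k * y' m * p m k := by
    intro m
    simp only [Y, BoundedContinuousFunction.add_apply, BoundedContinuousFunction.sum_apply,
      BoundedContinuousFunction.smul_apply]
    rfl
  let G : ℕ → H →L[ℂ] H := fun m =>
    ∑ k, p' m k * g m * p' m k + Complex.I • ∑ k, p m k * g' m * p m k
  have hGn : ∀ m, ‖G m‖ ≤ K + K := fun m => by
    refine (norm_add_le _ _).trans (add_le_add ?_ ?_)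
    · exact ((hp' m).norm_pinch_le _).trans ((g.norm_coe_le_norm m).trans hg)
    · rw [norm_smul, Complex.norm_I, one_mul]
      exact ((hp m).norm_pinch_le _).trans ((g'.norm_coe_le_norm m).trans hg')
  let b : ℕ → H →L[ℂ] H := fun m =>
    (a : ℕ →ᵇ (H →L[ℂ] H)) m + Complex.I • (a' : ℕ →ᵇ (H →L[ℂ] H)) m
  have hb : ∀ m, b m ∈ A := fun m => add_mem (ha m) (smul_mem_vn _ (ha' m))
  -- The common refinement paves both parts: pinching the paving of `u` by `p'`, or that of `v` by
  -- `p`, fixes elements of `A`, contracts the bounded error and keeps the null error null.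
  let r : ℕ → Fin n × Fin n → H →L[ℂ] H := fun m jk => p m jk.1 * p' m jk.2
  have hr : ∀ m, IsPartition A (r m) := fun m => (hp m).prod hcomm (hp' m)
  have hrf : ∀ m, ∑ jk, r m jk * (f : ℕ →ᵇ (H →L[ℂ] H)) m * r m jk = b m + (G m + Y m) := by
    intro m
    have e1 : ∀ x : H →L[ℂ] H, ∀ c ∈ A, ∀ k : Fin n → H →L[ℂ] H, IsPartition A k →
        ∀ s t : H →L[ℂ] H, x - c = s + t →
        ∑ j, k j * x * k j = c + (∑ j, k j * s * k j + ∑ j, k j * t * k j) := by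
      intro x c hc k hk s t hx
      rw [sub_eq_iff_eq_add.1 hx]
      simp only [mul_add, add_mul, Finset.sum_add_distrib]
      rw [hk.pinch_of_commute fun j => hcomm _ hc _ (hk.1 j).1]
      abel
    have e2 := e1 _ _ (ha m) _ (hp' m) _ _ (e m)
    have e3 := e1 _ _ (ha' m) _ (hp m) _ _ (e' m)
    have e4 : ∑ j, p m j * (∑ k, p' m k * (f : ℕ →ᵇ (H →L[ℂ] H)) m * p' m k) * p m j =
        ∑ j, p m j * (∑ k, p' m k * (u : ℕ →ᵇ (H →L[ℂ] H)) m * p' m k) * p m j +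
        Complex.I • ∑ j, p m j * (∑ k, p' m k * (v : ℕ →ᵇ (H →L[ℂ] H)) m * p' m k) * p m j := by
      rw [huv m]
      simp only [mul_add, add_mul, Finset.sum_add_distrib, mul_smul_comm, smul_mul_assoc,
        ← Finset.smul_sum]
    rw [(hp m).sum_prod hcomm (hp' m), e4, (hp m).sum_prod_comm hcomm (hp' m), e2, e3, hYm m]
    simp only [b, G, smul_add]
    abel
  have hYM : ∀ m, Y m ∈ M := hY.1
  have hrM : ∀ m, ∑ jk, r m jk * (f : ℕ →ᵇ (H →L[ℂ] H)) m * r m jk ∈ M := fun m =>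
    sum_mem fun k _ => mul_mem (mul_mem (hF.le ((hr m).1 k).1) (f.2.1 m)) (hF.le ((hr m).1 k).1)
  have hGM : ∀ m, G m ∈ M := fun m => by
    have : G m = ∑ jk, r m jk * (f : ℕ →ᵇ (H →L[ℂ] H)) m * r m jk - b m - Y m := by
      rw [hrf]; abel
    rw [this]
    exact sub_mem (sub_mem (hrM m) (hF.le (hb m))) (hYM m)
  -- The element of `A^ω` is the class of `F f` rather than of `b`: its norm is at most that of the
  -- class of `f`, while `b` is only controlled by a sum of two bounds.
  have hmap : ∀ m, F ((f : ℕ →ᵇ (H →L[ℂ] H)) m) = b m + (F (G m) + F (Y m)) := fun m => by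
    rw [← (hr m).map_pinch hF hA (f.2.1 m), hrf,
      hF.map_add _ (hF.le (hb m)) _ (add_mem (hGM m) (hYM m)), hF.map_add _ (hGM m) _ (hYM m),
      hF.map_of_mem _ (hb m)]
  have hmem : hF.mapNet f f.2.1 ∈ multiplier M ω :=
    mem_multiplier hF hA fun m => hF.mem _ (f.2.1 m)
  -- Three doublings give `8 ε`: the representative of norm at most `2 ‖z‖`, the two parts, and the
  -- subtraction of `F (G m)`.
  have hGFn : ∀ m, ‖G m - F (G m)‖ ≤ 4 * K := fun m => by
    refine (norm_sub_le _ _).trans ?_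
    linarith [hGn m, hF.norm_le (hGM m)]
  refine isPavableWith_of_rep hF hA f (p := fun m k => r m (finProdFinEquiv.symm k))
    (fun m => (hr m).reindex finProdFinEquiv.symm) (a := ⟨_, hmem⟩) (fun m => hF.mem _ (f.2.1 m))
    (norm_mk_mapNet_le hF hA f hmem) (g := bddNet _ hGFn) (y := Y - hF.mapNet Y hYM) ?_
    (sub_mem_nullNets hY (hF.mapNet_mem_nullNets hA hY)) fun m => ?_
  · refine (BoundedContinuousFunction.norm_le
      (mul_nonneg (by positivity) (norm_nonneg' _))).2 fun m => (hGFn m).trans_eq ?_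
    rw [hK]; ring
  · rw [finProdFinEquiv.symm.sum_comp fun jk => r m jk * (f : ℕ →ᵇ (H →L[ℂ] H)) m * r m jk, hrf]
    change _ - F ((f : ℕ →ᵇ (H →L[ℂ] H)) m) = (G m - F (G m)) + (Y m - F (Y m))
    rw [hmap]
    abel

end Ultrapower

end Uniform

end Paving

end

theorem theorem2p5 {H : Type*} [NormedAddCommGroup H] [InnerProductSpace ℂ H] [CompleteSpace H]
    (M A : VonNeumannAlgebra H) (hA : Paving.IsMASA A M)
    (hE : ∃ E : M.toStarSubalgebra →ₗ[ℂ] A.toStarSubalgebra,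
      Paving.IsNormalConditionalExpectation M A E)
    (ω : Ultrafilter ℕ) (hω : (ω : Filter ℕ) ≤ Filter.cofinite) :
    -- so-pavability and app-pavability, with constants
    ((∀ x ∈ M, IsSelfAdjoint x →
        (∀ (n : ℕ) (ε κ : ℝ), 0 < ε → 1 ≤ κ → Paving.IsAppPavableWith M A ε n κ x →
          ∀ ε' : ℝ, ε < ε' → Paving.IsSoPavableWith M A (2 * κ * ε') n x) ∧
        (∀ (n : ℕ) (ε : ℝ), 0 < ε → Paving.IsSoPavableWith M A ε n x →
          ∀ ε' : ℝ, ε < ε' → Paving.IsAppPavableWith M A ε' n 3 x) ∧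
        (Paving.IsSoPavable M A x ↔ Paving.IsAppPavable M A x)) ∧
      (Paving.SoPavingProperty M A ↔ Paving.AppPavingProperty M A)) ∧
    (Paving.IsCountablyDecomposable A →
      -- so-pavability over `A` and norm pavability over `A^ω`
      (∀ (x : H →L[ℂ] H) (hx : x ∈ M), IsSelfAdjoint x →
        (Paving.IsSoPavable M A x ↔
          Paving.IsPavable (Paving.Ultrapower.ofSubalgebra M ω A)
            (Paving.Ultrapower.ofElement ω x hx)) ∧
        (∀ (n : ℕ) (ε : ℝ), 0 < ε → Paving.IsSoPavableWith M A ε n x →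
          Paving.IsPavableWith (Paving.Ultrapower.ofSubalgebra M ω A) ε n
            (Paving.Ultrapower.ofElement ω x hx)) ∧
        (∀ (n : ℕ) (ε : ℝ), 0 < ε →
          Paving.IsPavableWith (Paving.Ultrapower.ofSubalgebra M ω A) ε n
            (Paving.Ultrapower.ofElement ω x hx) →
          ∀ ε' : ℝ, ε < ε' → Paving.IsSoPavableWith M A ε' n x)) ∧
      -- uniform so-paving of `A ⊆ M` and uniform norm paving of `A^ω ⊆ M^ω`
      (Paving.UniformSoPaving M A ↔
        Paving.UniformPaving (Paving.Ultrapower.ofSubalgebra M ω A)) ∧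
      (∀ (n : ℕ) (ε : ℝ), 0 < ε →
        (∀ x ∈ M, IsSelfAdjoint x → Paving.IsSoPavableWith M A ε n x) →
        ∀ z : Paving.Ultrapower M ω, IsSelfAdjoint z →
          Paving.IsPavableWith (Paving.Ultrapower.ofSubalgebra M ω A) ε n z)) := by
  obtain ⟨E, hE⟩ := hE
  obtain ⟨F, hF⟩ := hE.exists_expectation hA.1
  refine ⟨⟨fun x hx hxs => ⟨fun n ε κ hε hκ h ε' hε' => ?_, fun n ε hε h ε' hε' => ?_, ?_⟩, ?_⟩,
    fun hφ => ⟨fun x hx hxs => ⟨⟨fun h ε hε => ?_, fun h ε hε => ?_⟩, fun n ε hε h => ?_,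
      fun n ε hε h ε' hε' => ?_⟩, ⟨fun h ε hε => ?_, fun h ε hε => ?_⟩, fun n ε hε h z hz => ?_⟩⟩
  · exact Paving.isSoPavableWith_of_isAppPavableWith hF hA hx hε hκ h hε'
  · exact Paving.isAppPavableWith_of_isSoPavableWith hF hA hx hxs hε h hε'
  · exact Paving.isSoPavable_iff_isAppPavable hF hA hx hxs
  · exact forall₃_congr fun x hx hxs => Paving.isSoPavable_iff_isAppPavable hF hA hx hxs
  · obtain ⟨n, hn⟩ := h ε hε
    exact ⟨n, Paving.Ultrapower.isPavableWith_ofElement hF hA hφ hω hε hx hn⟩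
  · obtain ⟨n, hn⟩ := h (ε / 2) (half_pos hε)
    exact ⟨n, Paving.Ultrapower.isSoPavableWith_of_isPavableWith hF hA hx hn (half_lt_self hε)⟩
  · exact Paving.Ultrapower.isPavableWith_ofElement hF hA hφ hω hε hx h
  · exact Paving.Ultrapower.isSoPavableWith_of_isPavableWith hF hA hx h hε'
  · obtain ⟨n, hn⟩ := h (ε / 8) (by positivity)
    refine ⟨n * n, fun z => ?_⟩
    have := Paving.Ultrapower.isPavableWith_of_forall_isSoPavableWith hF hA hφ hω
      (by positivity) hn z
    rwa [mul_div_cancel₀ ε (by norm_num)] at this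
  · obtain ⟨n, hn⟩ := h (ε / 2) (half_pos hε)
    -- Only classes of constant sequences are used; halving `ε` supplies the strict slack.
    exact ⟨n, fun x hx _ =>
      Paving.Ultrapower.isSoPavableWith_of_isPavableWith hF hA hx (hn _) (half_lt_self hε)⟩
  · exact Paving.Ultrapower.isPavableWith_of_isSelfAdjoint hF hA hφ hω hε h hz
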